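/- Let $k$ be a field, let $X$ and $Y$ be separated $k$-schemes locally of finite type, and let $\varphi:X\to Y$ be a $k$-morphism. Assume that $Y$ is smooth over $k$, that $X$ is a locally complete intersection over $k$, and that the étale locus $U\subset X$ of $\varphi$ is dense. Let $\Delta_X\subset X$ be the different of $\varphi$, i.e. the effective Cartier divisor attached by Knudsen and Mumford to $\Omega^1_{X/Y}$: locally $\Omega^1_{X/Y}$ has a resolution $0\to\mathcal O^n\xrightarrow{A}\mathcal O^n\to\Omega^1_{X/Y}\to 0$ and $\Delta_X$ is given by the equation $\det A=0$. Products without subscript are over $k$. Let $I_1\supset I_2$ be the ideals in $\mathcal O_{X\times X}$ of the diagonal and of $X\times_Y X$, let $D=\Delta_X\times X$, $\tilde D=X\times\Delta_X$, and let $j:U\times U\hookrightarrow X\times X$ be the open immersion. For an integer $r\ge 2$ let $\mathcal A_r\subset j_*\mathcal O_{U\times U}$ be the $\mathcal O_{X\times X}$-subalgebra generated by $I_1((r-1)D)$, $I_2(rD)$, $I_1((r-1)\tilde D)$, $I_2(r\tilde D)$, and let $\Gamma_r=\operatorname{Spec}\mathcal A_r$, a scheme affine over $X\times X$, with the two morphisms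 $p_1,p_2:\Gamma_r\to X$. Then for every $r\ge 2$ there is exactly one structure of a groupoid on $X$, in the category of schemes, on each of $\Gamma_r\to X\times X$ and $\Gamma_{r+1}\to X\times X$ (with source $p_1$ and target $p_2$). Let $e:X\to\Gamma_r$ be the unit. The following hold. (i) There is exactly one morphism $f:\Gamma_{r+1}\to\Gamma_r$ of schemes over $X\times X$, and $f$ is a morphism of groupoids. (ii) The morphism $\Gamma_{r+1}\times_{X\times X}(\Delta_X\times\Delta_X)\to\Gamma_r\times_{X\times X}(\Delta_X\times\Delta_X)$ induced by $f$ is trivial: for both $i=1$ and $i=2$ it equals the composition $$\Gamma_{r+1}\times_{X\times X}(\Delta_X\times\Delta_X)\xrightarrow{p_i}\Delta_X\xrightarrow{e}\Gamma_r\times_{X\times X}(\Delta_X\times\Delta_X).$$ (iii) The preimages of $\Delta_X$ under $p_1,p_2:\Gamma_r\to X$ are the same closed subscheme $\Delta_r\subset\Gamma_r$. The open immersion $j$ lifts to an open immersion $\nu:U\times U\to\Gamma_r$ (given by $\mathcal A_r\subset j_*\mathcal O_{U\times U}$). Let $I\subset\mathcal O_{\Gamma_r}$ be the ideal of $e(\Delta_X)$,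 and let $\mathcal B\subset\nu_*\mathcal O_{U\times U}$ be the unital $\mathcal O_{\Gamma_r}$-subalgebra generated by $I(\Delta_r)$. Then $f$ is affine and $\Gamma_{r+1}=\operatorname{Spec}\mathcal B$ as schemes over $\Gamma_r$, compatibly with the canonical morphisms from $U\times U$ to both sides. (iv) Regard $\Gamma_r$ and $\Gamma_{r+1}$ as $X$-schemes via $p_1$ (or both via $p_2$). For every scheme $S$ flat over $X$ the map $\operatorname{Mor}_X(S,\Gamma_{r+1})\to\operatorname{Mor}_X(S,\Gamma_r)$ given by composition with $f$ is injective, and an $X$-morphism $S\to\Gamma_r$ belongs to its image if and only if its restriction to $S\times_X\Delta_X$ equals the composition $S\times_X\Delta_X\to\Delta_X\xrightarrow{e}\Gamma_r$. -/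

import Mathlib

universe u

open CategoryTheory CategoryTheory.Limits AlgebraicGeometry

namespace Newton

noncomputable section

section QCSubalgebra

variable {U Z : Scheme.{u}} (ν : U ⟶ Z)

/-- Restriction of sections of `ν_* 𝒪_U` from `W` to `V`. -/
abbrev res {V W : Z.Opens} (h : V ≤ W) : Γ(U, ν ⁻¹ᵁ W) →+* Γ(U, ν ⁻¹ᵁ V) :=
  (U.presheaf.map (homOfLE (ν.preimage_mono h)).op).hom

/-- The structure map `𝒪_Z ⟶ ν_* 𝒪_U` over `W`. -/
abbrev toPush (W : Z.Opens) : Γ(Z, W) →+* Γ(U, ν ⁻¹ᵁ W) := (ν.app W).hom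

/-- A family of sets of sections of `ν_* 𝒪_U` over the affine open subsets of `Z` that is stable
under restriction, and such that each member of the family over a basic open subset `D(f)` of `W`
becomes, after multiplication by a power of `f`, the restriction of a member over `W`. This is
satisfied by the sections of a quasi-coherent `𝒪_Z`-submodule of `ν_* 𝒪_U`. -/
structure SectionFamily where
  carrier : ∀ W : Z.affineOpens, Set Γ(U, ν ⁻¹ᵁ W.1)
  res_mem : ∀ {V W : Z.affineOpens} (h : V.1 ≤ W.1) (s : Γ(U, ν ⁻¹ᵁ W.1)),
    s ∈ carrier W → res ν h s ∈ carrier V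
  exists_mem : ∀ {V W : Z.affineOpens} (h : V.1 ≤ W.1) (f : Γ(Z, W.1)),
    V.1 = Z.basicOpen f → ∀ s ∈ carrier V,
      ∃ n : ℕ, ∃ a ∈ carrier W, res ν h a = res ν h (toPush ν W.1 f) ^ n * s

/-- A quasi-coherent `𝒪_Z`-subalgebra `A` of `ν_* 𝒪_U` (for quasi-compact and quasi-separated `ν`),
given by its sections over the affine open subsets of `Z`. By `isLocalization_resRing` below, the
last condition says that `A(D(f)) = A(W)[1/f]`. -/
structure QCSubalgebra where
  ring : ∀ W : Z.affineOpens, Subring Γ(U, ν ⁻¹ᵁ W.1)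
  app_mem : ∀ (W : Z.affineOpens) (f : Γ(Z, W.1)), toPush ν W.1 f ∈ ring W
  res_mem : ∀ {V W : Z.affineOpens} (h : V.1 ≤ W.1) (s : Γ(U, ν ⁻¹ᵁ W.1)),
    s ∈ ring W → res ν h s ∈ ring V
  exists_mem : ∀ {V W : Z.affineOpens} (h : V.1 ≤ W.1) (f : Γ(Z, W.1)),
    V.1 = Z.basicOpen f → ∀ s ∈ ring V,
      ∃ n : ℕ, ∃ a ∈ ring W, res ν h a = res ν h (toPush ν W.1 f) ^ n * s

variable {ν}

lemma res_toPush {V W : Z.Opens} (h : V ≤ W) (f : Γ(Z, W)) :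
    res ν h (toPush ν W f) = toPush ν V ((Z.presheaf.map (homOfLE h).op).hom f) := by
  simp

lemma isLocalization_res [QuasiCompact ν] [QuasiSeparated ν] {V W : Z.affineOpens}
    (h : V.1 ≤ W.1) (f : Γ(Z, W.1)) (hV : V.1 = Z.basicOpen f) :
    letI := (res ν h).toAlgebra
    IsLocalization.Away (toPush ν W.1 f) Γ(U, ν ⁻¹ᵁ V.1) := by
  obtain ⟨V, hV'⟩ := V
  dsimp at hV h ⊢
  subst hV
  have key := isLocalization_basicOpen_of_qcqs (ν.isCompact_preimage W.2.isCompact)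
      (ν.isQuasiSeparated_preimage W.2.isQuasiSeparated) (ν.app _ f)
  have H : ∀ (V : U.Opens) (hV : V = U.basicOpen (ν.app W.1 f)) (h : V ≤ ν ⁻¹ᵁ W.1),
      letI := (U.presheaf.map (homOfLE h).op).hom.toAlgebra
      IsLocalization.Away (toPush ν W.1 f) Γ(U, V) := by
    rintro _ rfl h
    exact key
  exact H _ (ν.preimage_basicOpen f) _

lemma exists_lift [QuasiCompact ν] [QuasiSeparated ν] {V W : Z.affineOpens}
    (h : V.1 ≤ W.1) (f : Γ(Z, W.1)) (hV : V.1 = Z.basicOpen f) (s : Γ(U, ν ⁻¹ᵁ V.1)) :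
    ∃ (n : ℕ) (a : Γ(U, ν ⁻¹ᵁ W.1)), res ν h a = res ν h (toPush ν W.1 f) ^ n * s := by
  let := (res ν h).toAlgebra
  have := isLocalization_res (ν := ν) h f hV
  obtain ⟨⟨a, _, n, rfl⟩, h⟩ := IsLocalization.surj (.powers (toPush ν W.1 f)) s
  refine ⟨n, a, ?_⟩
  simp only [map_pow] at h
  rw [mul_comm]; exact h.symm

lemma exists_pow_mul_eq_zero [QuasiCompact ν] [QuasiSeparated ν] {V W : Z.affineOpens}
    (h : V.1 ≤ W.1) (f : Γ(Z, W.1)) (hV : V.1 = Z.basicOpen f)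
    (s : Γ(U, ν ⁻¹ᵁ W.1)) (hs : res ν h s = 0) :
    ∃ n : ℕ, toPush ν W.1 f ^ n * s = 0 := by
  let := (res ν h).toAlgebra
  have := isLocalization_res (ν := ν) h f hV
  obtain ⟨⟨_, n, rfl⟩, h⟩ := (IsLocalization.map_eq_zero_iff (.powers (toPush ν W.1 f))
    Γ(U, ν ⁻¹ᵁ V.1) s).mp hs
  exact ⟨n, h⟩

lemma isUnit_res {V W : Z.affineOpens}
    (h : V.1 ≤ W.1) (f : Γ(Z, W.1)) (hV : V.1 = Z.basicOpen f) :
    IsUnit (res ν h (toPush ν W.1 f)) := by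
  rw [res_toPush]
  refine IsUnit.map _ ?_
  obtain ⟨V, hV'⟩ := V
  dsimp at hV h ⊢
  subst hV
  exact RingedSpace.isUnit_res_basicOpen _ f

/-- Sections over a basic open subset are fractions. -/
lemma exists_lift_base {V W : Z.affineOpens}
    (h : V.1 ≤ W.1) (f : Γ(Z, W.1)) (hV : V.1 = Z.basicOpen f) (y : Γ(Z, V.1)) :
    ∃ (n : ℕ) (a : Γ(Z, W.1)), (Z.presheaf.map (homOfLE h).op).hom a =
      (Z.presheaf.map (homOfLE h).op).hom f ^ n * y := by
  let := (Z.presheaf.map (homOfLE h).op).hom.toAlgebra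
  have : IsLocalization.Away f Γ(Z, V.1) := W.2.isLocalization_of_eq_basicOpen f (homOfLE h) hV
  obtain ⟨⟨a, _, n, rfl⟩, h⟩ := IsLocalization.surj (.powers f) y
  refine ⟨n, a, ?_⟩
  simp only [map_pow] at h
  rw [mul_comm]; exact h.symm

lemma exists_lift_ideal (I : Z.IdealSheafData) {V W : Z.affineOpens}
    (h : V.1 ≤ W.1) (f : Γ(Z, W.1)) (hV : V.1 = Z.basicOpen f) (y : Γ(Z, V.1))
    (hy : y ∈ I.ideal V) :
    ∃ (n : ℕ), ∃ a ∈ I.ideal W, (Z.presheaf.map (homOfLE h).op).hom a =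
      (Z.presheaf.map (homOfLE h).op).hom f ^ n * y := by
  let := (Z.presheaf.map (homOfLE h).op).hom.toAlgebra
  have : IsLocalization.Away f Γ(Z, V.1) := W.2.isLocalization_of_eq_basicOpen f (homOfLE h) hV
  rw [← I.map_ideal (U := V) (V := W) h] at hy
  obtain ⟨⟨⟨a, ha⟩, ⟨_, n, rfl⟩⟩, h⟩ :=
    (IsLocalization.mem_map_algebraMap_iff (.powers f) Γ(Z, V.1)).mp hy
  refine ⟨n, a, ha, ?_⟩
  simp only [map_pow] at h
  rw [mul_comm]; exact h.symm

/-- The union of two families of sections. -/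
def SectionFamily.union (F G : SectionFamily ν) : SectionFamily ν where
  carrier W := F.carrier W ∪ G.carrier W
  res_mem h s := Or.imp (F.res_mem h s) (G.res_mem h s)
  exists_mem h f hV s hs := by
    rcases hs with hs | hs
    · obtain ⟨n, a, ha, h⟩ := F.exists_mem h f hV s hs
      exact ⟨n, a, Or.inl ha, h⟩
    · obtain ⟨n, a, ha, h⟩ := G.exists_mem h f hV s hs
      exact ⟨n, a, Or.inr ha, h⟩

/-- The unital `𝒪_Z`-subalgebra of `ν_* 𝒪_U` generated by a family of sections. -/
def SectionFamily.adjoin (F : SectionFamily ν) : QCSubalgebra ν where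
  ring W := Subring.closure (Set.range (toPush ν W.1) ∪ F.carrier W)
  app_mem W f := Subring.subset_closure (Or.inl ⟨f, rfl⟩)
  res_mem {V W} h s hs := by
    have : Subring.closure (Set.range (toPush ν W.1) ∪ F.carrier W) ≤
        (Subring.closure (Set.range (toPush ν V.1) ∪ F.carrier V)).comap (res ν h) := by
      rw [Subring.closure_le]
      rintro _ (⟨f, rfl⟩ | hs)
      · exact Subring.subset_closure (Or.inl ⟨_, (res_toPush h f).symm⟩)
      · exact Subring.subset_closure (Or.inr (F.res_mem h _ hs))
    exact this hs
  exists_mem {V W} h f hV s hs := by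
    set A := Subring.closure (Set.range (toPush ν W.1) ∪ F.carrier W)
    have hf : toPush ν W.1 f ∈ A := Subring.subset_closure (Or.inl ⟨f, rfl⟩)
    induction hs using Subring.closure_induction with
    | mem x hx =>
      rcases hx with ⟨y, rfl⟩ | hx
      · obtain ⟨n, a, e⟩ := exists_lift_base h f hV y
        refine ⟨n, toPush ν W.1 a, Subring.subset_closure (Or.inl ⟨a, rfl⟩), ?_⟩
        rw [res_toPush, res_toPush, e, map_mul, map_pow]
      · obtain ⟨n, a, ha, h⟩ := F.exists_mem h f hV x hx
        exact ⟨n, a, Subring.subset_closure (Or.inr ha), h⟩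
    | zero => exact ⟨0, 0, A.zero_mem, by rw [map_zero, mul_zero]⟩
    | one => exact ⟨0, 1, A.one_mem, by rw [map_one, pow_zero, mul_one]⟩
    | add x y _ _ hx hy =>
      obtain ⟨n, a, ha, h⟩ := hx
      obtain ⟨m, b, hb, h'⟩ := hy
      refine ⟨n + m, toPush ν W.1 f ^ m * a + toPush ν W.1 f ^ n * b,
        A.add_mem (A.mul_mem (A.pow_mem hf _) ha) (A.mul_mem (A.pow_mem hf _) hb), ?_⟩
      simp only [map_add, map_mul, map_pow, h, h']
      ring
    | neg x _ hx =>
      obtain ⟨n, a, ha, h⟩ := hx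
      exact ⟨n, -a, A.neg_mem ha, by rw [map_neg, h, mul_neg]⟩
    | mul x y _ _ hx hy =>
      obtain ⟨n, a, ha, h⟩ := hx
      obtain ⟨m, b, hb, h'⟩ := hy
      refine ⟨n + m, a * b, A.mul_mem ha hb, ?_⟩
      simp only [map_mul, h, h']
      ring

/-- The family of sections of the submodule `I(nE)` of `ν_* 𝒪_U`, where `E` is the closed
subscheme with ideal `J`: the sections `s` such that `𝒪(-nE) s = J ^ n s` is contained in (the
image of) `I`. When `E` is an effective Cartier divisor that is disjoint from the image of `U` and
`ν` is a schematically dense open immersion, this is the usual twist `I(nE) = I ⊗ 𝒪(nE)`. -/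
def twist [QuasiCompact ν] [QuasiSeparated ν] (I J : Z.IdealSheafData)
    (hJ : ∀ W, (J.ideal W).FG) (n : ℕ) : SectionFamily ν where
  carrier W := {s | ∀ t ∈ J.ideal W ^ n, ∃ i ∈ I.ideal W, toPush ν W.1 t * s = toPush ν W.1 i}
  res_mem {V W} h s hs t ht := by
    rw [← J.map_ideal (U := V) (V := W) h, ← Ideal.map_pow] at ht
    induction ht using Submodule.span_induction with
    | mem x hx =>
      obtain ⟨t, ht, rfl⟩ := hx
      obtain ⟨i, hi, e⟩ := hs t ht
      refine ⟨(Z.presheaf.map (homOfLE h).op).hom i, ?_, ?_⟩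
      · rw [← I.map_ideal (U := V) (V := W) h]
        exact Ideal.mem_map_of_mem _ hi
      · rw [← res_toPush, ← e, map_mul, res_toPush]; rfl
    | zero => exact ⟨0, Ideal.zero_mem _, by rw [map_zero, zero_mul]⟩
    | add x y _ _ hx hy =>
      obtain ⟨i, hi, e⟩ := hx
      obtain ⟨i', hi', e'⟩ := hy
      exact ⟨i + i', Ideal.add_mem _ hi hi', by rw [map_add, add_mul, e, e', map_add]⟩
    | smul a x _ hx =>
      obtain ⟨i, hi, e⟩ := hx
      exact ⟨a * i, Ideal.mul_mem_left _ _ hi, by rw [smul_eq_mul, map_mul, mul_assoc, e, map_mul]⟩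
  exists_mem {V W} h f hV s hs := by
    set φ := toPush ν W.1
    obtain ⟨N, s', hs'⟩ := exists_lift h f hV s
    -- for each `t` some power of `f` works
    have key : ∀ t ∈ J.ideal W ^ n, ∃ L : ℕ, ∃ i ∈ I.ideal W, φ t * (φ f ^ L * s') = φ i := by
      intro t ht
      have ht' : (Z.presheaf.map (homOfLE h).op).hom t ∈ J.ideal V ^ n := by
        rw [← J.map_ideal (U := V) (V := W) h, ← Ideal.map_pow]
        exact Ideal.mem_map_of_mem _ ht
      obtain ⟨i, hi, e⟩ := hs _ ht'
      obtain ⟨M, i', hi', e'⟩ := exists_lift_ideal I h f hV i hi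
      have h0 : res ν h (φ f ^ M * (φ t * s') - φ (f ^ N * i')) = 0 := by
        rw [map_sub, sub_eq_zero]
        simp only [φ, map_mul, map_pow, hs']
        rw [res_toPush h i', e', res_toPush h f, res_toPush h t, map_mul, map_pow, ← e]
        ring
      obtain ⟨L, hL⟩ := exists_pow_mul_eq_zero h f hV _ h0
      refine ⟨L + M, f ^ L * (f ^ N * i'), Ideal.mul_mem_left _ _ (Ideal.mul_mem_left _ _ hi'), ?_⟩
      rw [mul_sub, sub_eq_zero] at hL
      rw [map_mul, map_pow, ← hL]
      ring
    obtain ⟨T, hT⟩ := (hJ W).pow (n := n)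
    have hTm : ∀ t ∈ T, t ∈ J.ideal W ^ n := fun t ht => hT ▸ Submodule.subset_span ht
    choose! L hL using fun t ht => key t (hTm t ht)
    refine ⟨T.sup L + N, φ f ^ T.sup L * s', ?_, ?_⟩
    · intro t ht
      rw [← hT] at ht
      induction ht using Submodule.span_induction with
      | mem x hx =>
        obtain ⟨i, hi, e⟩ := hL x hx
        refine ⟨f ^ (T.sup L - L x) * i, Ideal.mul_mem_left _ _ hi, ?_⟩
        rw [map_mul φ, ← e, map_pow φ]
        have : T.sup L = (T.sup L - L x) + L x := (Nat.sub_add_cancel (Finset.le_sup hx)).symm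
        conv_lhs => rw [this, pow_add]
        ring
      | zero => exact ⟨0, Ideal.zero_mem _, by rw [map_zero, zero_mul]⟩
      | add x y _ _ hx hy =>
        obtain ⟨i, hi, e⟩ := hx
        obtain ⟨i', hi', e'⟩ := hy
        exact ⟨i + i', Ideal.add_mem _ hi hi', by rw [map_add, add_mul, e, e', map_add]⟩
      | smul a x _ hx =>
        obtain ⟨i, hi, e⟩ := hx
        exact ⟨a * i, Ideal.mul_mem_left _ _ hi,
          by rw [smul_eq_mul, map_mul, mul_assoc, e, map_mul]⟩
    · rw [map_mul, map_pow, hs', pow_add, mul_assoc]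


namespace QCSubalgebra

variable (A : QCSubalgebra ν)

open Scheme.AffineZariskiSite

/-- The presheaf `W ↦ A(W)` on affine open subsets. -/
def diagram : Z.AffineZariskiSiteᵒᵖ ⥤ CommRingCat.{u} where
  obj W := .of (A.ring W.unop)
  map {W V} i := CommRingCat.ofHom ((res ν (toOpens_mono i.unop.le)).restrict
    (A.ring W.unop) (A.ring V.unop) fun s hs ↦ A.res_mem _ s hs)
  map_id W := by
    ext x
    change (U.presheaf.map (𝟙 _)).hom x.1 = x.1
    rw [U.presheaf.map_id]; rfl
  map_comp {W V V'} i j := by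
    ext x
    change (U.presheaf.map _).hom x.1 = (U.presheaf.map _).hom ((U.presheaf.map _).hom x.1)
    rw [← CommRingCat.comp_apply, ← U.presheaf.map_comp]; rfl

/-- The structure map from `𝒪_Z` to `A`. -/
def diagramMap : (toOpensFunctor Z).op ⋙ Z.presheaf ⟶ A.diagram where
  app W := CommRingCat.ofHom ((toPush ν W.unop.1).codRestrict (A.ring W.unop) (A.app_mem W.unop))
  naturality {W V} i := by
    ext x
    exact Subtype.ext (res_toPush (ν := ν) (toOpens_mono i.unop.le) x).symm

/-- Restriction `A(W) ⟶ A(V)`. -/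
def resRing {V W : Z.affineOpens} (h : V.1 ≤ W.1) : A.ring W →+* A.ring V :=
  (res ν h).restrict (A.ring W) (A.ring V) fun s hs ↦ A.res_mem h s hs

lemma isLocalization_resRing [QuasiCompact ν] [QuasiSeparated ν] {V W : Z.affineOpens}
    (h : V.1 ≤ W.1) (f : Γ(Z, W.1)) (hV : V.1 = Z.basicOpen f) :
    letI := (A.resRing h).toAlgebra
    IsLocalization.Away (⟨toPush ν W.1 f, A.app_mem W f⟩ : A.ring W) (A.ring V) := by
  let := (A.resRing h).toAlgebra
  constructor; constructor
  · rintro ⟨_, n, rfl⟩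
    simp only [map_pow]
    refine IsUnit.pow _ ?_
    have hf : IsUnit ((Z.presheaf.map (homOfLE h).op).hom f) := by
      obtain ⟨V, hV'⟩ := V
      dsimp at hV h ⊢
      subst hV
      exact RingedSpace.isUnit_res_basicOpen _ f
    have := hf.map ((toPush ν V.1).codRestrict (A.ring V) (A.app_mem V))
    have e : (A.resRing h) ⟨toPush ν W.1 f, A.app_mem W f⟩ =
        ((toPush ν V.1).codRestrict (A.ring V) (A.app_mem V))
          ((Z.presheaf.map (homOfLE h).op).hom f) := Subtype.ext (res_toPush (ν := ν) h f)
    exact e ▸ this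
  · rintro ⟨s, hs⟩
    obtain ⟨n, a, ha, e⟩ := A.exists_mem h f hV s hs
    refine ⟨⟨⟨a, ha⟩, ⟨_, n, rfl⟩⟩, Subtype.ext ?_⟩
    rw [map_pow, mul_comm]
    exact e.symm
  · rintro ⟨x, hx⟩ ⟨y, hy⟩ hxy
    have h0 : res ν h (x - y) = 0 := by
      rw [map_sub, sub_eq_zero]
      exact congrArg Subtype.val hxy
    obtain ⟨n, hn⟩ := exists_pow_mul_eq_zero h f hV _ h0
    rw [mul_sub, sub_eq_zero] at hn
    exact ⟨⟨_, n, rfl⟩, Subtype.ext hn⟩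

lemma coequifibered [QuasiCompact ν] [QuasiSeparated ν] : A.diagramMap.Coequifibered :=
  coequifibered_iff_forall_isLocalizationAway.mpr fun W f ↦
    A.isLocalization_resRing (V := W.basicOpen f) (W := W) (Z.basicOpen_le f) f rfl

variable [QuasiCompact ν] [QuasiSeparated ν]

/-- The gluing datum of the schemes `Spec A(W)`. -/
def glueData : (directedCover Z).RelativeGluingData := relativeGluingData A.coequifibered

instance : (A.glueData.functor ⋙ Scheme.forget).IsLocallyDirected :=
  Scheme.Cover.RelativeGluingData.instIsLocallyDirectedI₀CompFunctorForgetOfIsThin ..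

/-- The relative spectrum `Spec A` of a quasi-coherent subalgebra `A`, a scheme affine over `Z`. -/
def relSpec : Scheme.{u} := A.glueData.glued

/-- The structure morphism `Spec A ⟶ Z`. -/
def toBase : A.relSpec ⟶ Z := A.glueData.toBase

/-- The inclusion of the affine piece `Spec A(W)`. -/
def ιAffine (W : Z.affineOpens) : Spec (.of (A.ring W)) ⟶ A.relSpec :=
  colimit.ι A.glueData.functor (show Z.AffineZariskiSite from W)

instance (W : Z.affineOpens) : IsOpenImmersion (A.ιAffine W) :=
  A.glueData.cover.map_prop (show Z.AffineZariskiSite from W)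

lemma ιAffine_toBase (W : Z.affineOpens) :
    A.ιAffine W ≫ A.toBase =
      Spec.map (CommRingCat.ofHom ((toPush ν W.1).codRestrict (A.ring W) (A.app_mem W))) ≫
        W.2.fromSpec :=
  colimit.ι_desc _ _

lemma map_ιAffine {V W : Z.AffineZariskiSite} (i : V ⟶ W) :
    Spec.map (CommRingCat.ofHom (A.resRing (V := V) (W := W) (toOpens_mono i.le))) ≫
      A.ιAffine W = A.ιAffine V :=
  colimit.w A.glueData.functor i

lemma toBase_preimage (W : Z.affineOpens) :
    A.toBase ⁻¹ᵁ W = (A.ιAffine W).opensRange := by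
  have := A.glueData.toBase_preimage_eq_opensRange_ι (show Z.AffineZariskiSite from W)
  rw [Scheme.Opens.opensRange_ι] at this
  exact this

instance isAffineHom_toBase : IsAffineHom A.toBase := by
  refine isAffineHom_of_forall_exists_isAffineOpen _ fun z ↦ ?_
  obtain ⟨W, hW⟩ := TopologicalSpace.Opens.mem_iSup.mp
      ((iSup_affineOpens_eq_top Z).ge (Set.mem_univ z))
  refine ⟨W.1, hW, W.2, ?_⟩
  rw [A.toBase_preimage W]
  exact isAffineOpen_opensRange (A.ιAffine W)

/-- The restriction of `fromSource` to `ν ⁻¹ W`. -/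
def fromSourceAux (W : Z.affineOpens) : (ν ⁻¹ᵁ W.1).toScheme ⟶ A.relSpec :=
  (ν ⁻¹ᵁ W.1).toSpecΓ ≫ Spec.map (CommRingCat.ofHom (A.ring W).subtype) ≫ A.ιAffine W

lemma homOfLE_fromSourceAux {V W : Z.AffineZariskiSite} (i : V ⟶ W) :
    U.homOfLE (ν.preimage_mono (toOpens_mono i.le)) ≫ A.fromSourceAux W = A.fromSourceAux V := by
  unfold fromSourceAux
  rw [← A.map_ιAffine i, ← Scheme.Opens.toSpecΓ_SpecMap_presheaf_map_assoc,
    ← Spec.map_comp_assoc, ← Spec.map_comp_assoc]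
  rfl

lemma trans_fromSourceAux {V W : ((directedCover Z).pullback₁ ν).I₀} (i : V ⟶ W) :
    Scheme.Cover.trans ((directedCover Z).pullback₁ ν) i ≫
      (pullbackRestrictIsoRestrict ν W.1).hom ≫ A.fromSourceAux W =
    (pullbackRestrictIsoRestrict ν V.1).hom ≫ A.fromSourceAux V := by
  let V' : Z.AffineZariskiSite := V
  let W' : Z.AffineZariskiSite := W
  have i' : V' ⟶ W' := i
  have key : (pullback.map ν V'.1.ι ν W'.1.ι (𝟙 _) (Z.homOfLE (toOpens_mono i'.le)) (𝟙 _)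
      (by simp) (by simp)) ≫ (pullbackRestrictIsoRestrict ν W'.1).hom =
      (pullbackRestrictIsoRestrict ν V'.1).hom ≫
        U.homOfLE (ν.preimage_mono (toOpens_mono i'.le)) := by
    rw [← cancel_mono (Scheme.Opens.ι _)]
    simp only [Category.assoc, pullbackRestrictIsoRestrict_hom_ι, Scheme.homOfLE_ι]
    exact (pullback.lift_fst _ _ _).trans (Category.comp_id _)
  refine (Category.assoc _ _ _).symm.trans ?_
  refine (congrArg (· ≫ A.fromSourceAux W') key).trans ?_
  exact (Category.assoc _ _ _).trans (congrArg _ (A.homOfLE_fromSourceAux i'))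

/-- The morphism `U ⟶ Spec A` over `Z` given by the inclusion of `A` in `ν_* 𝒪_U`. -/
def fromSource : U ⟶ A.relSpec :=
  Scheme.OpenCover.glueMorphismsOfLocallyDirected ((directedCover Z).pullback₁ ν)
    (fun W : Z.AffineZariskiSite ↦
      (pullbackRestrictIsoRestrict ν W.1).hom ≫ A.fromSourceAux W) A.trans_fromSourceAux

lemma ι_fromSource (W : Z.affineOpens) :
    (ν ⁻¹ᵁ W.1).ι ≫ A.fromSource = A.fromSourceAux W := by
  rw [← cancel_epi (pullbackRestrictIsoRestrict ν W.1).hom, ← Category.assoc,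
    pullbackRestrictIsoRestrict_hom_ι]
  exact Scheme.OpenCover.map_glueMorphismsOfLocallyDirected ((directedCover Z).pullback₁ ν)
    _ A.trans_fromSourceAux (show Z.AffineZariskiSite from W)

lemma fromSource_toBase : A.fromSource ≫ A.toBase = ν := by
  refine Scheme.Cover.hom_ext (U.openCoverOfIsOpenCover _
    (.comap (iSup_affineOpens_eq_top Z) ν.base.1)) _ _ fun W ↦ ?_
  have (W : Z.affineOpens) : (ν ⁻¹ᵁ W.1).ι ≫ A.fromSource ≫ A.toBase = (ν ⁻¹ᵁ W.1).ι ≫ ν := by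
    rw [← Category.assoc, A.ι_fromSource, fromSourceAux, Category.assoc, Category.assoc,
      A.ιAffine_toBase, ← Spec.map_comp_assoc]
    change (ν ⁻¹ᵁ W.1).toSpecΓ ≫ Spec.map (ν.app _) ≫ W.2.fromSpec = (ν ⁻¹ᵁ W.1).ι ≫ _
    simp only [Scheme.Opens.toSpecΓ_naturality_assoc]
    exact (congrArg (ν ∣_ W.1 ≫ ·) W.2.toSpecΓ_fromSpec).trans (morphismRestrict_ι _ _)
  exact this W

instance quasiCompact_fromSource : QuasiCompact A.fromSource := by
  have : QuasiCompact (A.fromSource ≫ A.toBase) := by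
    rw [A.fromSource_toBase]; infer_instance
  exact MorphismProperty.of_postcomp (W := @QuasiCompact) (W' := @QuasiSeparated) _ A.toBase
    inferInstance this

instance quasiSeparated_fromSource : QuasiSeparated A.fromSource := by
  have : QuasiSeparated (A.fromSource ≫ A.toBase) := by
    rw [A.fromSource_toBase]; infer_instance
  exact .of_comp _ A.toBase

end QCSubalgebra

end QCSubalgebra

/-- The inverse image of a coherent ideal is locally finitely generated. -/
lemma comap_fg {X Y : Scheme.{u}} [IsLocallyNoetherian Y] (f : X ⟶ Y) (I : Y.IdealSheafData)
    (W : X.affineOpens) : ((I.comap f).ideal W).FG := by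
  have : LocallyOfFinitePresentation I.subschemeι :=
    LocallyOfFinitePresentation.iff_locallyOfFiniteType.mpr inferInstance
  have : LocallyOfFinitePresentation (pullback.fst f I.subschemeι) := inferInstance
  rw [Scheme.IdealSheafData.comap, Scheme.Hom.ker_apply]
  set i := pullback.fst f I.subschemeι
  have h1 := i.finitePresentation_appLE W.2 (W.2.preimage i) le_rfl
  rw [← Scheme.Hom.app_eq_appLE] at h1
  algebraize [(i.app W.1).hom]
  have h2 : Function.Surjective (i.app W.1).hom := i.app_surjective W.1 W.2
  exact Algebra.FinitePresentation.ker_fG_of_surjective (Algebra.ofId _ _) h2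


/-- The ideal of the effective Cartier divisor which Knudsen and Mumford attach to a torsion module
`M` over a local ring `R` with a resolution `0 → Rⁿ → Rⁿ → M → 0`: it is generated by the
determinant of the first map, and does not depend on the resolution. Here it is written as the
ideal generated by all determinants `det A`, where `A` is an
injective square matrix (of any size) whose cokernel is isomorphic to `M`. -/
def divIdeal (R : Type u) [CommRing R] (M : Type u) [AddCommGroup M] [Module R M] : Ideal R :=
  Ideal.span {d | ∃ (n : ℕ) (A : Matrix (Fin n) (Fin n) R), Function.Injective A.mulVec ∧
    Nonempty (((Fin n → R) ⧸ LinearMap.range A.mulVecLin) ≃ₗ[R] M) ∧ A.det = d}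

/-- The stalk at `x` of the ideal of the Knudsen-Mumford divisor of `Ω¹_{X/Y}`. -/
def stalkDifferent {X Y : Scheme.{u}} (φ : X ⟶ Y) (x : X) : Ideal (X.presheaf.stalk x) :=
  letI := (φ.stalkMap x).hom.toAlgebra
  divIdeal (X.presheaf.stalk x) (Ω[X.presheaf.stalk x⁄Y.presheaf.stalk (φ x)])

/-- The ideal of the different `Δ_X` of `φ : X ⟶ Y`, i.e. of the divisor of `Ω¹_{X/Y}`: the
quasi-coherent ideal whose sections are the functions with germs in the ideals
`stalkDifferent φ x`. -/
def different {X Y : Scheme.{u}} (φ : X ⟶ Y) : X.IdealSheafData :=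
  .ofIdeals fun V ↦ ⨅ x : V.1, (stalkDifferent φ x.1).comap (X.presheaf.germ V.1 x.1 x.2).hom

/-- The largest open subset on which `φ` is étale. -/
def etaleLocus {X Y : Scheme.{u}} (φ : X ⟶ Y) : X.Opens := sSup {V | Etale (V.ι ≫ φ)}

/-- `X` is a locally complete intersection over `k`: locally `X` is isomorphic to the closed
subscheme of an affine space over `k` defined by a regular sequence. -/
def IsLCI {k : Type u} [Field k] {X : Scheme.{u}} (pX : X ⟶ Spec (.of k)) : Prop :=
  ∀ x : X, ∃ V : X.Opens, IsAffineOpen V ∧ x ∈ V ∧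
    ∃ (m : ℕ) (fs : List (MvPolynomial (Fin m) k)) (ψ : MvPolynomial (Fin m) k →+* Γ(X, V)),
      ψ.comp MvPolynomial.C =
        ((Scheme.ΓSpecIso (.of k)).inv ≫ pX.appLE ⊤ V (by simp)).hom ∧
      Function.Surjective ψ ∧ RingHom.ker ψ = Ideal.ofList fs ∧
      RingTheory.Sequence.IsRegular (MvPolynomial (Fin m) k) fs

/-- A morphism `φ : X ⟶ Y` of separated schemes locally of finite type over a field `k` such that
`Y` is smooth, `X` is a locally complete intersection, and the étale locus of `φ` is dense. -/
structure NewtonSetting (k : Type u) [Field k] where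
  X : Scheme.{u}
  Y : Scheme.{u}
  pX : X ⟶ Spec (.of k)
  pY : Y ⟶ Spec (.of k)
  φ : X ⟶ Y
  φ_comp : φ ≫ pY = pX
  isSeparated_X : IsSeparated pX
  isSeparated_Y : IsSeparated pY
  locallyOfFiniteType_X : LocallyOfFiniteType pX
  smooth_Y : Smooth pY
  isLCI_X : IsLCI pX
  dense_etaleLocus : Dense (etaleLocus φ : Set X)

namespace NewtonSetting

variable {k : Type u} [Field k] (D : NewtonSetting k)

instance : LocallyOfFiniteType D.pX := D.locallyOfFiniteType_X

instance : IsLocallyNoetherian D.X := LocallyOfFiniteType.isLocallyNoetherian D.pX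

/-- `X × X` (the product over `k`). -/
abbrev XX : Scheme.{u} := pullback D.pX D.pX

/-- The first projection `X × X ⟶ X`. -/
abbrev pr₁ : D.XX ⟶ D.X := pullback.fst D.pX D.pX

/-- The second projection `X × X ⟶ X`. -/
abbrev pr₂ : D.XX ⟶ D.X := pullback.snd D.pX D.pX

/-- The ideal of the different. -/
abbrev IΔ : D.X.IdealSheafData := different D.φ

/-- The different `Δ_X`, as a closed subscheme of `X`. -/
abbrev Δ : Scheme.{u} := D.IΔ.subscheme

/-- The closed immersion `Δ_X ⟶ X`. -/
abbrev ιΔ : D.Δ ⟶ D.X := D.IΔ.subschemeι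

/-- The ideal of the diagonal in `X × X`. -/
def I₁ : D.XX.IdealSheafData := (pullback.diagonal D.pX).ker

/-- The closed immersion `X ×_Y X ⟶ X × X`. -/
def fiberProductι : pullback D.φ D.φ ⟶ D.XX :=
  pullback.lift (pullback.fst D.φ D.φ) (pullback.snd D.φ D.φ)
    (by rw [← D.φ_comp, pullback.condition_assoc])

/-- The ideal of `X ×_Y X` in `X × X`. -/
def I₂ : D.XX.IdealSheafData := D.fiberProductι.ker

/-- The ideal of `D = Δ_X × X` in `X × X`. -/
def D₁ : D.XX.IdealSheafData := D.IΔ.comap D.pr₁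

/-- The ideal of `X × Δ_X` in `X × X`. -/
def D₂ : D.XX.IdealSheafData := D.IΔ.comap D.pr₂

lemma D₁_fg (W : D.XX.affineOpens) : (D.D₁.ideal W).FG := comap_fg _ _ _

lemma D₂_fg (W : D.XX.affineOpens) : (D.D₂.ideal W).FG := comap_fg _ _ _

/-- `U × U`, where `U` is the étale locus of `φ`. -/
def UU : D.XX.Opens := D.pr₁ ⁻¹ᵁ etaleLocus D.φ ⊓ D.pr₂ ⁻¹ᵁ etaleLocus D.φ

/-- The open immersion `U × U ⟶ X × X`. -/
abbrev j : D.UU.toScheme ⟶ D.XX := D.UU.ι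

/-- The subalgebra of `j_* 𝒪_{U × U}` generated by `I₁((r-1)D)`, `I₂(rD)`, `I₁((r-1)D')` and
`I₂(rD')`, where `D = Δ_X × X` and `D' = X × Δ_X`. -/
def 𝒜 (r : ℕ) : QCSubalgebra D.j :=
  SectionFamily.adjoin <|
    ((twist D.I₁ D.D₁ D.D₁_fg (r - 1)).union (twist D.I₂ D.D₁ D.D₁_fg r)).union
    ((twist D.I₁ D.D₂ D.D₂_fg (r - 1)).union (twist D.I₂ D.D₂ D.D₂_fg r))

/-- The Newton groupoid `Γ_r = Spec 𝒜_r`, as a scheme. -/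
def Γ (r : ℕ) : Scheme.{u} := (D.𝒜 r).relSpec

/-- The affine morphism `Γ_r ⟶ X × X`. -/
def π (r : ℕ) : D.Γ r ⟶ D.XX := (D.𝒜 r).toBase

/-- The source morphism `p₁ : Γ_r ⟶ X`. -/
def p₁ (r : ℕ) : D.Γ r ⟶ D.X := D.π r ≫ D.pr₁

/-- The target morphism `p₂ : Γ_r ⟶ X`. -/
def p₂ (r : ℕ) : D.Γ r ⟶ D.X := D.π r ≫ D.pr₂

/-- The lift `ν : U × U ⟶ Γ_r` of the open immersion `j`. -/
def ν (r : ℕ) : D.UU.toScheme ⟶ D.Γ r := (D.𝒜 r).fromSource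

instance (r : ℕ) : QuasiCompact (D.ν r) := (D.𝒜 r).quasiCompact_fromSource

instance (r : ℕ) : QuasiSeparated (D.ν r) := (D.𝒜 r).quasiSeparated_fromSource

/-- The subalgebra of `ν_* 𝒪_{U × U}` generated by `I(Δ_r)`, where `I` is the ideal of `e(Δ_X)` in
`Γ_r` and `Δ_r` is the preimage of `Δ_X` under `p₁`. -/
def ℬ (r : ℕ) (e : D.X ⟶ D.Γ r) : QCSubalgebra (D.ν r) :=
  SectionFamily.adjoin <|
    twist (D.ιΔ ≫ e).ker (D.IΔ.comap (D.p₁ r)) (comap_fg _ _) 1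

/-- `Δ_X × Δ_X` (the product over `k`). -/
abbrev ΔΔ : Scheme.{u} := pullback (D.ιΔ ≫ D.pX) (D.ιΔ ≫ D.pX)

/-- The closed immersion `Δ_X × Δ_X ⟶ X × X`. -/
def ιΔΔ : D.ΔΔ ⟶ D.XX :=
  pullback.lift (pullback.fst (D.ιΔ ≫ D.pX) (D.ιΔ ≫ D.pX) ≫ D.ιΔ)
    (pullback.snd (D.ιΔ ≫ D.pX) (D.ιΔ ≫ D.pX) ≫ D.ιΔ)
    (by rw [Category.assoc, Category.assoc, pullback.condition])

/-- `Γ_r ×_{X × X} (Δ_X × Δ_X)`. -/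
abbrev ΓΔ (r : ℕ) : Scheme.{u} := pullback (D.π r) D.ιΔΔ

/-- The morphism `Γ_s ×_{X × X} (Δ_X × Δ_X) ⟶ Γ_r ×_{X × X} (Δ_X × Δ_X)` induced by a morphism
`Γ_s ⟶ Γ_r` over `X × X`. -/
def mapΔ {s r : ℕ} (f : D.Γ s ⟶ D.Γ r) (hf : f ≫ D.π r = D.π s) : D.ΓΔ s ⟶ D.ΓΔ r :=
  pullback.map _ _ _ _ f (𝟙 _) (𝟙 _) (by simp [hf]) (by simp)

/-- The section `Δ_X ⟶ Γ_r ×_{X × X} (Δ_X × Δ_X)` induced by a section `e : X ⟶ Γ_r` over the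
diagonal. -/
def unitΔ {r : ℕ} (e : D.X ⟶ D.Γ r) (h₁ : e ≫ D.p₁ r = 𝟙 _) (h₂ : e ≫ D.p₂ r = 𝟙 _) :
    D.Δ ⟶ D.ΓΔ r :=
  pullback.lift (D.ιΔ ≫ e) (pullback.lift (𝟙 _) (𝟙 _) rfl) (by
    have h₁' : e ≫ D.π r ≫ D.pr₁ = 𝟙 _ := h₁
    have h₂' : e ≫ D.π r ≫ D.pr₂ = 𝟙 _ := h₂
    apply pullback.hom_ext
    · simp only [ιΔΔ, Category.assoc, h₁', pullback.lift_fst, pullback.lift_fst_assoc,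
        Category.comp_id, Category.id_comp]
    · simp only [ιΔΔ, Category.assoc, h₂', pullback.lift_snd, pullback.lift_snd_assoc,
        Category.comp_id, Category.id_comp])

end NewtonSetting

/-- A groupoid in schemes with objects `X`, morphisms `Γ`, source `p₁` and target `p₂`. The
composite of `(a, b)` with `p₂ a = p₁ b` goes from `p₁ a` to `p₂ b`. The laws are stated for
`T`-points. -/
structure SchemeGroupoid {X Γ : Scheme.{u}} (p₁ p₂ : Γ ⟶ X) where
  comp : pullback p₂ p₁ ⟶ Γ
  unit : X ⟶ Γ
  inv : Γ ⟶ Γ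
  comp_source : comp ≫ p₁ = pullback.fst p₂ p₁ ≫ p₁
  comp_target : comp ≫ p₂ = pullback.snd p₂ p₁ ≫ p₂
  unit_source : unit ≫ p₁ = 𝟙 X
  unit_target : unit ≫ p₂ = 𝟙 X
  inv_source : inv ≫ p₁ = p₂
  inv_target : inv ≫ p₂ = p₁
  assoc : ∀ {T : Scheme.{u}} (a b c : T ⟶ Γ) (hab : a ≫ p₂ = b ≫ p₁) (hbc : b ≫ p₂ = c ≫ p₁),
    pullback.lift (pullback.lift a b hab ≫ comp) c 
      (by rw [Category.assoc, comp_target, pullback.lift_snd_assoc, hbc]) ≫ comp =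
      pullback.lift a (pullback.lift b c hbc ≫ comp) 
        (by rw [Category.assoc, comp_source, pullback.lift_fst_assoc, hab]) ≫ comp
  unit_comp : ∀ {T : Scheme.{u}} (a : T ⟶ Γ),
    pullback.lift (a ≫ p₁ ≫ unit) a (by simp [unit_target]) ≫ comp = a
  comp_unit : ∀ {T : Scheme.{u}} (a : T ⟶ Γ),
    pullback.lift a (a ≫ p₂ ≫ unit) (by simp [unit_source]) ≫ comp = a
  inv_comp : ∀ {T : Scheme.{u}} (a : T ⟶ Γ),
    pullback.lift (a ≫ inv) a (by simp [inv_target]) ≫ comp = a ≫ p₂ ≫ unit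
  comp_inv : ∀ {T : Scheme.{u}} (a : T ⟶ Γ),
    pullback.lift a (a ≫ inv) (by simp [inv_source]) ≫ comp = a ≫ p₁ ≫ unit

/-- `f : Γ ⟶ Γ'` is a morphism of groupoids inducing the identity on the objects `X`. -/
structure SchemeGroupoid.IsHom {X Γ Γ' : Scheme.{u}} {p₁ p₂ : Γ ⟶ X} {p₁' p₂' : Γ' ⟶ X}
    (G : SchemeGroupoid p₁ p₂) (G' : SchemeGroupoid p₁' p₂') (f : Γ ⟶ Γ') : Prop where
  source : f ≫ p₁' = p₁
  target : f ≫ p₂' = p₂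
  unit : G.unit ≫ f = G'.unit
  inv : G.inv ≫ f = f ≫ G'.inv
  comp : G.comp ≫ f = pullback.lift (pullback.fst p₂ p₁ ≫ f) (pullback.snd p₂ p₁ ≫ f)
    (by simp [source, target, pullback.condition]) ≫ G'.comp

end
end Newton

open CategoryTheory CategoryTheory.Limits AlgebraicGeometry Newton

/-! The scheme `Γ_r` represents an equivalence relation of infinitesimal closeness on morphisms to
`X`, at least on those in which the étale locus is schematically dense. The assertions on groupoids
follow once `Γ_r` is known to be flat over `X`.

The first step is a local normal form. Let `x` be a point of `X`. Near `φ x`, the smooth scheme `Y`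
has étale coordinates `y₁, …, y_d`, and near `x` the complete intersection `X` is `Spec k[x] / (f)`.
Since `φ` is étale on a dense open subset, the number of variables `x` is the number of equations
`f` plus `d`, so that the `f` together with polynomials that express the `y` in terms of the `x`
form a square system `F` (`NewtonSetting.exists_chart`). The Jacobian matrix of `F` presents
`Ω_{X/Y}`. The determinant of a square presentation is unique up to units (`det_mem_span_det`), so
that the different is cut out by the Jacobian determinant `g`, and the étale locus is the set where
`g` is invertible (`NewtonSetting.PreChart.basicOpen_g`). Moreover `g` is a nonzerodivisor: it
vanishes on no irreducible component, and a complete intersection has no embedded components because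
regular local rings are Cohen–Macaulay (`mem_of_mul_mem_of_isWeaklyRegular`).

The second step is to describe `Γ_r` by a functor. Two morphisms `q₁, q₂ : S ⟶ X` are called close
of order `r` if they pull back the different to the same ideal `J`, if they agree modulo
`J ^ (r - 1)` and if their composites with `φ` agree modulo `J ^ r` (`NewtonSetting.Close`). The
generators of `𝒜_r` are made so that the two projections of `Γ_r` are close
(`NewtonSetting.close_p₁_p₂`). If the preimage of the étale locus is schematically dense in `S`, for
instance if `S` is flat over `X`, then conversely a close pair over `k` comes from exactly one
morphism `S ⟶ Γ_r` (`NewtonSetting.Close.exists_lift`, `NewtonSetting.Γ_hom_ext`). Closeness is an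
equivalence relation, whence the unit, the inverse and the composition of the groupoid. To define
the composition on `Γ_r ×_X Γ_r`, to verify associativity on the triple product, and to see that the
structure is unique, the étale locus has to be schematically dense there, and this holds because the
projections of `Γ_r` are flat.

Flatness (`NewtonSetting.flat_p₁`) is proved with the equations of Newton's method. In a chart, a
pair that is close of order `r = m + 2` has the form `x`, `x + g ^ (m + 1) u` with
`F (x + g ^ (m + 1) u) = F x + g ^ (m + 2) w`, where the entries of `w` that belong to the equations
`f` vanish and the others are arbitrary. After Taylor expansion, multiplication by the adjugate of
the Jacobian matrix and division by powers of `g`, this is a system of equations for `u` that is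
étale where its own Jacobian determinant is invertible, and this determinant is the ratio of the
values of `g` at the two points (`evalShift_det`). Therefore the universal close pair of a chart
lives on the spectrum of a ring `PairRing` that is étale over an affine space over the chart, and
the part of `Γ_r` where both projections meet the chart is locally isomorphic to an open subscheme
of this spectrum, because both carry universal close pairs.

The third step concerns the transition morphism `Γ_{r+1} ⟶ Γ_r`. The generators of `𝒜_r` become
divisible by `g` in `𝒜_{r+1}`, and they vanish at the unit, so that the transition morphism
contracts the preimage of the different to the unit (`NewtonSetting.transition_eq_of_p₁`).
Conversely, let `a : S ⟶ Γ_r` be a morphism with this property, and let the étale locus be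
schematically dense in `S`. The difference quotients that `Γ_r` carries vanish at the unit, hence
become divisible by `g` on `S`. Thus the pair given by `a` is close of order `r + 1`, and `a` lifts
to `Γ_{r+1}` (`NewtonSetting.Contracts.close`, `NewtonSetting.Contracts.exists_lift`). This
universal property is the statement on flat `S`, and it is shared by the affine blow-up of `Γ_r`,
which is therefore `Γ_{r+1}` (`NewtonSetting.exists_iso_blowup`). -/

/-! ### Regular local rings and unmixedness of complete intersections -/

namespace Newton

open IsLocalRing RingTheory.Sequence

section Unmixed

variable {R : Type*} [CommRing R]

lemma le_of_natCast_add_one_le {n : ℕ} {b : WithBot ℕ∞} (h : (n : WithBot ℕ∞) + 1 ≤ b + 1) :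
    (n : WithBot ℕ∞) ≤ b := by
  induction b with
  | bot =>
    rw [WithBot.bot_add, le_bot_iff] at h
    exact absurd h (by exact_mod_cast WithBot.coe_ne_bot)
  | coe b =>
    have h' : ((n : ℕ∞) + 1) ≤ b + 1 := by exact_mod_cast h
    exact_mod_cast (ENat.add_le_add_iff_right (by simp)).mp h'

/-- Cutting a regular local ring by a parameter outside `𝔪 ^ 2` gives a regular local ring whose
dimension is one less. -/
lemma isRegularLocalRing_quotient_span_singleton [IsRegularLocalRing R] {z : R}
    (hz : z ∈ maximalIdeal R) (hz2 : z ∉ maximalIdeal R ^ 2) :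
    IsRegularLocalRing (R ⧸ Ideal.span {z}) ∧
      ringKrullDim (R ⧸ Ideal.span {z}) + 1 = ringKrullDim R := by
  classical
  have hne : Ideal.span {z} ≠ ⊤ := by
    rw [Ne, Ideal.span_singleton_eq_top]; exact hz
  have : Nontrivial (R ⧸ Ideal.span {z}) := Ideal.Quotient.nontrivial_iff.mpr hne
  have : IsLocalRing (R ⧸ Ideal.span {z}) :=
    .of_surjective' (Ideal.Quotient.mk _) Ideal.Quotient.mk_surjective
  have hdim : ringKrullDim R ≤ ringKrullDim (R ⧸ Ideal.span {z}) + 1 := by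
    have := ringKrullDim_le_ringKrullDim_quotient_add_card (R := R) {z} (by
      simpa [IsLocalRing.ringJacobson_eq_maximalIdeal] using hz)
    rwa [Finset.coe_singleton, Finset.card_singleton, Nat.cast_one] at this
  obtain ⟨s, hs, hspan⟩ := Submodule.FG.exists_span_finset_card_eq_spanFinrank
    (IsNoetherian.noetherian (maximalIdeal R))
  -- some coefficient of `z` is a unit
  obtain ⟨y, hy, hyz⟩ : ∃ y ∈ s, y ∈ Ideal.span ((s.erase y : Finset R) ∪ {z} : Set R) := by
    have hz' : z ∈ Submodule.span R (s : Set R) := hspan ▸ hz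
    obtain ⟨c, hc⟩ := (Submodule.mem_span_finset'.mp hz')
    have hex : ∃ y : s, IsUnit (c y) := by
      by_contra! hcon
      refine hz2 (hc ▸ Ideal.sum_mem _ fun y _ ↦ ?_)
      rw [pow_two, smul_eq_mul]
      exact Ideal.mul_mem_mul (hcon y) (hspan ▸ Submodule.subset_span y.2)
    obtain ⟨⟨y, hy⟩, hu⟩ := hex
    refine ⟨y, hy, ?_⟩
    rw [← Ideal.unit_mul_mem_iff_mem _ hu]
    have : c ⟨y, hy⟩ * y = z - ∑ a ∈ Finset.univ.erase ⟨y, hy⟩, c a • (a : R) := by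
      rw [← hc, ← Finset.add_sum_erase _ _ (Finset.mem_univ (⟨y, hy⟩ : s))]
      simp
    rw [this]
    refine Ideal.sub_mem _ (Ideal.subset_span (by simp)) (Ideal.sum_mem _ fun a ha ↦ ?_)
    refine Ideal.mul_mem_left _ _ (Ideal.subset_span (Or.inl ?_))
    simp only [Finset.mem_erase, Finset.mem_univ, and_true] at ha
    simp only [Finset.coe_erase, Set.mem_sdiff, Finset.mem_coe, a.2, Set.mem_singleton_iff,
      true_and]
    exact fun h ↦ ha (Subtype.ext h)
  have hmax : maximalIdeal (R ⧸ Ideal.span {z}) =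
      Ideal.span (((s.erase y).image (Ideal.Quotient.mk (Ideal.span {z})) : Finset _) : Set _) := by
    rw [← IsLocalRing.map_maximalIdeal_of_surjective (Ideal.Quotient.mk (Ideal.span {z}))
      Ideal.Quotient.mk_surjective, Finset.coe_image, ← Ideal.map_span]
    apply le_antisymm
    · rw [← hspan]
      have : Submodule.span R (s : Set R) ≤ Ideal.span ((s.erase y : Finset R) ∪ {z} : Set R) := by
        refine Submodule.span_le.mpr fun a ha ↦ ?_
        by_cases h : a = y
        · exact h ▸ hyz
        · exact Ideal.subset_span (Or.inl (by simpa [h] using ha))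
      refine (Ideal.map_mono this).trans ?_
      rw [Ideal.span_union, Ideal.map_sup]
      simp [Ideal.map_span]
    · refine Ideal.map_mono (Ideal.span_le.mpr fun a ha ↦ ?_)
      rw [← hspan]
      exact Submodule.subset_span (Finset.mem_of_mem_erase ha)
  have hrank : (maximalIdeal (R ⧸ Ideal.span {z})).spanFinrank + 1 ≤
      (maximalIdeal R).spanFinrank := by
    rw [hmax, ← hs, ← Finset.card_erase_add_one hy]
    gcongr
    refine (Submodule.spanFinrank_span_le_ncard_of_finite (Finset.finite_toSet _)).trans ?_
    rw [Set.ncard_coe_finset]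
    exact Finset.card_image_le
  have h1 := ringKrullDim_le_spanFinrank_maximalIdeal (R ⧸ Ideal.span {z})
  have h2 := IsRegularLocalRing.spanFinrank_maximalIdeal (R := R)
  have h3 : (((maximalIdeal (R ⧸ Ideal.span {z})).spanFinrank + 1 : ℕ) : WithBot ℕ∞) ≤
      ringKrullDim R := by
    rw [← h2]; exact_mod_cast hrank
  have h4 : ((maximalIdeal (R ⧸ Ideal.span {z})).spanFinrank : WithBot ℕ∞) ≤
      ringKrullDim (R ⧸ Ideal.span {z}) := by
    have := h3.trans hdim
    push_cast at this
    exact le_of_natCast_add_one_le this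
  refine ⟨.of_spanFinrank_maximalIdeal_le _ h4, le_antisymm ?_ hdim⟩
  refine le_trans ?_ h3
  push_cast
  gcongr

/-- Regular local rings are domains: if `x ∉ 𝔪 ^ 2` avoids the minimal primes, then `(x)` is prime
by induction on the dimension, and a minimal prime `p ⊆ (x)` satisfies `p = x p`. -/
theorem isDomain_of_isRegularLocalRing : ∀ (n : ℕ) (R : Type u) [CommRing R]
    [IsRegularLocalRing R], (maximalIdeal R).spanFinrank = n → IsDomain R
  | 0, R, _, _, h => by
    have h0 : maximalIdeal R = ⊥ :=
      (Submodule.spanFinrank_eq_zero_iff_eq_bot (IsNoetherian.noetherian _)).mp h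
    exact (IsLocalRing.isField_iff_maximalIdeal_eq.mpr h0).isDomain
  | n + 1, R, _, _, h => by
    have hm0 : maximalIdeal R ≠ ⊥ := fun h0 ↦ by
      rw [h0, Submodule.spanFinrank_bot] at h; omega
    have hm2 : ¬ maximalIdeal R ≤ maximalIdeal R ^ 2 := fun hle ↦ hm0 <|
      Submodule.eq_bot_of_le_smul_of_le_jacobson_bot (maximalIdeal R) (maximalIdeal R)
        (IsNoetherian.noetherian _) (by rwa [smul_eq_mul, ← pow_two])
        (IsLocalRing.jacobson_eq_maximalIdeal ⊥ bot_ne_top).ge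
    have hdim := IsRegularLocalRing.spanFinrank_maximalIdeal (R := R)
    rw [h] at hdim
    have hmin : ∀ p ∈ minimalPrimes R, ¬ maximalIdeal R ≤ p := fun p hp hle ↦ by
      have := hp.1.1
      have hpm : p = maximalIdeal R := le_antisymm (le_maximalIdeal this.ne_top) hle
      have h0 : (maximalIdeal R).height = 0 := by
        rw [← hpm, Ideal.height_eq_zero_iff]
        exact hp
      rw [← IsLocalRing.maximalIdeal_height_eq_ringKrullDim, h0] at hdim
      norm_cast at hdim
    obtain ⟨x, hx, hx2, hxp⟩ : ∃ x ∈ maximalIdeal R, x ∉ maximalIdeal R ^ 2 ∧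
        ∀ p ∈ minimalPrimes R, x ∉ p := by
      by_contra! hcon
      have hfin := minimalPrimes.finite_of_isNoetherianRing R
      have hsub : (maximalIdeal R : Set R) ⊆
          ⋃ I ∈ insert (maximalIdeal R ^ 2) (minimalPrimes R), (I : Set R) := fun x hx ↦ by
        by_cases h2 : x ∈ maximalIdeal R ^ 2
        · exact Set.mem_biUnion (Set.mem_insert _ _) h2
        · obtain ⟨p, hp, hxp⟩ := hcon x hx h2
          exact Set.mem_biUnion (Set.mem_insert_of_mem _ hp) hxp
      obtain ⟨I, hI, hle⟩ := (Ideal.subset_union_prime_finite (hfin.insert _) (f := id)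
        (maximalIdeal R ^ 2) (maximalIdeal R ^ 2) (fun I hI h1 _ ↦
          (Set.mem_of_mem_insert_of_ne hI h1).1.1)).mp hsub
      rcases hI with rfl | hI
      · exact hm2 hle
      · exact hmin _ hI hle
    obtain ⟨hreg, hd⟩ := isRegularLocalRing_quotient_span_singleton hx hx2
    have hn : (maximalIdeal (R ⧸ Ideal.span {x})).spanFinrank = n := by
      have h1 := IsRegularLocalRing.spanFinrank_maximalIdeal (R := R ⧸ Ideal.span {x})
      rw [← h1, ← hdim] at hd
      have : (maximalIdeal (R ⧸ Ideal.span {x})).spanFinrank + 1 = n + 1 := by exact_mod_cast hd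
      omega
    have hdom := isDomain_of_isRegularLocalRing n (R ⧸ Ideal.span {x}) hn
    have hprime : (Ideal.span {x}).IsPrime := (Ideal.Quotient.isDomain_iff_prime _).mp hdom
    obtain ⟨p, hp, hpx⟩ := Ideal.exists_minimalPrimes_le (bot_le : ⊥ ≤ Ideal.span {x})
    have hpp := hp.1.1
    have hp0 : p = ⊥ := by
      refine Submodule.eq_bot_of_le_smul_of_le_jacobson_bot (Ideal.span {x}) p
        (IsNoetherian.noetherian _) (fun y hy ↦ ?_)
        ((Ideal.span_singleton_le_iff_mem _).mpr hx |>.trans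
          (IsLocalRing.jacobson_eq_maximalIdeal ⊥ bot_ne_top).ge)
      obtain ⟨c, rfl⟩ := Ideal.mem_span_singleton'.mp (hpx hy)
      rw [mul_comm]
      exact Submodule.smul_mem_smul (Ideal.mem_span_singleton_self x)
        ((hpp.mem_or_mem hy).resolve_right (hxp p hp))
    rw [hp0] at hpp
    exact IsDomain.of_bot_isPrime R

/-- If `a` and `z` in `𝔪` are both regular modulo `I`, then `𝔪` is associated to `R / (I, a)` if
and only if it is associated to `R / (I, z)`. -/
lemma exists_socle_exchange {I 𝔪 : Ideal R} {a z : R} (hz𝔪 : z ∈ 𝔪)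
    (ha : ∀ x, a * x ∈ I → x ∈ I) (hz : ∀ x, z * x ∈ I → x ∈ I)
    (h : ∃ w ∉ I ⊔ Ideal.span {a}, ∀ m ∈ 𝔪, m * w ∈ I ⊔ Ideal.span {a}) :
    ∃ w ∉ I ⊔ Ideal.span {z}, ∀ m ∈ 𝔪, m * w ∈ I ⊔ Ideal.span {z} := by
  have hmem (b y : R) : y ∈ I ⊔ Ideal.span {b} ↔ ∃ c, y - b * c ∈ I := by
    simp_rw [Submodule.mem_sup, Ideal.mem_span_singleton']
    constructor
    · rintro ⟨i, hi, _, ⟨c, rfl⟩, rfl⟩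
      exact ⟨c, by convert hi using 1; ring⟩
    · rintro ⟨c, hc⟩
      exact ⟨_, hc, _, ⟨c, rfl⟩, by ring⟩
  simp only [hmem] at h ⊢
  obtain ⟨w, hw, h⟩ := h
  obtain ⟨w', hw'⟩ := h z hz𝔪
  refine ⟨w', fun ⟨e, he⟩ ↦ hw ⟨e, hz _ ?_⟩, fun m hm ↦ ?_⟩
  · have := I.add_mem hw' (I.mul_mem_left a he)
    convert this using 1; ring
  · obtain ⟨c, hc⟩ := h m hm
    refine ⟨c, ha _ ?_⟩
    have := I.sub_mem (I.mul_mem_left z hc) (I.mul_mem_left m hw')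
    convert this using 1; ring

lemma isSMulRegular_quotient_iff {I : Ideal R} {a : R} :
    IsSMulRegular (R ⧸ I) a ↔ ∀ x, a * x ∈ I → x ∈ I := by
  rw [isSMulRegular_iff_right_eq_zero_of_smul]
  constructor
  · intro h x hx
    exact Ideal.Quotient.eq_zero_iff_mem.mp (h (Ideal.Quotient.mk I x)
      (Ideal.Quotient.eq_zero_iff_mem.mpr hx))
  · intro h x hx
    obtain ⟨x, rfl⟩ := Ideal.Quotient.mk_surjective x
    exact Ideal.Quotient.eq_zero_iff_mem.mpr (h x (Ideal.Quotient.eq_zero_iff_mem.mp hx))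

lemma isWeaklyRegular_append_singleton_iff {l : List R} {a : R} :
    IsWeaklyRegular R (l ++ [a]) ↔
      IsWeaklyRegular R l ∧ ∀ x, a * x ∈ Ideal.ofList l → x ∈ Ideal.ofList l := by
  rw [isWeaklyRegular_append_iff, isWeaklyRegular_singleton_iff, ← isSMulRegular_quotient_iff,
    smul_eq_mul, Ideal.mul_top]

/-- A regular local ring is Cohen–Macaulay: if its maximal ideal is associated to the quotient by
a regular sequence, then the length of the sequence is the dimension. -/
theorem ringKrullDim_eq_length_of_socle (n : ℕ) : ∀ (R : Type u) [CommRing R]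
    [IsRegularLocalRing R] (l : List R), l.length = n → (∀ a ∈ l, a ∈ maximalIdeal R) →
    IsWeaklyRegular R l →
    (∃ w ∉ Ideal.ofList l, ∀ m ∈ maximalIdeal R, m * w ∈ Ideal.ofList l) →
    ringKrullDim R = n := by
  induction n with
  | zero =>
    intro R _ _ l hl _ _ ⟨w, hw, h⟩
    obtain rfl := List.length_eq_zero_iff.mp hl
    have := isDomain_of_isRegularLocalRing _ R rfl
    simp only [Ideal.ofList_nil, Ideal.mem_bot] at hw h
    have h0 : maximalIdeal R = ⊥ := by
      rw [eq_bot_iff]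
      exact fun m hm ↦ (mul_eq_zero.mp (h m hm)).resolve_right hw
    rw [← IsRegularLocalRing.spanFinrank_maximalIdeal, h0, Submodule.spanFinrank_bot]
  | succ n ih =>
    intro R _ _ l hl hmem hreg ⟨w, hw, h⟩
    have := isDomain_of_isRegularLocalRing _ R rfl
    obtain ⟨l, a, rfl⟩ : ∃ l' b, l = l' ++ [b] := by
      rcases List.eq_nil_or_concat l with rfl | ⟨l', b, rfl⟩
      · simp at hl
      · exact ⟨l', b, List.concat_eq_append⟩
    obtain ⟨hreg, ha⟩ := isWeaklyRegular_append_singleton_iff.mp hreg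
    have hlm : ∀ a ∈ l, a ∈ maximalIdeal R := fun b hb ↦ hmem b (by simp [hb])
    have ham : a ∈ maximalIdeal R := hmem a (by simp)
    set I := Ideal.ofList l
    have hI : I ⊔ Ideal.span {a} = Ideal.ofList (l ++ [a]) := by
      rw [Ideal.ofList_append, Ideal.ofList_singleton]
    rw [← hI] at hw h
    have hm0 : maximalIdeal R ≠ ⊥ := fun h0 ↦ by
      have : a = 0 := by simpa [h0] using ham
      exact hw (Ideal.mem_sup_left (ha w (by simp [this])))
    have hm2 : ¬ maximalIdeal R ≤ maximalIdeal R ^ 2 := fun hle ↦ hm0 <|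
      Submodule.eq_bot_of_le_smul_of_le_jacobson_bot (maximalIdeal R) (maximalIdeal R)
        (IsNoetherian.noetherian _) (by rwa [smul_eq_mul, ← pow_two])
        (IsLocalRing.jacobson_eq_maximalIdeal ⊥ bot_ne_top).ge
    have hzd := biUnion_associatedPrimes_eq_compl_regular R (R ⧸ I)
    -- replace the last member `a` by an element `z` outside `𝔪 ^ 2`, which exists by prime
    -- avoidance, in order that `R ⧸ (z)` is again regular
    obtain ⟨z, hz, hz2, hzI⟩ : ∃ z ∈ maximalIdeal R, z ∉ maximalIdeal R ^ 2 ∧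
        ∀ x, z * x ∈ I → x ∈ I := by
      by_contra! hcon
      have hfin := associatedPrimes.finite R (R ⧸ I)
      have hsub : (maximalIdeal R : Set R) ⊆
          ⋃ J ∈ insert (maximalIdeal R ^ 2) (associatedPrimes R (R ⧸ I)), (J : Set R) :=
          fun x hx ↦ by
        by_cases h2 : x ∈ maximalIdeal R ^ 2
        · exact Set.mem_biUnion (Set.mem_insert _ _) h2
        · obtain ⟨y, hxy, hy⟩ := hcon x hx h2
          have hx' : x ∈ ⋃ p ∈ associatedPrimes R (R ⧸ I), (p : Set R) :=
            hzd ▸ fun hx ↦ hy (isSMulRegular_quotient_iff.mp hx y hxy)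
          simp only [Set.mem_iUnion] at hx' ⊢
          obtain ⟨p, hp, hxp⟩ := hx'
          exact ⟨p, Set.mem_insert_of_mem _ hp, hxp⟩
      obtain ⟨J, hJ, hle⟩ := (Ideal.subset_union_prime_finite (hfin.insert _) (f := id)
        (maximalIdeal R ^ 2) (maximalIdeal R ^ 2) (fun I hI h1 _ ↦
          (Set.mem_of_mem_insert_of_ne hI h1).isPrime)).mp hsub
      rcases hJ with rfl | hJ
      · exact hm2 hle
      · have : a ∈ (⋃ p ∈ associatedPrimes R (R ⧸ I), (p : Set R)) :=
          Set.mem_biUnion hJ (hle ham)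
        rw [hzd] at this
        exact this (isSMulRegular_quotient_iff.mpr ha)
    -- the maximal ideal remains associated after the replacement
    obtain ⟨w', hw', h'⟩ := exists_socle_exchange hz ha hzI ⟨w, hw, h⟩
    obtain ⟨hregz, hd⟩ := isRegularLocalRing_quotient_span_singleton hz hz2
    have hperm : IsWeaklyRegular R (z :: l) :=
      IsLocalRing.isWeaklyRegular_of_perm_of_subset_maximalIdeal
        (isWeaklyRegular_append_singleton_iff.mpr ⟨hreg, hzI⟩) (List.perm_append_singleton z l)
        (by
          intro b hb
          rcases List.mem_append.mp hb with hb | hb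
          · exact hlm b hb
          · exact List.mem_singleton.mp hb ▸ hz)
    have hq : IsWeaklyRegular (R ⧸ Ideal.span {z}) l :=
      ((Submodule.quotEquivOfEq _ _ (by
        rw [← Submodule.ideal_span_singleton_smul, smul_eq_mul,
          Ideal.mul_top])).isWeaklyRegular_congr l).mp ((isWeaklyRegular_cons_iff R z l).mp hperm).2
    have hq' := (isWeaklyRegular_map_algebraMap_iff (R ⧸ Ideal.span {z})
      (R ⧸ Ideal.span {z}) l).mpr hq
    have hmap (y : R) : Ideal.Quotient.mk (Ideal.span {z}) y ∈
        Ideal.ofList (l.map (algebraMap R (R ⧸ Ideal.span {z}))) ↔ y ∈ I ⊔ Ideal.span {z} := by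
      rw [← Ideal.map_ofList, Ideal.Quotient.algebraMap_eq,
        Ideal.mem_quotient_iff_mem_sup]
    have := ih (R ⧸ Ideal.span {z})
      (l.map (algebraMap R (R ⧸ Ideal.span {z}))) (by simpa using hl) (by
        intro c hc
        obtain ⟨b, hb, rfl⟩ := List.mem_map.mp hc
        rw [← IsLocalRing.map_maximalIdeal_of_surjective (Ideal.Quotient.mk (Ideal.span {z}))
          Ideal.Quotient.mk_surjective]
        exact Ideal.mem_map_of_mem _ (hlm b hb)) hq'
      ⟨Ideal.Quotient.mk _ w', by rwa [hmap], fun m hm ↦ by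
        rw [← IsLocalRing.map_maximalIdeal_of_surjective (Ideal.Quotient.mk (Ideal.span {z}))
          Ideal.Quotient.mk_surjective, Ideal.mem_map_iff_of_surjective _
            Ideal.Quotient.mk_surjective] at hm
        obtain ⟨m, hm, rfl⟩ := hm
        rw [← map_mul, hmap]
        exact h' m hm⟩
    rw [← hd, this]
    push_cast
    rfl

/-- A complete intersection in a regular ring has no embedded components: an element outside all
minimal primes of an ideal generated by a regular sequence is regular modulo that ideal. -/
theorem mem_of_mul_mem_of_isWeaklyRegular {P : Type u} [CommRing P] [IsRegularRing P] {l : List P}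
    (hl : IsWeaklyRegular P l) {g : P} (hg : ∀ p ∈ (Ideal.ofList l).minimalPrimes, g ∉ p) {x : P}
    (hx : g * x ∈ Ideal.ofList l) : x ∈ Ideal.ofList l := by
  by_contra hxI
  set I := Ideal.ofList l
  have hzd := biUnion_associatedPrimes_eq_compl_regular P (P ⧸ I)
  have hmem : g ∈ ⋃ p ∈ associatedPrimes P (P ⧸ I), (p : Set P) := by
    rw [hzd]
    exact fun h ↦ hxI (isSMulRegular_quotient_iff.mp h x hx)
  simp only [Set.mem_iUnion] at hmem
  obtain ⟨q, hq, hgq⟩ := hmem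
  obtain ⟨hq, w, hw⟩ := isAssociatedPrime_iff.mp hq
  obtain ⟨w, rfl⟩ := Ideal.Quotient.mk_surjective w
  have hq' (y : P) : y ∈ q ↔ y * w ∈ I := by
    rw [hw, Submodule.mem_colon_singleton, Submodule.mem_bot, Algebra.smul_def,
      Ideal.Quotient.algebraMap_eq, ← map_mul, Ideal.Quotient.eq_zero_iff_mem]
  have hIq : I ≤ q := fun y hy ↦ (hq' y).mpr (I.mul_mem_right _ hy)
  have hlq : ∀ a ∈ l, a ∈ q := fun a ha ↦ hIq (Ideal.subset_span ha)
  -- `q` is an associated prime that contains `g`; the quotient of its local ring by `I` has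
  -- dimension zero, since a maximal ideal that is associated forces `dim = length`
  let S := Localization.AtPrime q
  have hreg : IsRegular S (l.map (algebraMap P S)) := hl.isRegular_of_isLocalization_of_mem S q hlq
  have hmap : Ideal.ofList (l.map (algebraMap P S)) = I.map (algebraMap P S) :=
    (Ideal.map_ofList _ _).symm
  have hdim := ringKrullDim_eq_length_of_socle _ S (l.map (algebraMap P S)) rfl (by
    intro a ha
    obtain ⟨b, hb, rfl⟩ := List.mem_map.mp ha
    exact (IsLocalization.AtPrime.to_map_mem_maximal_iff S q b).mpr (hlq b hb)) hreg.1
    ⟨algebraMap P S w, fun h ↦ by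
      rw [hmap, IsLocalization.algebraMap_mem_map_algebraMap_iff q.primeCompl] at h
      obtain ⟨u, hu, h⟩ := h
      exact hu ((hq' u).mpr h), fun m hm ↦ by
      rw [← Localization.AtPrime.map_eq_maximalIdeal] at hm
      rw [hmap]
      induction hm using Submodule.span_induction with
      | mem x hx =>
        obtain ⟨y, hy, rfl⟩ := hx
        rw [← map_mul]
        exact Ideal.mem_map_of_mem _ ((hq' y).mp hy)
      | zero => simp
      | add x y _ _ hx hy => rw [add_mul]; exact Ideal.add_mem _ hx hy
      | smul a x _ hx => rw [smul_eq_mul, mul_assoc]; exact Ideal.mul_mem_left _ _ hx⟩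
  have h0 := ringKrullDim_add_length_eq_ringKrullDim_of_isRegular _ hreg
  rw [hdim, hmap] at h0
  have hmin : q ∈ I.minimalPrimes := by
    refine ⟨⟨hq, hIq⟩, fun p ⟨hp, hIp⟩ hpq ↦ ?_⟩
    have hd0 : ringKrullDim (S ⧸ I.map (algebraMap P S)) ≤ 0 := by
      generalize ringKrullDim (S ⧸ I.map (algebraMap P S)) = d at h0
      induction d with
      | bot => exact bot_le
      | coe d =>
        have h1 : d + ((l.map (algebraMap P S)).length : ℕ∞) =
            ((l.map (algebraMap P S)).length : ℕ∞) := by exact_mod_cast h0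
        have h2 : d ≤ 0 := (ENat.add_le_add_iff_right (ENat.natCast_ne_top _)).mp
          (h1.trans (zero_add _).symm).le
        exact_mod_cast h2
    have hle : Ring.KrullDimLE 0 (S ⧸ I.map (algebraMap P S)) := Ring.krullDimLE_iff.mpr hd0
    have hdisj : Disjoint (q.primeCompl : Set P) p :=
      Set.disjoint_left.mpr fun x hx hxp ↦ hx (hpq hxp)
    have hpS := IsLocalization.isPrime_of_isPrime_disjoint q.primeCompl S p hp hdisj
    have hker : RingHom.ker (Ideal.Quotient.mk (I.map (algebraMap P S))) ≤
        p.map (algebraMap P S) := by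
      rw [Ideal.mk_ker]; exact Ideal.map_mono hIp
    have hprime := Ideal.map_isPrime_of_surjective Ideal.Quotient.mk_surjective hker
    have hmax := hprime.isMaximal'
    have hmax' := Ideal.comap_isMaximal_of_surjective _ Ideal.Quotient.mk_surjective (K :=
      (p.map (algebraMap P S)).map (Ideal.Quotient.mk (I.map (algebraMap P S))))
    rw [Ideal.comap_map_of_surjective' _ Ideal.Quotient.mk_surjective,
      sup_eq_left.mpr hker] at hmax'
    have heq := IsLocalRing.eq_maximalIdeal hmax'
    intro y hy
    rw [← IsLocalization.under_map_of_isPrime_disjoint q.primeCompl S hp hdisj, heq]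
    exact (IsLocalization.AtPrime.to_map_mem_maximal_iff S q y).mpr hy
  exact hg q hmin hgq

end Unmixed

end Newton

/-! ### Differentials of complete intersections -/

namespace Newton

open RingTheory.Sequence TensorProduct KaehlerDifferential

section Conormal

/-- The members of a regular sequence are independent modulo the square of the ideal they
generate. -/
lemma mem_ofList_of_sum_mul_eq_zero {R : Type*} [CommRing R] : ∀ (n : ℕ) (l : List R),
    l.length = n → IsWeaklyRegular R l →
    ∀ a : Fin l.length → R, ∑ i, a i * l.get i = 0 → ∀ i, a i ∈ Ideal.ofList l := by
  intro n
  induction n with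
  | zero =>
    intro l hl _ a _ i
    exact absurd i.2 (by omega)
  | succ n ih =>
    intro l hl hreg
    obtain ⟨l, b, rfl⟩ : ∃ l' b, l = l' ++ [b] := by
      rcases List.eq_nil_or_concat l with rfl | ⟨l', b, rfl⟩
      · simp at hl
      · exact ⟨l', b, List.concat_eq_append⟩
    obtain ⟨hreg, hb⟩ := isWeaklyRegular_append_singleton_iff.mp hreg
    have hlen : (l ++ [b]).length = l.length + 1 := by simp
    suffices H : ∀ a : Fin (l.length + 1) → R, ∑ i : Fin l.length, a i.castSucc * l.get i +
        a (Fin.last _) * b = 0 → ∀ i, a i ∈ Ideal.ofList (l ++ [b]) by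
      intro a ha i
      have := H (fun j ↦ a (j.cast hlen.symm)) (by
        rw [← ha, ← (finCongr hlen.symm).sum_comp, Fin.sum_univ_castSucc]
        simp) (i.cast hlen)
      simpa using this
    intro a ha
    have hle : Ideal.ofList l ≤ Ideal.ofList (l ++ [b]) := by
      rw [Ideal.ofList_append]; exact le_sup_left
    have hmem : a (Fin.last _) ∈ Ideal.ofList l := by
      refine hb _ ?_
      rw [mul_comm, ← neg_eq_iff_add_eq_zero.mpr ha]
      refine (Ideal.neg_mem_iff _).mpr (Ideal.sum_mem _ fun i _ ↦ Ideal.mul_mem_left _ _ ?_)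
      exact Ideal.subset_span (List.get_mem _ _)
    have hspan : Ideal.ofList l = Ideal.span (Set.range l.get) := by
      rw [Set.range_list_get]
    rw [hspan] at hmem
    obtain ⟨c, hc⟩ := (Ideal.mem_span_range_iff_exists_fun).mp hmem
    have h0 := ih l (by simpa using hl) hreg (fun i ↦ a i.castSucc + c i * b) (by
      rw [← ha, ← hc, Finset.sum_mul, ← Finset.sum_add_distrib]
      exact Finset.sum_congr rfl fun i _ ↦ by ring)
    intro i
    induction i using Fin.lastCases with
    | last => exact hle (hspan ▸ hmem)
    | cast i =>
      have hbm : b ∈ Ideal.ofList (l ++ [b]) := Ideal.subset_span (by simp)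
      have := Ideal.sub_mem _ (hle (h0 i)) (Ideal.mul_mem_left _ (c i) hbm)
      simpa using this

variable {k B : Type u} [CommRing k] [CommRing B] [Algebra k B]

/-- The conormal module of a regular sequence is free on the members of the sequence. -/
lemma nonempty_cotangent_equiv {ι : Type} [Finite ι] {l : List (MvPolynomial ι k)}
    (P : Algebra.Presentation k B ι (Fin l.length)) (hP : P.relation = l.get)
    (hl : IsWeaklyRegular (MvPolynomial ι k) l) :
    Nonempty (P.toExtension.Cotangent ≃ₗ[B] (Fin l.length → B)) := by
  have hker : Ideal.ofList l = P.ker := by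
    rw [← P.span_range_relation_eq_ker, hP, Set.range_list_get]
  let f := Algebra.Presentation.differentials.hom₁ P
  refine ⟨((LinearEquiv.ofBijective f
    ⟨?_, Algebra.Presentation.differentials.surjective_hom₁ P⟩).symm.trans
    (Finsupp.linearEquivFunOnFinite B B _))⟩
  rw [injective_iff_map_eq_zero]
  intro v hv
  choose a ha using fun i ↦ P.algebraMap_surjective (v i)
  have hmem (i) : P.relation i ∈ P.toExtension.ker := P.relation_mem_ker i
  let mk := Algebra.Extension.Cotangent.mk (P := P.toExtension)
  let r (i) : P.toExtension.ker := ⟨P.relation i, hmem i⟩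
  have hsum : f v = mk (∑ i, (show P.toExtension.Ring from a i) • r i) := by
    rw [map_sum mk]
    refine (Finsupp.linearCombination_apply B v).trans ?_
    refine (Finsupp.sum_fintype v (fun i b ↦ b • mk (r i)) fun i ↦ zero_smul B _).trans ?_
    refine Finset.sum_congr rfl fun i _ ↦ ?_
    rw [map_smul mk, ← ha i]
    exact algebraMap_smul (R := P.toExtension.Ring) B (a i) (mk (r i))
  rw [hsum, Algebra.Extension.Cotangent.mk_eq_zero_iff] at hv
  have hv' : ∑ i, a i * P.relation i ∈ P.ker • Ideal.span (Set.range P.relation) := by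
    rw [P.span_range_relation_eq_ker, smul_eq_mul, ← pow_two]
    have hcoe : ((∑ i, (show P.toExtension.Ring from a i) • r i : P.toExtension.ker) :
        P.toExtension.Ring) = ∑ i, a i * P.relation i := Submodule.coe_sum _ _ _
    exact hcoe ▸ hv
  obtain ⟨b, hb, hbs⟩ := (Submodule.mem_ideal_smul_span_iff_exists_sum _ _ _).mp hv'
  rw [Finsupp.sum_fintype _ _ (by simp)] at hbs
  have key := mem_ofList_of_sum_mul_eq_zero _ l rfl hl (fun i ↦ a i - b i) (by
    rw [← hP]
    simp only [sub_mul, Finset.sum_sub_distrib]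
    rw [sub_eq_zero, ← hbs]; rfl)
  ext i
  have h1 : a i ∈ P.ker := by
    have := P.ker.add_mem (hker ▸ key i) (hb i)
    simpa using this
  rw [← ha i]
  exact h1

end Conormal

section Rank

variable {k B B' : Type u} [CommRing k] [CommRing B] [Algebra k B] [CommRing B'] [Algebra k B']
  [Algebra B B'] [IsScalarTower k B B']

/-- If the conormal module of a presentation with `n` variables is free of rank `s` and some basic
open subset is smooth of relative dimension `d`, then `n = s + d`. -/
lemma card_eq_of_cotangent_equiv {ι σ : Type} [Fintype ι] [Fintype σ]
    (P : Algebra.Generators k B ι) (e : P.toExtension.Cotangent ≃ₗ[B] (σ → B)) (h : B)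
    [IsLocalization.Away h B'] [Nontrivial B'] [Algebra.FormallySmooth k B'] {d : ℕ}
    (eΩ : Ω[B'⁄k] ≃ₗ[B'] (Fin d → B')) : Fintype.card ι = Fintype.card σ + d := by
  classical
  -- compare ranks in the conormal sequence of the presentation of `B'` with one more variable for
  -- the inverse of `h`; it is split exact because `B'` is smooth
  let Q := (Algebra.Generators.localizationAway B' h).comp P
  have hsub : Subsingleton Q.toExtension.H1Cotangent :=
    (Algebra.Generators.H1Cotangent.equiv Q (Algebra.Generators.self k B')).toEquiv.subsingleton
  have hinj : Function.Injective Q.toExtension.cotangentComplex :=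
    (Algebra.Extension.subsingleton_h1Cotangent _).mp hsub
  have hx : ∃ x, Algebra.Extension.Cotangent.map
      ((Algebra.Generators.localizationAway B' h).ofComp P).toExtensionHom x =
        Algebra.Generators.cMulXSubOneCotangent B' h :=
    (Algebra.Generators.Cotangent.surjective_map_ofComp _ P) _
  obtain ⟨x, hx⟩ := hx
  let e₁ := Algebra.Generators.cotangentCompLocalizationAwayEquiv h P hx
  let e₂ : Q.toExtension.Cotangent ≃ₗ[B'] (σ → B') × (Unit → B') :=
    e₁.trans (LinearEquiv.prodCongr
      ((e.baseChange B B' _ _).trans (TensorProduct.piScalarRight B B' B' σ))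
      (Algebra.Generators.basisCotangentAway B' h).equivFun)
  have : Module.Projective B' Ω[B'⁄k] := .of_equiv eΩ.symm
  obtain ⟨s, hs⟩ := Module.projective_lifting_property Q.toExtension.toKaehler LinearMap.id
    Q.toExtension.toKaehler_surjective
  let e₃ := (Q.toExtension.exact_cotangentComplex_toKaehler.splitSurjectiveEquiv hinj ⟨s, hs⟩).1
  have h1 : Module.finrank B' Q.toExtension.CotangentSpace = 1 + Fintype.card ι := by
    rw [Module.finrank_eq_card_basis Q.cotangentSpaceBasis]; simp
  have h2 := (e₃.trans (LinearEquiv.prodCongr e₂ eΩ)).finrank_eq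
  rw [h1, Module.finrank_prod, Module.finrank_prod] at h2
  simp at h2
  omega

end Rank

section Fitting

/-- If two square matrices have isomorphic cokernels, then the determinant of the first one is a
multiple of that of the second one. -/
lemma det_mem_span_det {R M : Type*} [CommRing R] [AddCommGroup M] [Module R M]
    {m n : Type*} [Fintype m] [Fintype n] [DecidableEq m] [DecidableEq n]
    {A : Matrix n n R} {J : Matrix m m R} {p : (n → R) →ₗ[R] M} {q : (m → R) →ₗ[R] M}
    (hp : Function.Surjective p) (hq : Function.Surjective q)
    (hA : Function.Exact A.mulVecLin p) (hJ : Function.Exact J.mulVecLin q) :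
    A.det ∈ Ideal.span {J.det} := by
  -- lift `p` along `q` and conversely, and compare two presentations of the sum of `p` and `q`
  obtain ⟨σ, hσ⟩ := Module.projective_lifting_property q p hq
  obtain ⟨τ, hτ⟩ := Module.projective_lifting_property p q hp
  let S := LinearMap.toMatrix' σ
  let T := LinearMap.toMatrix' τ
  have hS (v) : S.mulVec v = σ v := LinearMap.toMatrix'_mulVec σ v
  have hT (v) : T.mulVec v = τ v := LinearMap.toMatrix'_mulVec τ v
  have hσ' (v) : q (σ v) = p v := LinearMap.congr_fun hσ v
  have hτ' (v) : p (τ v) = q v := LinearMap.congr_fun hτ v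
  let M₁ : Matrix (n ⊕ m) (n ⊕ m) R := Matrix.fromBlocks A (-T) 0 1
  let M₂ : Matrix (n ⊕ m) (n ⊕ m) R := Matrix.fromBlocks 1 0 (-S) J
  have hd₁ : M₁.det = A.det := by simp [M₁]
  have hd₂ : M₂.det = J.det := by simp [M₂]
  have key : ∀ v : n ⊕ m → R, ∃ w, M₂.mulVec w = M₁.mulVec v := by
    intro v
    have hq0 : q ((M₁.mulVec v) ∘ Sum.inr + σ ((M₁.mulVec v) ∘ Sum.inl)) = 0 := by
      have h1 : (M₁.mulVec v) ∘ Sum.inl = A.mulVec (v ∘ Sum.inl) - τ (v ∘ Sum.inr) := by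
        rw [Matrix.fromBlocks_mulVec, ← hT]; ext i; simp [Matrix.neg_mulVec, sub_eq_add_neg]
      have h2 : (M₁.mulVec v) ∘ Sum.inr = v ∘ Sum.inr := by
        rw [Matrix.fromBlocks_mulVec]; ext i; simp
      rw [map_add, hσ', h1, h2, map_sub, hτ']
      have : p (A.mulVec (v ∘ Sum.inl)) = 0 := hA.apply_apply_eq_zero _
      rw [this]; abel
    obtain ⟨u, hu⟩ := (hJ _).mp hq0
    refine ⟨Sum.elim ((M₁.mulVec v) ∘ Sum.inl) u, ?_⟩
    rw [Matrix.fromBlocks_mulVec]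
    ext (i | i)
    · simp
    · have := congrFun hu i
      simp only [Matrix.mulVecLin_apply, Pi.add_apply, Function.comp_apply] at this
      simp only [Sum.elim_comp_inl, Sum.elim_comp_inr, Sum.elim_inr, Pi.add_apply,
        Matrix.neg_mulVec, Pi.neg_apply, this, hS]
      ring
  choose w hw using fun j ↦ key (Pi.single j 1)
  have hmul : M₁ = M₂ * Matrix.of fun i j ↦ w j i := by
    ext i j
    have := congrFun (hw j) i
    rw [Matrix.mulVec_single_one] at this
    exact this.symm
  rw [← hd₁, ← hd₂, hmul, Matrix.det_mul]
  exact Ideal.mul_mem_right _ _ (Ideal.mem_span_singleton_self _)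

/-- The divisor ideal of a torsion module can be computed from a single square presentation. -/
lemma divIdeal_eq_span_det {R M : Type u} [CommRing R] [AddCommGroup M] [Module R M] {n : Type*}
    [Fintype n] [DecidableEq n] {J : Matrix n n R} {q : (n → R) →ₗ[R] M}
    (hq : Function.Surjective q) (hJ : Function.Exact J.mulVecLin q)
    (hdet : J.det ∈ nonZeroDivisors R) : divIdeal R M = Ideal.span {J.det} := by
  apply le_antisymm
  · refine Ideal.span_le.mpr ?_
    rintro _ ⟨m, A, -, ⟨e⟩, rfl⟩
    refine det_mem_span_det (p := e.toLinearMap ∘ₗ (LinearMap.range A.mulVecLin).mkQ) (q := q)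
      (e.surjective.comp (Submodule.mkQ_surjective _)) hq ?_ hJ
    rw [LinearMap.exact_iff, LinearEquiv.ker_comp, Submodule.ker_mkQ]
  · rw [Ideal.span_singleton_le_iff_mem]
    let ε := Fintype.equivFin n
    refine Ideal.subset_span ⟨_, J.reindex ε ε, ?_, ⟨?_⟩, Matrix.det_reindex_self _ _⟩
    · refine Matrix.mulVec_injective_of_det_mem_nonZeroDivisors ?_
      rwa [Matrix.det_reindex_self]
    · have hex : Function.Exact (J.reindex ε ε).mulVecLin
          (q ∘ₗ (LinearEquiv.funCongrLeft R R ε).toLinearMap) := by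
        rw [Matrix.mulVecLin_reindex, LinearMap.exact_iff, LinearMap.ker_comp,
          hJ.linearMap_ker_eq, ← LinearMap.comp_assoc, LinearMap.range_comp_of_range_eq_top _
            (LinearEquiv.range _), LinearMap.range_comp]
        exact Submodule.comap_equiv_eq_map_symm (LinearEquiv.funCongrLeft R R ε) _
      refine (Submodule.quotEquivOfEq _ _ hex.linearMap_ker_eq.symm).trans
        (LinearMap.quotKerEquivOfSurjective _ (hq.comp (LinearEquiv.surjective _)))

end Fitting

end Newton

/-! ### Jacobian presentations -/

namespace Newton

open TensorProduct KaehlerDifferential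

section Etale

open Algebra in
/-- A finitely presented algebra with as many variables as relations becomes étale after inverting
the Jacobian. -/
lemma etale_of_isLocalization_away_jacobian {R S T : Type*} [CommRing R] [CommRing S] [CommRing T]
    [Algebra R S] [Algebra R T] [Algebra S T] [IsScalarTower R S T] {σ : Type} [Finite σ]
    (P : PreSubmersivePresentation R S σ σ) [IsLocalization.Away P.jacobian T] :
    Algebra.Etale R T := by
  let L := SubmersivePresentation.localizationAway T P.jacobian
  have hu : IsUnit (L.toPreSubmersivePresentation.comp P).jacobian := by
    rw [PreSubmersivePresentation.comp_jacobian_eq_jacobian_smul_jacobian]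
    rw [Algebra.smul_def, mul_comm]
    exact L.jacobian_isUnit.mul (IsLocalization.Away.algebraMap_isUnit P.jacobian)
  let Q : SubmersivePresentation R T (Unit ⊕ σ) (Unit ⊕ σ) :=
    { L.toPreSubmersivePresentation.comp P with jacobian_isUnit := hu }
  have : IsStandardSmoothOfRelativeDimension 0 R T :=
    ⟨Unit ⊕ σ, Unit ⊕ σ, inferInstance, inferInstance, Q, by simp [Presentation.dimension]⟩
  infer_instance

end Etale

section Localization

/-- Presentations by square matrices are compatible with localization. -/
lemma exact_mulVecLin_of_isLocalizedModule {B R M M' : Type*} [CommRing B] [CommRing R]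
    [Algebra B R]
    (S : Submonoid B) [IsLocalization S R] [AddCommGroup M] [Module B M] [AddCommGroup M']
    [Module B M'] [Module R M'] [IsScalarTower B R M'] (h : M →ₗ[B] M') [IsLocalizedModule S h]
    {ι : Type*} [Fintype ι] [DecidableEq ι] {A : Matrix ι ι B} {v : ι → M}
    (hs : Function.Surjective (Fintype.linearCombination B v))
    (he : Function.Exact A.mulVecLin (Fintype.linearCombination B v)) :
    Function.Surjective (Fintype.linearCombination R (h ∘ v)) ∧
    Function.Exact (A.map (algebraMap B R)).mulVecLin (Fintype.linearCombination R (h ∘ v)) := by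
  have key (y : ι → B) : Fintype.linearCombination R (h ∘ v) (algebraMap B R ∘ y) =
      h (Fintype.linearCombination B v y) := by
    simp [Fintype.linearCombination_apply]
  have hA (y : ι → B) : (A.map (algebraMap B R)).mulVec (algebraMap B R ∘ y) =
      algebraMap B R ∘ A.mulVec y := by
    ext i; simp [Matrix.mulVec, dotProduct]
  refine ⟨fun m ↦ ?_, fun x ↦ ⟨fun hx ↦ ?_, ?_⟩⟩
  · obtain ⟨⟨m, s⟩, e⟩ := IsLocalizedModule.surj S h m
    obtain ⟨y, rfl⟩ := hs m
    refine ⟨IsLocalization.mk' R 1 s • (algebraMap B R ∘ y), ?_⟩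
    rw [map_smul, key, ← e, Submonoid.smul_def, ← algebraMap_smul R (s : B), smul_smul,
      IsLocalization.mk'_spec, map_one, one_smul]
  · obtain ⟨s, hs'⟩ := IsLocalization.exist_integer_multiples_of_finite S x
    choose y hy using hs'
    have hxy : algebraMap B R ∘ y = algebraMap B R s • x := by
      ext i; simp [hy, Algebra.smul_def]
    have h0 : h (Fintype.linearCombination B v y) = 0 := by rw [← key, hxy, map_smul, hx, smul_zero]
    obtain ⟨t, ht⟩ := (IsLocalizedModule.eq_zero_iff S h).mp h0
    rw [Submonoid.smul_def, ← map_smul] at ht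
    obtain ⟨z, hz⟩ := (he _).mp ht
    refine ⟨IsLocalization.mk' R 1 (t * s) • (algebraMap B R ∘ z), ?_⟩
    rw [map_smul, Matrix.mulVecLin_apply, hA]
    rw [Matrix.mulVecLin_apply] at hz
    have : algebraMap B R ∘ A.mulVec z = algebraMap B R (t * s : S) • x := by
      rw [hz]; ext i
      have := congrFun hxy i
      simp only [Function.comp_apply, Pi.smul_apply, smul_eq_mul, map_mul,
        Submonoid.coe_mul] at this ⊢
      rw [this, mul_assoc]
    rw [this, smul_smul, IsLocalization.mk'_spec, map_one, one_smul]
  · rintro ⟨x, rfl⟩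
    obtain ⟨s, hs'⟩ := IsLocalization.exist_integer_multiples_of_finite S x
    choose y hy using hs'
    have hxy : algebraMap B R ∘ y = algebraMap B R s • x := by
      ext i; simp [hy, Algebra.smul_def]
    refine ((IsLocalization.map_units R s).smul_eq_zero (x := Fintype.linearCombination R (h ∘ v)
      ((A.map (algebraMap B R)).mulVecLin x))).mp ?_
    rw [← map_smul, ← map_smul, ← hxy, Matrix.mulVecLin_apply, hA, key]
    have := he.apply_apply_eq_zero y
    rw [Matrix.mulVecLin_apply] at this
    rw [this, map_zero]

/-- A presentation in terms of finitely supported functions is a presentation by a matrix. -/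
lemma exact_mulVecLin_of_finsupp {B M : Type*} [CommRing B] [AddCommGroup M] [Module B M]
    {ι : Type*} [Fintype ι] [DecidableEq ι] {A : Matrix ι ι B} {v : ι → M}
    (μ : (ι →₀ B) →ₗ[B] (ι →₀ B)) (p : (ι →₀ B) →ₗ[B] M)
    (hp : ∀ i, p (Finsupp.single i 1) = v i) (hμ : ∀ i j, μ (Finsupp.single i 1) j = A j i)
    (hs : Function.Surjective p) (he : Function.Exact μ p) :
    Function.Surjective (Fintype.linearCombination B v) ∧
    Function.Exact A.mulVecLin (Fintype.linearCombination B v) := by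
  let ε := Finsupp.linearEquivFunOnFinite B B ι
  have e1 : Fintype.linearCombination B v ∘ₗ ε.toLinearMap = p := by
    refine Finsupp.lhom_ext' fun i ↦ LinearMap.ext_ring ?_
    change Fintype.linearCombination B v (ε (Finsupp.single i 1)) = p (Finsupp.single i 1)
    rw [Finsupp.linearEquivFunOnFinite_single, Fintype.linearCombination_apply_single, one_smul, hp]
  have e2 : A.mulVecLin ∘ₗ ε.toLinearMap = ε.toLinearMap ∘ₗ μ := by
    refine Finsupp.lhom_ext' fun i ↦ LinearMap.ext_ring ?_
    change A.mulVec (ε (Finsupp.single i 1)) = ε (μ (Finsupp.single i 1))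
    rw [Finsupp.linearEquivFunOnFinite_single, Matrix.mulVec_single_one]
    ext j
    exact (hμ i j).symm
  constructor
  · rw [← e1] at hs
    exact Function.Surjective.of_comp hs
  · exact (LinearMap.exact_iff_of_surjective_of_bijective_of_injective μ p A.mulVecLin
      (Fintype.linearCombination B v) ε.toLinearMap ε.toLinearMap LinearMap.id e2
      (by rw [e1]; rfl) ε.surjective ε.bijective Function.injective_id).mp he

end Localization

section Graph

open MvPolynomial

variable {k B : Type u} [CommRing k] [CommRing B] [Algebra k B] {σ κ : Type}

/-- The matrix of partial derivatives of a family of polynomials. -/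
noncomputable def jacobiMat {ι : Type*} {k : Type*} [CommRing k] (F : ι → MvPolynomial ι k) :
    Matrix ι ι (MvPolynomial ι k) := Matrix.of fun i j ↦ pderiv j (F i)

variable (k σ κ) in
/-- Polynomials in `x` as polynomials in `x` with coefficients polynomials in `y`. -/
noncomputable abbrev constMap :
    MvPolynomial (σ ⊕ κ) k →+* MvPolynomial (σ ⊕ κ) (MvPolynomial κ k) :=
  MvPolynomial.map MvPolynomial.C

/-- The substitution `y = φ(x)`. -/
noncomputable abbrev graphEval (φ : κ → MvPolynomial (σ ⊕ κ) k) :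
    MvPolynomial (σ ⊕ κ) (MvPolynomial κ k) →+* MvPolynomial (σ ⊕ κ) k :=
  eval₂Hom (aeval φ : MvPolynomial κ k →ₐ[k] MvPolynomial (σ ⊕ κ) k).toRingHom X

lemma graphEval_constMap (φ : κ → MvPolynomial (σ ⊕ κ) k) (p : MvPolynomial (σ ⊕ κ) k) :
    graphEval φ (constMap k σ κ p) = p := by
  have : (graphEval φ).comp (constMap k σ κ) = RingHom.id (MvPolynomial (σ ⊕ κ) k) := by
    ext i <;> simp
  exact RingHom.congr_fun this p

variable (ψ : MvPolynomial (σ ⊕ κ) k →ₐ[k] B) (f : σ → MvPolynomial (σ ⊕ κ) k)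
    (φ : κ → MvPolynomial (σ ⊕ κ) k) (hψ : Function.Surjective ψ)
    (hker : RingHom.ker ψ = Ideal.span (Set.range f)) [Algebra (MvPolynomial κ k) B]
    (halg : ∀ p, algebraMap (MvPolynomial κ k) B p = ψ (aeval φ p))

/-- An algebra `k[x] / (f)` as an algebra over `k[y]` through `y ↦ φ(x)` is presented by the
variables `x` and the relations `f(x) = 0` and `φ(x) = y`. -/
noncomputable def graphPresentation :
    Algebra.PreSubmersivePresentation (MvPolynomial κ k) B (σ ⊕ κ) (σ ⊕ κ) where
  toGenerators := .ofSurjective (fun i ↦ ψ (X i)) (by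
    intro b
    obtain ⟨p, rfl⟩ := hψ b
    refine ⟨constMap k σ κ p, ?_⟩
    have : (aeval (R := MvPolynomial κ k) (fun i ↦ ψ (X i))).toRingHom.comp (constMap k σ κ) =
        ψ.toRingHom := by
      ext i
      · simp [halg]
      · simp
    exact RingHom.congr_fun this p)
  relation := Sum.elim (fun s ↦ constMap k σ κ (f s)) (fun l ↦ constMap k σ κ (φ l) - C (X l))
  span_range_relation_eq_ker := by
    have h1 : (aeval (R := MvPolynomial κ k) (fun i ↦ ψ (X i))).toRingHom =
        ψ.toRingHom.comp (graphEval φ) := by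
      ext i <;> simp [halg]
    set N := Ideal.span (Set.range (Sum.elim (fun s ↦ constMap k σ κ (f s))
      (fun l ↦ constMap k σ κ (φ l) - C (X l))))
    have h2 : (Ideal.Quotient.mk N) =
        ((Ideal.Quotient.mk N).comp (constMap k σ κ)).comp (graphEval φ) := by
      ext i
      · simp
      · simp
        refine (Ideal.Quotient.eq.mpr ?_).symm
        exact Ideal.subset_span ⟨Sum.inr i, rfl⟩
      · simp
    change N = RingHom.ker (aeval (R := MvPolynomial κ k) (fun i ↦ ψ (X i))).toRingHom
    apply le_antisymm
    · refine Ideal.span_le.mpr ?_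
      rintro _ ⟨s | l, rfl⟩
      · have : f s ∈ RingHom.ker ψ := hker ▸ Ideal.subset_span ⟨s, rfl⟩
        rw [SetLike.mem_coe, RingHom.mem_ker, h1]
        exact (congrArg ψ (graphEval_constMap φ (f s))).trans this
      · rw [SetLike.mem_coe, RingHom.mem_ker, h1]
        change ψ (graphEval φ (constMap k σ κ (φ l) - C (X l))) = 0
        rw [map_sub, graphEval_constMap, map_sub]
        simp
    · intro p hp
      rw [RingHom.mem_ker, h1] at hp
      have hp' : graphEval φ p ∈ RingHom.ker ψ := hp
      rw [hker] at hp'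
      rw [← Ideal.Quotient.eq_zero_iff_mem, h2]
      refine Ideal.Quotient.eq_zero_iff_mem.mpr ?_
      have hle : Ideal.span (Set.range f) ≤ N.comap (constMap k σ κ) := by
        rw [Ideal.span_le]
        rintro _ ⟨s, rfl⟩
        exact Ideal.subset_span ⟨Sum.inl s, rfl⟩
      exact hle hp'
  map := id
  map_inj := Function.injective_id

lemma graphPresentation_jacobiMatrix [Fintype σ] [Fintype κ] [DecidableEq (σ ⊕ κ)] :
    (graphPresentation ψ f φ hψ hker halg).jacobiMatrix =
      (jacobiMat (Sum.elim f φ)).transpose.map (constMap k σ κ) := by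
  ext1 i j
  rw [Algebra.PreSubmersivePresentation.jacobiMatrix_apply]
  rcases j with j | j <;> simp [graphPresentation, jacobiMat, pderiv_map]

lemma graphPresentation_algebraMap (p) :
    algebraMap (graphPresentation ψ f φ hψ hker halg).Ring B (constMap k σ κ p) = ψ p := by
  rw [(graphPresentation ψ f φ hψ hker halg).algebraMap_apply]
  change aeval (R := MvPolynomial κ k) (fun i ↦ ψ (X i)) (constMap k σ κ p) = ψ p
  have : (aeval (R := MvPolynomial κ k) (fun i ↦ ψ (X i))).toRingHom.comp (constMap k σ κ) =
      ψ.toRingHom := by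
    ext i
    · simp [halg]
    · simp
  exact RingHom.congr_fun this p

lemma graphPresentation_jacobian [Fintype σ] [Fintype κ] [DecidableEq (σ ⊕ κ)] :
    (graphPresentation ψ f φ hψ hker halg).jacobian = ψ (jacobiMat (Sum.elim f φ)).det := by
  rw [Algebra.PreSubmersivePresentation.jacobian_eq_jacobiMatrix_det,
    graphPresentation_jacobiMatrix, ← Matrix.det_transpose (jacobiMat _),
    ← graphPresentation_algebraMap ψ f φ hψ hker halg]
  exact congrArg (algebraMap _ B) (RingHom.map_det (constMap k σ κ) _).symm

include hψ hker halg in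
/-- The differentials of `k[x] / (f)` over `k[y]` are presented by the Jacobian matrix. -/
lemma exact_jacobiMat [Fintype σ] [Fintype κ] [DecidableEq (σ ⊕ κ)] :
    Function.Surjective
      (Fintype.linearCombination B fun i ↦ D (MvPolynomial κ k) B (ψ (X i))) ∧
    Function.Exact ((jacobiMat (Sum.elim f φ)).transpose.map ψ).mulVecLin
      (Fintype.linearCombination B fun i ↦ D (MvPolynomial κ k) B (ψ (X i))) := by
  let P := (graphPresentation ψ f φ hψ hker halg).toPresentation
  have h := P.differentialsSolution_isPresentation
  refine exact_mulVecLin_of_finsupp P.differentialsRelations.map P.differentialsSolution.π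
    P.differentialsSolution.π_single (fun i j ↦ ?_) h.surjective_π h.exact
  have := P.differentialsRelations.map_single i
  refine (DFunLike.congr_fun this j).trans ?_
  change algebraMap P.Ring B
      ((mvPolynomialBasis (MvPolynomial κ k) (σ ⊕ κ)).repr (D _ _ (P.relation i)) j) =
    ψ (pderiv j (Sum.elim f φ i))
  rw [mvPolynomialBasis_repr_apply, ← graphPresentation_algebraMap ψ f φ hψ hker halg]
  refine congrArg (algebraMap P.Ring B) ?_
  have := congrFun (congrFun (graphPresentation_jacobiMatrix ψ f φ hψ hker halg) j) i
  rwa [Algebra.PreSubmersivePresentation.jacobiMatrix_apply] at this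

end Graph

section Stalk

open MvPolynomial

variable {k B : Type u} [CommRing k] [CommRing B] [Algebra k B] {σ κ : Type}

lemma det_map_map {ι : Type*} [Fintype ι] [DecidableEq ι] {R : Type*} [CommRing R] [Algebra B R]
    (ψ : MvPolynomial ι k →ₐ[k] B) (A : Matrix ι ι (MvPolynomial ι k)) :
    ((A.transpose.map ψ).map (algebraMap B R)).det = algebraMap B R (ψ A.det) := by
  rw [← Matrix.det_transpose A]
  exact ((RingHom.map_det (algebraMap B R) _).trans (congrArg Matrix.det rfl)).symm.trans
    (congrArg _ (RingHom.map_det ψ.toRingHom _).symm)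

section

variable [Fintype σ] [Fintype κ] [DecidableEq (σ ⊕ κ)] (ψ : MvPolynomial (σ ⊕ κ) k →ₐ[k] B)
    (f : σ → MvPolynomial (σ ⊕ κ) k) (φ : κ → MvPolynomial (σ ⊕ κ) k)
    (hψ : Function.Surjective ψ) (hker : RingHom.ker ψ = Ideal.span (Set.range f))
    [Algebra (MvPolynomial κ k) B] (halg : ∀ p, algebraMap (MvPolynomial κ k) B p = ψ (aeval φ p))
    (S : Submonoid B) {R O : Type u} [CommRing R] [CommRing O] [Algebra B R] [IsLocalization S R]
    [Algebra O R] [Algebra (MvPolynomial κ k) R] [Algebra (MvPolynomial κ k) O]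
    [IsScalarTower (MvPolynomial κ k) B R] [IsScalarTower (MvPolynomial κ k) O R]
    [Algebra.FormallyUnramified (MvPolynomial κ k) O]

include hψ hker halg S in
/-- The differentials of a localization of `k[x] / (f)` over a base that is formally unramified
over `k[y]` are presented by the Jacobian matrix. -/
lemma exists_exact_jacobiMat : ∃ q : (σ ⊕ κ → R) →ₗ[R] Ω[R⁄O], Function.Surjective q ∧
    Function.Exact
      (((jacobiMat (Sum.elim f φ)).transpose.map ψ).map (algebraMap B R)).mulVecLin q := by
  obtain ⟨h1, h2⟩ := exact_jacobiMat ψ f φ hψ hker halg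
  obtain ⟨h1, h2⟩ := exact_mulVecLin_of_isLocalizedModule S (R := R)
    (KaehlerDifferential.map (MvPolynomial κ k) (MvPolynomial κ k) B R) h1 h2
  have hbij : Function.Bijective (KaehlerDifferential.map (MvPolynomial κ k) O R R) := by
    refine ⟨?_, KaehlerDifferential.map_surjective _ _ _⟩
    rw [injective_iff_map_eq_zero]
    intro x hx
    obtain ⟨y, rfl⟩ := (KaehlerDifferential.exact_mapBaseChange_map (MvPolynomial κ k) O R x).mp hx
    rw [Subsingleton.elim y 0, map_zero]
  let e := LinearEquiv.ofBijective (KaehlerDifferential.map (MvPolynomial κ k) O R R) hbij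
  refine ⟨e.toLinearMap ∘ₗ _, e.surjective.comp h1, ?_⟩
  rw [LinearMap.exact_iff, LinearEquiv.ker_comp]
  exact h2.linearMap_ker_eq

include hψ hker halg S in
/-- The different is cut out by the Jacobian determinant. Here `R` is a localization of
`k[x] / (f)`, for instance a local ring, and the base `O` is formally unramified over `k[y]`. -/
lemma divIdeal_kaehlerDifferential (hreg : ψ (jacobiMat (Sum.elim f φ)).det ∈ nonZeroDivisors B) :
    divIdeal R (Ω[R⁄O]) =
      Ideal.span {algebraMap B R (ψ (jacobiMat (Sum.elim f φ)).det)} := by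
  obtain ⟨q, hq, h⟩ := exists_exact_jacobiMat ψ f φ hψ hker halg S (R := R) (O := O)
  rw [divIdeal_eq_span_det hq h, det_map_map]
  rw [det_map_map]
  exact IsLocalization.map_nonZeroDivisors_le S R ⟨_, hreg, rfl⟩

variable (O) in
include hψ hker halg S in
/-- The Jacobian determinant is invertible where the morphism is unramified. -/
lemma isUnit_jacobian_of_formallyUnramified [Algebra.FormallyUnramified O R] :
    IsUnit (algebraMap B R (ψ (jacobiMat (Sum.elim f φ)).det)) := by
  obtain ⟨q, hq, h⟩ := exists_exact_jacobiMat ψ f φ hψ hker halg S (R := R) (O := O)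
  rw [← det_map_map, ← Matrix.isUnit_iff_isUnit_det]
  refine Matrix.mulVec_surjective_iff_isUnit.mp fun v ↦ ?_
  exact (h v).mp (Subsingleton.elim _ _)

end

end Stalk

end Newton

/-! ### Complete intersections with a dense étale locus -/

namespace Newton

open TensorProduct KaehlerDifferential RingTheory.Sequence

lemma isRegularRing_of_isLocalization {R S : Type*} [CommRing R] [CommRing S] [Algebra R S]
    (M : Submonoid R) [IsLocalization M S] [IsRegularRing R] : IsRegularRing S := by
  have : IsNoetherianRing S := IsLocalization.isNoetherianRing M S inferInstance
  refine isRegularRing_iff.mpr fun p hp ↦ ?_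
  have : IsLocalization.AtPrime (Localization.AtPrime p) (p.comap (algebraMap R S)) :=
    IsLocalization.isLocalization_isLocalization_atPrime_isLocalization M (Localization.AtPrime p) p
  exact IsRegularLocalRing.of_ringEquiv (IsLocalization.algEquiv
    (p.comap (algebraMap R S)).primeCompl
    (Localization.AtPrime (p.comap (algebraMap R S))) (Localization.AtPrime p)).toRingEquiv

/-- On a localization of a complete intersection, a function with a dense nonvanishing locus is a
nonzerodivisor. -/
lemma mem_nonZeroDivisors_of_isWeaklyRegular {P B₀ B : Type*} [CommRing P] [IsRegularRing P]
    [CommRing B₀] [CommRing B] [Algebra B₀ B] (ψ : P →+* B₀) (hψ : Function.Surjective ψ)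
    {l : List P} (hker : RingHom.ker ψ = Ideal.ofList l) (hl : IsWeaklyRegular P l) (h : B₀)
    [IsLocalization.Away h B] {g : B} (hg : ∀ c, IsNilpotent (g * c) → IsNilpotent c) :
    g ∈ nonZeroDivisors B := by
  obtain ⟨h, rfl⟩ := hψ h
  let P' := Localization.Away h
  have hT : (Submonoid.powers h).map ψ = .powers (ψ h) := Submonoid.map_powers ψ h
  have : IsLocalization ((Submonoid.powers h).map ψ) B := by rwa [hT]
  let ψ' : P' →+* B := IsLocalization.map B ψ (hT.symm ▸ (Submonoid.powers h).le_comap_map :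
    Submonoid.powers h ≤ (Submonoid.powers (ψ h)).comap ψ)
  have hψ' : Function.Surjective ψ' :=
    IsLocalization.map_surjective_of_surjective (Submonoid.powers h) P' B hψ
  have hker' : RingHom.ker ψ' = Ideal.ofList (l.map (algebraMap P P')) :=
    (IsLocalization.ker_map (S := P') B ψ hT).trans (by rw [hker, Ideal.map_ofList])
  have : IsRegularRing P' := isRegularRing_of_isLocalization (.powers h)
  have hl' : IsWeaklyRegular P' (l.map (algebraMap P P')) := hl.of_isLocalization P' (.powers h)
  obtain ⟨g, rfl⟩ := hψ' g
  refine mem_nonZeroDivisors_iff_right.mpr fun x hx ↦ ?_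
  obtain ⟨x, rfl⟩ := hψ' x
  rw [← map_mul, ← RingHom.mem_ker, hker', mul_comm] at hx
  rw [← RingHom.mem_ker, hker']
  refine mem_of_mul_mem_of_isWeaklyRegular hl' (fun p hp hgp ↦ ?_) hx
  rw [← Ideal.radical_minimalPrimes] at hp
  obtain ⟨y, hy, hgy⟩ := Ideal.exists_mul_mem_of_mem_minimalPrimes hp hgp
  rw [← hker'] at hy hgy
  have hn (z : P') : z ∈ (RingHom.ker ψ').radical ↔ IsNilpotent (ψ' z) := by
    simp only [Ideal.mem_radical_iff, RingHom.mem_ker, map_pow, IsNilpotent]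
  rw [hn] at hy hgy
  rw [map_mul] at hgy
  exact hy (hg _ hgy)

/-- A localization of a complete intersection `k[x] / (f)` such that a nonempty basic open subset
is étale over affine space: there are as many equations `f` and coordinates of the
affine space as there are variables `x`. -/
lemma exists_graph_presentation {k B₀ B B' : Type u} [Field k] [CommRing B₀] [CommRing B]
    [CommRing B'] [Algebra k B₀] [Algebra k B] [Algebra k B'] [Algebra B₀ B] [Algebra B₀ B']
    [IsScalarTower k B₀ B] [IsScalarTower k B₀ B'] {m : ℕ} {l : List (MvPolynomial (Fin m) k)}
    (P₀ : Algebra.Presentation k B₀ (Fin m) (Fin l.length)) (hP₀ : P₀.relation = l.get)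
    (hl : IsWeaklyRegular (MvPolynomial (Fin m) k) l) (h h' : B₀) [IsLocalization.Away h B]
    [IsLocalization.Away h' B'] [Nontrivial B'] {d : ℕ} [Algebra (MvPolynomial (Fin d) k) B']
    [IsScalarTower k (MvPolynomial (Fin d) k) B']
    [Algebra.FormallyEtale (MvPolynomial (Fin d) k) B'] :
    ∃ (σ : Type) (_ : Fintype σ) (_ : DecidableEq σ) (ψ : MvPolynomial (σ ⊕ Fin d) k →ₐ[k] B)
      (f : σ → MvPolynomial (σ ⊕ Fin d) k), Function.Surjective ψ ∧
      RingHom.ker ψ = Ideal.span (Set.range f) := by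
  obtain ⟨e⟩ := nonempty_cotangent_equiv P₀ hP₀ hl
  have : Algebra.FormallySmooth k B' := .comp k (MvPolynomial (Fin d) k) B'
  let eΩ : Ω[B'⁄k] ≃ₗ[B'] (Fin d → B') :=
    (tensorKaehlerEquivOfFormallyEtale k (MvPolynomial (Fin d) k) B').symm.trans <|
      ((mvPolynomialBasis k (Fin d)).baseChange B').equivFun
  have hcard := card_eq_of_cotangent_equiv (B' := B') P₀.toGenerators e h' eΩ
  let P := (Algebra.Presentation.localizationAway B h).comp P₀
  -- the summand `Unit` stands for the equation, and for the variable, that inverts `h`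
  let ε : (Unit ⊕ Fin l.length) ⊕ Fin d ≃ Unit ⊕ Fin m :=
    Fintype.equivOfCardEq (by simp at hcard ⊢; omega)
  let Q := P.reindex ε (Equiv.refl _)
  refine ⟨Unit ⊕ Fin l.length, inferInstance, inferInstance, MvPolynomial.aeval Q.val,
    Q.relation, ?_, ?_⟩
  · exact Q.algebraMap_surjective
  · exact Q.span_range_relation_eq_ker.symm

end Newton

/-! ### Charts -/

namespace Newton

section EtaleLocus

variable {X Y : Scheme.{u}} (φ : X ⟶ Y)

instance etale_etaleLocus_ι : Etale ((etaleLocus φ).ι ≫ φ) := by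
  have hsup : ⨆ V : {V : X.Opens | Etale (V.ι ≫ φ)}, (etaleLocus φ).ι ⁻¹ᵁ V.1 = ⊤ := by
    rw [eq_top_iff]
    rintro ⟨x, hx⟩ -
    obtain ⟨V, hV, hxV⟩ := TopologicalSpace.Opens.mem_sSup.mp hx
    exact TopologicalSpace.Opens.mem_iSup.mpr ⟨⟨V, hV⟩, hxV⟩
  have : IsZariskiLocalAtSource @Etale.{u} := HasRingHomProperty.instIsZariskiLocalAtSource
  refine IsZariskiLocalAtSource.of_iSup_eq_top (P := @Etale.{u}) _ hsup fun V ↦ ?_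
  have : Etale (V.1.ι ≫ φ) := V.2
  let W := (etaleLocus φ).ι ⁻¹ᵁ V.1
  have hr : Set.range (W.ι ≫ (etaleLocus φ).ι) ⊆ Set.range V.1.ι := by
    rintro _ ⟨x, rfl⟩
    rw [Scheme.Opens.range_ι]
    exact x.2
  let l := IsOpenImmersion.lift V.1.ι (W.ι ≫ (etaleLocus φ).ι) hr
  have hl : l ≫ V.1.ι = W.ι ≫ (etaleLocus φ).ι := IsOpenImmersion.lift_fac _ _ _
  have : IsOpenImmersion (l ≫ V.1.ι) := by rw [hl]; infer_instance
  have : IsOpenImmersion l := IsOpenImmersion.of_comp _ V.1.ι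
  have h : Etale (l ≫ V.1.ι ≫ φ) := Etale.etale_comp l (V.1.ι ≫ φ)
  rw [← Category.assoc, hl, Category.assoc] at h
  exact h

variable {φ}

lemma etale_ι_of_le {W : X.Opens} (hW : W ≤ etaleLocus φ) : Etale (W.ι ≫ φ) := by
  rw [← X.homOfLE_ι hW, Category.assoc]
  infer_instance

lemma le_etaleLocus {W : X.Opens} (h : Etale (W.ι ≫ φ)) : W ≤ etaleLocus φ := le_sSup h

lemma ι_comp_appLE_etale_iff {W : X.Opens} {V : Y.Opens} (e : W ≤ φ ⁻¹ᵁ V)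
    (e' : ⊤ ≤ (W.ι ≫ φ) ⁻¹ᵁ V) :
    ((W.ι ≫ φ).appLE V ⊤ e').hom.Etale ↔ (φ.appLE V W e).hom.Etale := by
  have he : ⊤ ≤ W.ι ⁻¹ᵁ W := by simp
  rw [← Scheme.Hom.appLE_comp_appLE W.ι φ V W ⊤ e he]
  have : IsIso (W.ι.appLE W ⊤ he) := by
    rw [Scheme.Opens.ι_appLE]
    have h : W.ι ''ᵁ ⊤ = W := by simp
    have : IsIso (homOfLE h.le) := ⟨homOfLE h.ge, rfl, rfl⟩
    have : IsIso (homOfLE h.le).op := isIso_op _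
    exact Functor.map_isIso X.presheaf (homOfLE h.le).op
  exact RingHom.Etale.respectsIso.cancel_right_isIso _ _

lemma etale_appLE_of_le {W : X.Opens} (hW : W ≤ etaleLocus φ) (hWa : IsAffineOpen W) {V : Y.Opens}
    (hV : IsAffineOpen V) (e : W ≤ φ ⁻¹ᵁ V) : (φ.appLE V W e).hom.Etale := by
  have := etale_ι_of_le hW
  have : IsAffine W := hWa
  have e' : ⊤ ≤ (W.ι ≫ φ) ⁻¹ᵁ V := fun x _ ↦ e x.2
  exact (ι_comp_appLE_etale_iff e e').mp ((W.ι ≫ φ).etale_appLE hV (isAffineOpen_top W) e')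

lemma le_etaleLocus_of_appLE {W : X.Opens} (hWa : IsAffineOpen W) {V : Y.Opens}
    (hV : IsAffineOpen V) (e : W ≤ φ ⁻¹ᵁ V) (h : (φ.appLE V W e).hom.Etale) :
    W ≤ etaleLocus φ := by
  refine le_etaleLocus ?_
  have : IsAffine W := hWa
  have e' : ⊤ ≤ (W.ι ≫ φ) ⁻¹ᵁ V := fun x _ ↦ e x.2
  have hS : RingHom.StableUnderCompositionWithLocalizationAwaySource
      (fun {R S} _ _ ↦ @RingHom.Etale R S _ _) :=
    (RingHom.Etale.stableUnderComposition.stableUnderCompositionWithLocalizationAway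
      fun {R} S _ _ _ r _ ↦ RingHom.etale_algebraMap.mpr (Algebra.Etale.of_isLocalizationAway r)).1
  exact (HasRingHomProperty.iff_exists_appLE (P := @Etale.{u}) hS).mpr fun x ↦
    ⟨⟨V, hV⟩, ⟨⊤, isAffineOpen_top W⟩, trivial, e', (ι_comp_appLE_etale_iff e e').mpr h⟩

end EtaleLocus

lemma stalkMap_germ {X Y : Scheme.{u}} (f : X ⟶ Y) {U : Y.Opens} {V : X.Opens} (e : V ≤ f ⁻¹ᵁ U)
    {x : X} (hx : x ∈ V) (s : Γ(Y, U)) :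
    (f.stalkMap x).hom (Y.presheaf.germ U (f x) (e hx) s) =
      X.presheaf.germ V x hx ((f.appLE U V e).hom s) := by
  refine (Scheme.Hom.germ_stalkMap_apply f U x (e hx) s).trans ?_
  exact (X.presheaf.germ_res_apply (homOfLE e) x hx (f.app U s)).symm

lemma formallyUnramified_stalkMap {X Y : Scheme.{u}} {f : X ⟶ Y} {U : Y.Opens} {V : X.Opens}
    {x : X} (hx : x ∈ V) (hV : IsAffineOpen V) (e : V ≤ f ⁻¹ᵁ U)
    (h : (f.appLE U V e).hom.FormallyUnramified) : (f.stalkMap x).hom.FormallyUnramified := by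
  let := (f.appLE U V e).hom.toAlgebra
  let := X.presheaf.algebra_section_stalk ⟨x, hx⟩
  let := Y.presheaf.algebra_section_stalk ⟨f x, e hx⟩
  let := (f.stalkMap x).hom.toAlgebra
  let : Algebra Γ(Y, U) (X.presheaf.stalk x) :=
    ((algebraMap Γ(X, V) (X.presheaf.stalk x)).comp (algebraMap _ _)).toAlgebra
  have : IsScalarTower Γ(Y, U) Γ(X, V) (X.presheaf.stalk x) := .of_algebraMap_eq fun _ ↦ rfl
  have : IsScalarTower Γ(Y, U) (Y.presheaf.stalk (f x)) (X.presheaf.stalk x) :=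
    .of_algebraMap_eq fun s ↦ (stalkMap_germ f e hx s).symm
  have h2 : IsLocalization.AtPrime (X.presheaf.stalk x) _ := hV.isLocalization_stalk ⟨x, hx⟩
  have : Algebra.FormallyUnramified Γ(Y, U) Γ(X, V) := h
  have : Algebra.FormallyUnramified Γ(X, V) (X.presheaf.stalk x) :=
    .of_isLocalization (hV.primeIdealOf ⟨x, hx⟩).asIdeal.primeCompl
  have : Algebra.FormallyUnramified Γ(Y, U) (X.presheaf.stalk x) := .comp _ Γ(X, V) _
  exact Algebra.FormallyUnramified.of_restrictScalars Γ(Y, U) _ _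

namespace NewtonSetting

variable {k : Type u} [Field k] (D : NewtonSetting k)

/-- The structure map from `k` to the sections of a `k`-scheme. -/
noncomputable abbrev scalars {X : Scheme.{u}} (pX : X ⟶ Spec (.of k)) (V : X.Opens) :
    k →+* Γ(X, V) :=
  ((Scheme.ΓSpecIso (.of k)).inv ≫ pX.appLE ⊤ V (by simp)).hom

lemma appLE_scalars {X Y : Scheme.{u}} {pX : X ⟶ Spec (.of k)} {pY : Y ⟶ Spec (.of k)} {φ : X ⟶ Y}
    (h : φ ≫ pY = pX) {V : X.Opens} {V' : Y.Opens} (e : V ≤ φ ⁻¹ᵁ V') (a : k) :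
    (φ.appLE V' V e).hom (scalars pY V' a) = scalars pX V a := by
  subst h
  have := Scheme.Hom.appLE_comp_appLE φ pY ⊤ V' V (by simp) e
  exact ConcreteCategory.congr_hom (congrArg ((Scheme.ΓSpecIso (.of k)).inv ≫ ·) this) a

open MvPolynomial in
/-- An affine open subset `V` of `X` that is mapped into an affine open subset `Y'` of `Y`, together
with étale coordinates `y` on `Y'`, a presentation of `Γ(X, V)` as `k[x] / (f)`, and polynomials
`comp` in `x` that express the coordinates `y`, such that there are as many variables `x` as
equations `f` and coordinates `y` together. -/
structure PreChart where
  V : D.X.Opens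
  isAffineOpen_V : IsAffineOpen V
  Y' : D.Y.Opens
  isAffineOpen_Y' : IsAffineOpen Y'
  le : V ≤ D.φ ⁻¹ᵁ Y'
  σ : Type
  κ : Type
  [fintype_σ : Fintype σ]
  [fintype_κ : Fintype κ]
  [decidableEq_σ : DecidableEq σ]
  [decidableEq_κ : DecidableEq κ]
  ψ : MvPolynomial (σ ⊕ κ) k →+* Γ(D.X, V)
  ψ_C : ψ.comp C = scalars D.pX V
  surjective_ψ : Function.Surjective ψ
  f : σ → MvPolynomial (σ ⊕ κ) k
  ker_ψ : RingHom.ker ψ = Ideal.span (Set.range f)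
  comp : κ → MvPolynomial (σ ⊕ κ) k
  y : MvPolynomial κ k →+* Γ(D.Y, Y')
  y_C : y.comp C = scalars D.pY Y'
  etale_y : y.Etale
  appLE_y : ∀ l : κ, (D.φ.appLE Y' V le).hom (y (MvPolynomial.X l)) = ψ (comp l)

namespace PreChart

variable {D} (c : PreChart D)

attribute [instance] fintype_σ fintype_κ decidableEq_σ decidableEq_κ

/-- The polynomials whose Jacobian defines the different. -/
noncomputable abbrev F : c.σ ⊕ c.κ → MvPolynomial (c.σ ⊕ c.κ) k := Sum.elim c.f c.comp

/-- The Jacobian determinant, which is the equation of the different. -/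
noncomputable def g : Γ(D.X, c.V) := c.ψ (jacobiMat c.F).det

lemma appLE_comp_y : (D.φ.appLE c.Y' c.V c.le).hom.comp c.y =
    c.ψ.comp (MvPolynomial.aeval c.comp : MvPolynomial c.κ k →ₐ[k] _).toRingHom := by
  refine MvPolynomial.ringHom_ext (fun a ↦ ?_) fun l ↦ ?_
  · have h1 := RingHom.congr_fun c.y_C a
    have h2 := RingHom.congr_fun c.ψ_C a
    simp only [RingHom.comp_apply] at h1 h2 ⊢
    rw [h1]
    simp only [AlgHom.toRingHom_eq_coe, RingHom.coe_coe, MvPolynomial.algHom_C,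
      MvPolynomial.algebraMap_eq, h2]
    exact appLE_scalars D.φ_comp c.le a
  · simpa using c.appLE_y l

/-- The Jacobian determinant is an equation of the different, provided that it is a nonzerodivisor,
and it is invertible where `φ` is unramified. The two claims share the algebra structures on the
stalks. -/
lemma stalkDifferent_eq_and_isUnit_germ {z : D.X} (hz : z ∈ c.V) :
    (c.g ∈ nonZeroDivisors Γ(D.X, c.V) →
      stalkDifferent D.φ z = Ideal.span {D.X.presheaf.germ c.V z hz c.g}) ∧
    ((D.φ.stalkMap z).hom.FormallyUnramified → IsUnit (D.X.presheaf.germ c.V z hz c.g)) := by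
  let : Algebra k Γ(D.X, c.V) := (c.ψ.comp MvPolynomial.C).toAlgebra
  let ψ : MvPolynomial (c.σ ⊕ c.κ) k →ₐ[k] Γ(D.X, c.V) := { c.ψ with commutes' := fun _ ↦ rfl }
  let : Algebra (MvPolynomial c.κ k) Γ(D.X, c.V) :=
    (c.ψ.comp (MvPolynomial.aeval c.comp : MvPolynomial c.κ k →ₐ[k] _).toRingHom).toAlgebra
  let := D.X.presheaf.algebra_section_stalk ⟨z, hz⟩
  let := D.Y.presheaf.algebra_section_stalk ⟨D.φ z, c.le hz⟩
  have h1 : IsLocalization.AtPrime (D.X.presheaf.stalk z) _ :=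
    c.isAffineOpen_V.isLocalization_stalk ⟨z, hz⟩
  have h2 : IsLocalization.AtPrime (D.Y.presheaf.stalk (D.φ z)) _ :=
    c.isAffineOpen_Y'.isLocalization_stalk ⟨D.φ z, c.le hz⟩
  let : Algebra (MvPolynomial c.κ k) Γ(D.Y, c.Y') := c.y.toAlgebra
  let : Algebra (MvPolynomial c.κ k) (D.Y.presheaf.stalk (D.φ z)) :=
    ((algebraMap Γ(D.Y, c.Y') _).comp c.y).toAlgebra
  let : Algebra (MvPolynomial c.κ k) (D.X.presheaf.stalk z) :=
    ((algebraMap Γ(D.X, c.V) (D.X.presheaf.stalk z)).comp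
      (algebraMap (MvPolynomial c.κ k) _)).toAlgebra
  let := (D.φ.stalkMap z).hom.toAlgebra
  have : IsScalarTower (MvPolynomial c.κ k) Γ(D.X, c.V) (D.X.presheaf.stalk z) :=
    .of_algebraMap_eq fun _ ↦ rfl
  have : IsScalarTower (MvPolynomial c.κ k) Γ(D.Y, c.Y') (D.Y.presheaf.stalk (D.φ z)) :=
    .of_algebraMap_eq fun _ ↦ rfl
  have : IsScalarTower (MvPolynomial c.κ k) (D.Y.presheaf.stalk (D.φ z))
      (D.X.presheaf.stalk z) := by
    refine .of_algebraMap_eq fun p ↦ ?_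
    change D.X.presheaf.germ c.V z hz _ =
      D.φ.stalkMap z (D.Y.presheaf.germ c.Y' (D.φ z) (c.le hz) (c.y p))
    rw [stalkMap_germ D.φ c.le hz]
    exact congrArg _ (RingHom.congr_fun c.appLE_comp_y p).symm
  have : Algebra.FormallyUnramified (MvPolynomial c.κ k) Γ(D.Y, c.Y') :=
    c.etale_y.formallyUnramified
  have : Algebra.FormallyUnramified Γ(D.Y, c.Y') (D.Y.presheaf.stalk (D.φ z)) :=
    .of_isLocalization (c.isAffineOpen_Y'.primeIdealOf ⟨D.φ z, c.le hz⟩).asIdeal.primeCompl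
  have : Algebra.FormallyUnramified (MvPolynomial c.κ k) (D.Y.presheaf.stalk (D.φ z)) :=
    .comp _ Γ(D.Y, c.Y') _
  constructor
  · intro hreg
    exact divIdeal_kaehlerDifferential ψ c.f c.comp c.surjective_ψ c.ker_ψ (fun _ ↦ rfl)
      (c.isAffineOpen_V.primeIdealOf ⟨z, hz⟩).asIdeal.primeCompl hreg
  · intro h
    have : Algebra.FormallyUnramified (D.Y.presheaf.stalk (D.φ z)) (D.X.presheaf.stalk z) := h
    exact isUnit_jacobian_of_formallyUnramified ψ c.f c.comp c.surjective_ψ c.ker_ψ (fun _ ↦ rfl)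
      (c.isAffineOpen_V.primeIdealOf ⟨z, hz⟩).asIdeal.primeCompl (D.Y.presheaf.stalk (D.φ z))

/-- The Jacobian determinant is invertible exactly on the étale locus. -/
lemma basicOpen_g : D.X.basicOpen c.g = c.V ⊓ etaleLocus D.φ := by
  apply le_antisymm
  · refine le_inf (D.X.basicOpen_le _) ?_
    have e : D.X.basicOpen c.g ≤ D.φ ⁻¹ᵁ c.Y' := (D.X.basicOpen_le _).trans c.le
    refine le_etaleLocus_of_appLE (c.isAffineOpen_V.basicOpen c.g) c.isAffineOpen_Y' e ?_
    let : Algebra k Γ(D.X, c.V) := (c.ψ.comp MvPolynomial.C).toAlgebra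
    let ψ : MvPolynomial (c.σ ⊕ c.κ) k →ₐ[k] Γ(D.X, c.V) := { c.ψ with commutes' := fun _ ↦ rfl }
    let : Algebra (MvPolynomial c.κ k) Γ(D.X, c.V) :=
      (c.ψ.comp (MvPolynomial.aeval c.comp : MvPolynomial c.κ k →ₐ[k] _).toRingHom).toAlgebra
    let : Algebra (MvPolynomial c.κ k) Γ(D.Y, c.Y') := c.y.toAlgebra
    let : Algebra (MvPolynomial c.κ k) Γ(D.X, D.X.basicOpen c.g) :=
      ((algebraMap Γ(D.X, c.V) Γ(D.X, D.X.basicOpen c.g)).comp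
        (algebraMap (MvPolynomial c.κ k) _)).toAlgebra
    let : Algebra Γ(D.Y, c.Y') Γ(D.X, D.X.basicOpen c.g) := (D.φ.appLE _ _ e).hom.toAlgebra
    have : IsScalarTower (MvPolynomial c.κ k) Γ(D.X, c.V) Γ(D.X, D.X.basicOpen c.g) :=
      .of_algebraMap_eq fun _ ↦ rfl
    have : IsScalarTower (MvPolynomial c.κ k) Γ(D.Y, c.Y') Γ(D.X, D.X.basicOpen c.g) := by
      refine .of_algebraMap_eq fun p ↦ ?_
      have h := RingHom.congr_fun c.appLE_comp_y p
      have h' := ConcreteCategory.congr_hom (Scheme.Hom.appLE_map D.φ c.le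
        (homOfLE (D.X.basicOpen_le c.g)).op) (c.y p)
      exact (congrArg (D.X.presheaf.map (homOfLE (D.X.basicOpen_le c.g)).op).hom h).symm.trans h'
    have : IsLocalization.Away c.g Γ(D.X, D.X.basicOpen c.g) :=
      c.isAffineOpen_V.isLocalization_basicOpen c.g
    let P := graphPresentation ψ c.f c.comp c.surjective_ψ c.ker_ψ (fun _ ↦ rfl)
    have hP : P.jacobian = c.g := graphPresentation_jacobian _ _ _ _ _ _
    have : IsLocalization.Away P.jacobian Γ(D.X, D.X.basicOpen c.g) := by rwa [hP]
    have : Algebra.Etale (MvPolynomial c.κ k) Γ(D.X, D.X.basicOpen c.g) :=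
      etale_of_isLocalization_away_jacobian P
    have : Algebra.Etale (MvPolynomial c.κ k) Γ(D.Y, c.Y') := c.etale_y
    exact RingHom.etale_algebraMap.mpr (Algebra.Etale.of_restrictScalars (MvPolynomial c.κ k) _ _)
  · rintro z ⟨hz, hzU⟩
    obtain ⟨h, hle, hzh⟩ := c.isAffineOpen_V.exists_basicOpen_le (V := c.V ⊓ etaleLocus D.φ)
      ⟨z, hz, hzU⟩ hz
    refine (D.X.mem_basicOpen _ _ hz).mpr ((c.stalkDifferent_eq_and_isUnit_germ hz).2 ?_)
    exact formallyUnramified_stalkMap hzh (c.isAffineOpen_V.basicOpen h)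
      ((hle.trans inf_le_left).trans c.le)
      (etale_appLE_of_le (hle.trans inf_le_right) (c.isAffineOpen_V.basicOpen h) c.isAffineOpen_Y'
        _).formallyUnramified

end PreChart

/-- A chart whose Jacobian is a nonzerodivisor. -/
structure Chart extends PreChart D where
  regular : toPreChart.g ∈ nonZeroDivisors Γ(D.X, V)

lemma Chart.stalkDifferent_eq {D : NewtonSetting k} (c : Chart D) {z : D.X} (hz : z ∈ c.V) :
    stalkDifferent D.φ z = Ideal.span {D.X.presheaf.germ c.V z hz c.g} :=
  (c.stalkDifferent_eq_and_isUnit_germ hz).1 c.regular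

/-- A smooth scheme has local étale coordinates. -/
lemma exists_etale_coordinates (y : D.Y) : ∃ (Y' : D.Y.Opens) (_ : IsAffineOpen Y') (_ : y ∈ Y')
    (d : ℕ) (c : MvPolynomial (Fin d) k →+* Γ(D.Y, Y')),
    c.comp MvPolynomial.C = scalars D.pY Y' ∧ c.Etale := by
  have := D.smooth_Y
  obtain ⟨U, hU, Y', hY', hy, e, h⟩ := Smooth.exists_isStandardSmooth D.pY y
  obtain rfl : U = ⊤ := by
    refine top_le_iff.mp fun z _ ↦ ?_
    have : Subsingleton (PrimeSpectrum k) := inferInstance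
    have : z = D.pY y := Subsingleton.elim (α := PrimeSpectrum k) _ _
    exact this ▸ e hy
  obtain ⟨d, c, hc, hE⟩ := h.exists_etale_mvPolynomial
  let i : k ≃+* Γ(Spec (.of k), ⊤) := (Scheme.ΓSpecIso (.of k)).symm.commRingCatIsoToRingEquiv
  refine ⟨Y', hY', hy, d, c.comp (MvPolynomial.mapEquiv (Fin d) i).toRingHom, ?_, ?_⟩
  · ext a
    have := RingHom.congr_fun hc (i a)
    simp only [RingHom.comp_apply] at this ⊢
    refine Eq.trans (congrArg c ?_) this
    simp
  · exact RingHom.Etale.respectsIso.2 _ _ hE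

/-- The Jacobian is a nonzerodivisor: it vanishes on no irreducible component because the étale
locus is dense, and a complete intersection has no embedded components. -/
lemma PreChart.mem_nonZeroDivisors {D : NewtonSetting k} (c : PreChart D) {P B₀ : Type*}
    [CommRing P] [IsRegularRing P] [CommRing B₀] [Algebra B₀ Γ(D.X, c.V)] (ψ : P →+* B₀)
    (hψ : Function.Surjective ψ) {l : List P} (hker : RingHom.ker ψ = Ideal.ofList l)
    (hl : RingTheory.Sequence.IsWeaklyRegular P l) (h : B₀) [IsLocalization.Away h Γ(D.X, c.V)] :
    c.g ∈ nonZeroDivisors Γ(D.X, c.V) := by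
  refine mem_nonZeroDivisors_of_isWeaklyRegular ψ hψ hker hl h fun b hb ↦ ?_
  rw [Scheme.isNilpotent_iff_basicOpen_eq_bot_of_isCompact c.isAffineOpen_V.isCompact] at hb ⊢
  by_contra hne
  obtain ⟨z, hz⟩ : (D.X.basicOpen b : Set D.X).Nonempty := by
    rw [Set.nonempty_iff_ne_empty]
    intro h
    exact hne (TopologicalSpace.Opens.ext h)
  obtain ⟨z, hz, hzU⟩ := D.dense_etaleLocus.inter_open_nonempty _ (D.X.basicOpen b).2 ⟨z, hz⟩
  have hzg : z ∈ D.X.basicOpen c.g := by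
    rw [c.basicOpen_g]
    exact ⟨D.X.basicOpen_le b hz, hzU⟩
  have : z ∈ D.X.basicOpen (c.g * b) := by
    rw [Scheme.basicOpen_mul]; exact ⟨hzg, hz⟩
  rw [hb] at this
  exact this

/-- The scheme `X` is covered by charts. The number of equations of the complete intersection is
determined by a comparison of ranks on a part of the étale locus, which is nonempty by density. -/
lemma exists_chart (x : D.X) : ∃ c : Chart D, x ∈ c.V := by
  obtain ⟨V₀, hV₀, hx, m, l, ψ₀, hψC, hψ, hker, hl⟩ := D.isLCI_X x
  obtain ⟨Y', hY', hy, d, y, hyC, hE⟩ := D.exists_etale_coordinates (D.φ x)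
  obtain ⟨h, hle, hxh⟩ := hV₀.exists_basicOpen_le (V := V₀ ⊓ D.φ ⁻¹ᵁ Y') ⟨x, hx, hy⟩ hx
  set V := D.X.basicOpen h
  have hV : IsAffineOpen V := hV₀.basicOpen h
  have hVY : V ≤ D.φ ⁻¹ᵁ Y' := hle.trans inf_le_right
  obtain ⟨u, huV, huU⟩ := D.dense_etaleLocus.inter_open_nonempty _ V.2 ⟨x, hxh⟩
  obtain ⟨h', hle', huh'⟩ := hV₀.exists_basicOpen_le (V := V ⊓ etaleLocus D.φ) ⟨u, huV, huU⟩
    (D.X.basicOpen_le h huV)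
  have hVY' : D.X.basicOpen h' ≤ D.φ ⁻¹ᵁ Y' := (hle'.trans inf_le_left).trans hVY
  let : Algebra k Γ(D.X, V₀) := (ψ₀.comp MvPolynomial.C).toAlgebra
  let : Algebra k Γ(D.X, V) := ((algebraMap Γ(D.X, V₀) Γ(D.X, V)).comp (algebraMap k _)).toAlgebra
  let : Algebra k Γ(D.X, D.X.basicOpen h') :=
    ((algebraMap Γ(D.X, V₀) Γ(D.X, D.X.basicOpen h')).comp (algebraMap k _)).toAlgebra
  have : IsScalarTower k Γ(D.X, V₀) Γ(D.X, V) := .of_algebraMap_eq fun _ ↦ rfl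
  have : IsScalarTower k Γ(D.X, V₀) Γ(D.X, D.X.basicOpen h') := .of_algebraMap_eq fun _ ↦ rfl
  have : IsLocalization.Away h Γ(D.X, V) := hV₀.isLocalization_basicOpen h
  have : IsLocalization.Away h' Γ(D.X, D.X.basicOpen h') := hV₀.isLocalization_basicOpen h'
  let : Algebra (MvPolynomial (Fin d) k) Γ(D.X, D.X.basicOpen h') :=
    ((D.φ.appLE _ _ hVY').hom.comp y).toAlgebra
  have hres (a : k) (W : D.X.Opens) (hW : W ≤ V₀) :
      (D.X.presheaf.map (homOfLE hW).op).hom (ψ₀ (MvPolynomial.C a)) = scalars D.pX W a := by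
    have h1 := RingHom.congr_fun hψC a
    refine (congrArg _ h1).trans ?_
    exact ConcreteCategory.congr_hom (congrArg ((Scheme.ΓSpecIso (.of k)).inv ≫ ·)
      (Scheme.Hom.appLE_map D.pX (by simp) (homOfLE hW).op)) a
  have : IsScalarTower k (MvPolynomial (Fin d) k) Γ(D.X, D.X.basicOpen h') := by
    refine .of_algebraMap_eq fun a ↦ ?_
    refine (hres a _ (D.X.basicOpen_le h')).trans ?_
    have h1 := RingHom.congr_fun hyC a
    refine Eq.trans ?_ (congrArg (D.φ.appLE _ _ hVY').hom h1).symm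
    exact (appLE_scalars D.φ_comp hVY' a).symm
  have : Algebra.Etale (MvPolynomial (Fin d) k) Γ(D.X, D.X.basicOpen h') :=
    RingHom.Etale.stableUnderComposition y _ hE
      (etale_appLE_of_le (hle'.trans inf_le_right) (hV₀.basicOpen h') hY' hVY')
  have : Nontrivial Γ(D.X, D.X.basicOpen h') := by
    have : Nonempty (D.X.basicOpen h') := ⟨⟨u, huh'⟩⟩
    infer_instance
  have hae : (MvPolynomial.aeval (R := k) (fun i ↦ ψ₀ (MvPolynomial.X i))).toRingHom = ψ₀ := by
    refine MvPolynomial.ringHom_ext (fun a ↦ ?_) fun i ↦ ?_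
    · simp; rfl
    · simp
  let P₀ : Algebra.Presentation k Γ(D.X, V₀) (Fin m) (Fin l.length) :=
    { toGenerators := .ofSurjective (fun i ↦ ψ₀ (MvPolynomial.X i)) fun b ↦
        (hψ b).imp fun p hp ↦ (RingHom.congr_fun hae p).trans hp
      relation := l.get
      span_range_relation_eq_ker := by
        rw [Set.range_list_get]
        exact hker.symm.trans (congrArg RingHom.ker hae).symm }
  obtain ⟨σ, _, _, ψ, f, hψ', hker'⟩ := exists_graph_presentation (B := Γ(D.X, V))
    (B' := Γ(D.X, D.X.basicOpen h')) P₀ rfl hl.toIsWeaklyRegular h h' (d := d)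
  choose comp hcomp using fun i ↦ hψ' ((D.φ.appLE Y' V hVY).hom (y (MvPolynomial.X i)))
  let c : PreChart D :=
    { V := V
      isAffineOpen_V := hV
      Y' := Y'
      isAffineOpen_Y' := hY'
      le := hVY
      σ := σ
      κ := Fin d
      ψ := ψ.toRingHom
      ψ_C := by
        ext a
        exact (ψ.commutes a).trans (hres a V (D.X.basicOpen_le h))
      surjective_ψ := hψ'
      f := f
      ker_ψ := hker'
      comp := comp
      y := y
      y_C := hyC
      etale_y := hE
      appLE_y := fun i ↦ (hcomp i).symm }
  exact ⟨⟨c, c.mem_nonZeroDivisors ψ₀ hψ hker hl.toIsWeaklyRegular h⟩, hxh⟩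

end NewtonSetting

end Newton

/-! ### Ideals of closed subschemes -/

namespace Newton

section SpecTo

variable {X Y : Scheme.{u}}

/-- The morphism `Spec R ⟶ X` given by a ring map from the sections over an affine open subset. -/
noncomputable def specTo {W : X.Opens} (hW : IsAffineOpen W) {R : CommRingCat.{u}}
    (ρ : Γ(X, W) ⟶ R) : Spec R ⟶ X := Spec.map ρ ≫ hW.fromSpec

lemma specTo_comp (f : X ⟶ Y) {W : X.Opens} (hW : IsAffineOpen W) {U : Y.Opens}
    (hU : IsAffineOpen U) (e : W ≤ f ⁻¹ᵁ U) {R : CommRingCat.{u}} (ρ : Γ(X, W) ⟶ R) :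
    specTo hW ρ ≫ f = specTo hU (f.appLE U W e ≫ ρ) := by
  simp only [specTo, Spec.map_comp, Category.assoc, hU.SpecMap_appLE_fromSpec f hW e]

lemma specTo_mem {W : X.Opens} (hW : IsAffineOpen W) {R : CommRingCat.{u}}
    (ρ : Γ(X, W) ⟶ R) : ⊤ ≤ specTo hW ρ ⁻¹ᵁ W := by
  rw [specTo, Scheme.Hom.comp_preimage, hW.fromSpec_preimage_self]; simp

lemma specTo_appLE {W : X.Opens} (hW : IsAffineOpen W) {R : CommRingCat.{u}}
    (ρ : Γ(X, W) ⟶ R) (e : ⊤ ≤ specTo hW ρ ⁻¹ᵁ W) :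
    (specTo hW ρ).appLE W ⊤ e = ρ ≫ (Scheme.ΓSpecIso R).inv := by
  have e' : ⊤ ≤ (Spec.map ρ ≫ hW.fromSpec) ⁻¹ᵁ W := e
  change (Spec.map ρ ≫ hW.fromSpec).appLE W ⊤ e' = _
  rw [Scheme.Hom.comp_appLE, hW.fromSpec_app_self, Category.assoc]
  refine (congrArg ((Scheme.ΓSpecIso Γ(X, W)).inv ≫ ·) (Scheme.Hom.map_appLE (Spec.map ρ)
    (U' := ⊤) (by rwa [Scheme.Hom.comp_preimage] at e') _)).trans ?_
  refine Eq.trans ?_ (Scheme.ΓSpecIso_inv_naturality ρ).symm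
  rw [Scheme.Hom.appTop, Scheme.Hom.app_eq_appLE]
  rfl

/-- A criterion for the ideal of (the closure of the image of) a morphism to be contained in a given
ideal. -/
lemma ideal_ker_le_of_factors {Z : Scheme.{u}} (h : Z ⟶ X) {W : X.Opens} (hW : IsAffineOpen W)
    (J : Ideal Γ(X, W)) (q : Spec (.of (Γ(X, W) ⧸ J)) ⟶ Z)
    (hq : q ≫ h = specTo hW (CommRingCat.ofHom (Ideal.Quotient.mk J))) :
    h.ker.ideal ⟨W, hW⟩ ≤ J := by
  intro x hx
  have h1 : (h.app W).hom x = 0 := h.ideal_ker_le ⟨W, hW⟩ hx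
  have e := specTo_mem hW (CommRingCat.ofHom (Ideal.Quotient.mk J))
  have h2 : ((q ≫ h).appLE W ⊤ (hq ▸ e)).hom x = 0 := by
    rw [Scheme.Hom.comp_appLE]
    exact (congrArg (q.appLE _ ⊤ _).hom h1).trans (map_zero _)
  simp_rw [hq] at h2
  rw [specTo_appLE hW] at h2
  have h3 := congrArg (Scheme.ΓSpecIso _).hom.hom h2
  rw [map_zero] at h3
  refine Ideal.Quotient.eq_zero_iff_mem.mp (Eq.trans ?_ h3)
  exact (ConcreteCategory.congr_hom (Scheme.ΓSpecIso (.of (Γ(X, W) ⧸ J))).inv_hom_id _).symm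

/-- The inverse image of an ideal sheaf is generated by pullbacks. -/
lemma comap_ideal (I : Y.IdealSheafData) (f : X ⟶ Y) {W : X.Opens} (hW : IsAffineOpen W)
    {V : Y.Opens} (hV : IsAffineOpen V) (e : W ≤ f ⁻¹ᵁ V) :
    (I.comap f).ideal ⟨W, hW⟩ = (I.ideal ⟨V, hV⟩).map (f.appLE V W e).hom := by
  set J := (I.ideal ⟨V, hV⟩).map (f.appLE V W e).hom
  apply le_antisymm
  · let ρ : CommRingCat.of (Γ(Y, V) ⧸ I.ideal ⟨V, hV⟩) ⟶ .of (Γ(X, W) ⧸ J) :=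
      CommRingCat.ofHom (Ideal.quotientMap J (f.appLE V W e).hom Ideal.le_comap_map)
    refine ideal_ker_le_of_factors _ hW J (pullback.lift
      (specTo hW (CommRingCat.ofHom (Ideal.Quotient.mk J)))
      (Spec.map ρ ≫ I.subschemeCover.f ⟨V, hV⟩) ?_) (pullback.lift_fst _ _ _)
    have h1 : I.subschemeCover.f ⟨V, hV⟩ ≫ I.subschemeι =
        specTo hV (CommRingCat.ofHom (Ideal.Quotient.mk (I.ideal ⟨V, hV⟩))) :=
      (I.subschemeCover_map_subschemeι ⟨V, hV⟩).trans (I.glueDataObjι_ι ⟨V, hV⟩)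
    refine (specTo_comp f hW hV e _).trans (Eq.trans ?_ (Category.assoc _ _ _).symm)
    refine Eq.trans ?_ (congrArg (Spec.map ρ ≫ ·) h1).symm
    unfold specTo
    exact Spec.map_comp_assoc (CommRingCat.ofHom (Ideal.Quotient.mk (I.ideal ⟨V, hV⟩))) ρ _
  · refine Ideal.map_le_iff_le_comap.mpr fun a ha ↦ ?_
    rw [Ideal.mem_comap, Scheme.IdealSheafData.comap, Scheme.Hom.ker_apply, RingHom.mem_ker]
    have h1 : (I.subschemeι.app V).hom a = 0 := by
      rw [← RingHom.mem_ker]; exact (I.ker_subschemeι_app ⟨V, hV⟩).ge ha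
    have h2 := (Scheme.Hom.appLE_comp_appLE (pullback.fst f I.subschemeι) f V W
      (pullback.fst f I.subschemeι ⁻¹ᵁ W) e le_rfl)
    simp_rw [pullback.condition, Scheme.Hom.comp_appLE] at h2
    have h3 := ConcreteCategory.congr_hom h2 a
    rw [Scheme.Hom.app_eq_appLE]
    refine h3.trans ?_
    exact (congrArg ((pullback.snd f I.subschemeι).appLE _ _ _).hom h1).trans (map_zero _)

/-- The equations of a morphism `h : Z ⟶ X` that is universal among the morphisms equalizing
`q₁, q₂ : X ⟶ Y`. -/
lemma ker_ideal_of_isEqualizer {Z : Scheme.{u}} (h : Z ⟶ X) [QuasiCompact h] (q₁ q₂ : X ⟶ Y)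
    (hq : h ≫ q₁ = h ≫ q₂)
    (lift : ∀ {S : Scheme.{u}} (t : S ⟶ X), t ≫ q₁ = t ≫ q₂ → ∃ s, s ≫ h = t)
    {W : X.Opens} (hW : IsAffineOpen W) {V : Y.Opens} (hV : IsAffineOpen V) (e₁ : W ≤ q₁ ⁻¹ᵁ V)
    (e₂ : W ≤ q₂ ⁻¹ᵁ V) : h.ker.ideal ⟨W, hW⟩ =
      Ideal.span (Set.range fun b ↦ (q₁.appLE V W e₁).hom b - (q₂.appLE V W e₂).hom b) := by
  set J := Ideal.span (Set.range fun b ↦ (q₁.appLE V W e₁).hom b - (q₂.appLE V W e₂).hom b)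
  apply le_antisymm
  · obtain ⟨s, hs⟩ := lift (specTo hW (CommRingCat.ofHom (Ideal.Quotient.mk J))) (by
      rw [specTo_comp q₁ hW hV e₁, specTo_comp q₂ hW hV e₂]
      congr 1
      ext b
      exact Ideal.Quotient.eq.mpr (Ideal.subset_span ⟨b, rfl⟩))
    exact ideal_ker_le_of_factors h hW J s hs
  · refine Ideal.span_le.mpr ?_
    rintro _ ⟨b, rfl⟩
    rw [SetLike.mem_coe, Scheme.Hom.ker_apply, RingHom.mem_ker, map_sub, sub_eq_zero]
    have h1 := Scheme.Hom.appLE_comp_appLE h q₁ V W (h ⁻¹ᵁ W) e₁ le_rfl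
    have h2 := Scheme.Hom.appLE_comp_appLE h q₂ V W (h ⁻¹ᵁ W) e₂ le_rfl
    simp_rw [hq] at h1
    have h3 := ConcreteCategory.congr_hom (h1.trans h2.symm) b
    rw [Scheme.Hom.app_eq_appLE]
    exact h3

end SpecTo

namespace NewtonSetting

variable {k : Type u} [Field k] (D : NewtonSetting k)

/-- The ideal of the diagonal is generated by the differences of the two pullbacks of functions on
`X`. -/
lemma I₁_ideal {W : D.XX.Opens} (hW : IsAffineOpen W) {V : D.X.Opens} (hV : IsAffineOpen V)
    (e₁ : W ≤ D.pr₁ ⁻¹ᵁ V) (e₂ : W ≤ D.pr₂ ⁻¹ᵁ V) : D.I₁.ideal ⟨W, hW⟩ =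
      Ideal.span (Set.range fun b ↦ (D.pr₁.appLE V W e₁).hom b - (D.pr₂.appLE V W e₂).hom b) := by
  have := D.isSeparated_X
  refine ker_ideal_of_isEqualizer _ D.pr₁ D.pr₂ (by simp) (fun t ht ↦ ⟨t ≫ D.pr₁, ?_⟩) hW hV e₁ e₂
  apply pullback.hom_ext <;> simp [ht]

lemma fiberProductι_pr₁ : D.fiberProductι ≫ D.pr₁ = pullback.fst D.φ D.φ := pullback.lift_fst _ _ _

lemma fiberProductι_pr₂ : D.fiberProductι ≫ D.pr₂ = pullback.snd D.φ D.φ := pullback.lift_snd _ _ _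

instance : IsClosedImmersion D.fiberProductι := by
  have := D.isSeparated_Y
  have h : D.fiberProductι =
      pullback.mapDesc D.φ D.φ D.pY ≫ (pullback.congrHom D.φ_comp D.φ_comp).hom := by
    have h₁ : (pullback.congrHom D.φ_comp D.φ_comp).hom ≫ pullback.fst D.pX D.pX =
      pullback.fst _ _ := by
      rw [pullback.congrHom_hom]; exact (pullback.lift_fst _ _ _).trans (Category.comp_id _)
    have h₂ : (pullback.congrHom D.φ_comp D.φ_comp).hom ≫ pullback.snd D.pX D.pX =
      pullback.snd _ _ := by
      rw [pullback.congrHom_hom]; exact (pullback.lift_snd _ _ _).trans (Category.comp_id _)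
    apply pullback.hom_ext
    · refine D.fiberProductι_pr₁.trans (Eq.trans ?_ (Category.assoc _ _ _).symm)
      refine Eq.trans ?_ (congrArg (_ ≫ ·) h₁).symm
      exact ((pullback.lift_fst _ _ _).trans (Category.comp_id _)).symm
    · refine D.fiberProductι_pr₂.trans (Eq.trans ?_ (Category.assoc _ _ _).symm)
      refine Eq.trans ?_ (congrArg (_ ≫ ·) h₂).symm
      exact ((pullback.lift_snd _ _ _).trans (Category.comp_id _)).symm
  rw [h]
  infer_instance

/-- The ideal of `X ×_Y X` is generated by the differences of the two pullbacks of functions on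
`Y`. -/
lemma I₂_ideal {W : D.XX.Opens} (hW : IsAffineOpen W) {V : D.Y.Opens} (hV : IsAffineOpen V)
    (e₁ : W ≤ (D.pr₁ ≫ D.φ) ⁻¹ᵁ V) (e₂ : W ≤ (D.pr₂ ≫ D.φ) ⁻¹ᵁ V) : D.I₂.ideal ⟨W, hW⟩ =
      Ideal.span (Set.range fun b ↦
        ((D.pr₁ ≫ D.φ).appLE V W e₁).hom b - ((D.pr₂ ≫ D.φ).appLE V W e₂).hom b) := by
  refine ker_ideal_of_isEqualizer _ _ _ ?_ (fun t ht ↦ ?_) hW hV e₁ e₂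
  · rw [← Category.assoc, fiberProductι_pr₁, ← Category.assoc, fiberProductι_pr₂,
      pullback.condition]
  · refine ⟨pullback.lift (t ≫ D.pr₁) (t ≫ D.pr₂) (by simpa using ht), ?_⟩
    apply pullback.hom_ext
    · rw [Category.assoc, ← pr₁, fiberProductι_pr₁, pullback.lift_fst]
    · rw [Category.assoc, ← pr₂, fiberProductι_pr₂, pullback.lift_snd]

end NewtonSetting

end Newton

/-! ### The ideals of the different and of the divisors `D` and `D'` -/

namespace Newton

lemma germ_res_apply {X : Scheme.{u}} {W V : X.Opens} (h : W ≤ V) {x : X} (hx : x ∈ W)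
    (s : Γ(X, V)) : X.presheaf.germ W x hx ((X.presheaf.map (homOfLE h).op).hom s) =
      X.presheaf.germ V x (h hx) s :=
  X.presheaf.germ_res_apply (homOfLE h) x hx s

section LocallyPrincipal

variable {X : Scheme.{u}} (L : ∀ x : X, Ideal (X.presheaf.stalk x))

lemma mem_iInf_comap_germ {V : X.Opens} {s : Γ(X, V)} :
    s ∈ (⨅ x : V, (L x.1).comap (X.presheaf.germ V x.1 x.2).hom) ↔
      ∀ (x : X) (hx : x ∈ V), X.presheaf.germ V x hx s ∈ L x := by
  simp

lemma iInf_comap_germ_eq_span {V : X.Opens} (g : Γ(X, V))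
    (hg : ∀ (z : X) (hz : z ∈ V), L z = Ideal.span {X.presheaf.germ V z hz g})
    {W : X.Opens} (hW : IsAffineOpen W) (h : W ≤ V) :
    (⨅ x : W, (L x.1).comap (X.presheaf.germ W x.1 x.2).hom) =
      Ideal.span {(X.presheaf.map (homOfLE h).op).hom g} := by
  ext s
  rw [mem_iInf_comap_germ, hW.mem_ideal_iff]
  refine forall₂_congr fun x hx ↦ ?_
  have : X.presheaf.germ W x hx ((X.presheaf.map (homOfLE h).op).hom g) =
    X.presheaf.germ V x (h hx) g := germ_res_apply h hx g
  rw [Ideal.map_span, Set.image_singleton, hg x (h hx), ← this]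

/-- A family of ideals of the stalks that is locally generated by a section defines a quasi-coherent
ideal, whose sections are the functions with germs in the given ideals. -/
lemma ofIdeals_iInf_comap_germ
    (hL : ∀ x : X, ∃ (V : X.Opens) (_ : x ∈ V) (g : Γ(X, V)),
      ∀ (z : X) (hz : z ∈ V), L z = Ideal.span {X.presheaf.germ V z hz g}) :
    (Scheme.IdealSheafData.ofIdeals fun V : X.affineOpens ↦
      ⨅ x : V.1, (L x.1).comap (X.presheaf.germ V.1 x.1 x.2).hom).ideal =
    fun V : X.affineOpens ↦ ⨅ x : V.1, (L x.1).comap (X.presheaf.germ V.1 x.1 x.2).hom := by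
  let N : X.IdealSheafData :=
    { ideal := fun V : X.affineOpens ↦ ⨅ x : V.1, (L x.1).comap (X.presheaf.germ V.1 x.1 x.2).hom
      map_ideal_basicOpen := ?_ }
  · exact congrArg _ (Scheme.IdealSheafData.ofIdeals_ideal N)
  rintro ⟨U, hU⟩ f
  have hfU : X.basicOpen f ≤ U := X.basicOpen_le f
  change Ideal.map (X.presheaf.map (homOfLE hfU).op).hom _ =
    ⨅ x : X.basicOpen f, (L x.1).comap (X.presheaf.germ (X.basicOpen f) x.1 x.2).hom
  apply le_antisymm
  · refine Ideal.map_le_iff_le_comap.mpr fun s hs ↦ ?_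
    rw [mem_iInf_comap_germ] at hs
    rw [Ideal.mem_comap, mem_iInf_comap_germ]
    intro x hx
    rw [germ_res_apply hfU hx]
    exact hs x _
  · intro s hs
    rw [mem_iInf_comap_germ] at hs
    have hloc := hU.isLocalization_basicOpen f
    obtain ⟨⟨a, _, n, rfl⟩, ha⟩ := IsLocalization.surj (.powers f) s
    -- near each point a power of `f` times `a` lies in the ideal
    have key (x : U) : ∃ (h : Γ(X, U)) (m : ℕ), x.1 ∈ X.basicOpen h ∧
        ∀ (z : X) (hz : z ∈ U), z ∈ X.basicOpen h → X.presheaf.germ U z hz (f ^ m * a) ∈ L z := by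
      obtain ⟨V, hxV, g, hg⟩ := hL x.1
      obtain ⟨h, hle, hxh⟩ := hU.exists_basicOpen_le (V := U ⊓ V) ⟨x.1, x.2, hxV⟩ x.2
      have hhU : X.basicOpen h ≤ U := X.basicOpen_le h
      have hh := hU.basicOpen h
      set f' := (X.presheaf.map (homOfLE hhU).op).hom f with hf'
      have hf'U : X.basicOpen f' ≤ X.basicOpen h := X.basicOpen_le f'
      have hf'f : X.basicOpen f' ≤ X.basicOpen f := by
        rw [hf']; exact (X.basicOpen_res _ _).trans_le inf_le_right
      have hloc' := hh.isLocalization_basicOpen f'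
      have hmem : algebraMap Γ(X, X.basicOpen h) Γ(X, X.basicOpen f')
          ((X.presheaf.map (homOfLE hhU).op).hom a) ∈
          (⨅ x : X.basicOpen h, (L x.1).comap (X.presheaf.germ _ x.1 x.2).hom).map
            (algebraMap Γ(X, X.basicOpen h) Γ(X, X.basicOpen f')) := by
        rw [iInf_comap_germ_eq_span L g hg hh (hle.trans inf_le_right), Ideal.map_span,
          Set.image_singleton]
        have e1 : (algebraMap Γ(X, X.basicOpen h) Γ(X, X.basicOpen f'))
            ((X.presheaf.map (homOfLE (hle.trans inf_le_right)).op).hom g) =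
            (X.presheaf.map (homOfLE (hf'U.trans (hle.trans inf_le_right))).op).hom g :=
          ConcreteCategory.congr_hom (X.presheaf.map_comp (homOfLE (hle.trans inf_le_right)).op
            (homOfLE hf'U).op).symm g
        rw [e1, ← iInf_comap_germ_eq_span L g hg (hh.basicOpen f'), mem_iInf_comap_germ]
        intro z hz
        have e2 : X.presheaf.germ (X.basicOpen f') z hz
            (algebraMap Γ(X, X.basicOpen h) Γ(X, X.basicOpen f')
              ((X.presheaf.map (homOfLE hhU).op).hom a)) = X.presheaf.germ U z (hhU (hf'U hz)) a :=
          (germ_res_apply hf'U hz _).trans (germ_res_apply hhU (hf'U hz) a)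
        rw [e2]
        have e3 := congrArg (X.presheaf.germ (X.basicOpen f) z (hf'f hz)) ha
        have e4 : X.presheaf.germ (X.basicOpen f) z (hf'f hz)
            (algebraMap Γ(X, U) Γ(X, X.basicOpen f) a) = X.presheaf.germ U z (hhU (hf'U hz)) a :=
          germ_res_apply hfU (hf'f hz) a
        rw [← e4, ← e3, map_mul]
        exact Ideal.mul_mem_right _ _ (hs z _)
      obtain ⟨_, ⟨m, rfl⟩, hm⟩ := (IsLocalization.algebraMap_mem_map_algebraMap_iff
        (.powers f') _ _ _).mp hmem
      refine ⟨h, m, hxh, fun z hz hzh ↦ ?_⟩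
      rw [mem_iInf_comap_germ] at hm
      have := hm z hzh
      beta_reduce at this
      rw [hf', ← map_pow, ← map_mul, germ_res_apply hhU hzh] at this
      exact this
    choose h m hx hm using key
    obtain ⟨T, hT⟩ := hU.isCompact.elim_finite_subcover (fun x ↦ (X.basicOpen (h x) : Set X))
      (fun x ↦ (X.basicOpen (h x)).2) fun x hxU ↦ Set.mem_iUnion.mpr ⟨⟨x, hxU⟩, hx ⟨x, hxU⟩⟩
    have hfa : f ^ T.sup m * a ∈ (⨅ x : U, (L x.1).comap (X.presheaf.germ U x.1 x.2).hom) := by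
      rw [mem_iInf_comap_germ]
      intro z hz
      obtain ⟨x, hxT, hzx⟩ : ∃ x ∈ T, z ∈ X.basicOpen (h x) := by
        simpa using hT hz
      have := hm x z hz hzx
      rw [← Nat.sub_add_cancel (Finset.le_sup (f := m) hxT), pow_add, mul_assoc, map_mul]
      exact Ideal.mul_mem_left _ _ this
    refine (IsLocalization.mem_map_algebraMap_iff (.powers f) Γ(X, X.basicOpen f)).mpr
      ⟨⟨⟨_, hfa⟩, ⟨_, T.sup m + n, rfl⟩⟩, ?_⟩
    simp only [map_mul, map_pow] at ha ⊢
    rw [← ha]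
    ring

lemma mem_different_ideal {Y : Scheme.{u}} (φ : X ⟶ Y)
    (hL : ∀ x : X, ∃ (V : X.Opens) (_ : x ∈ V) (g : Γ(X, V)),
      ∀ (z : X) (hz : z ∈ V), stalkDifferent φ z = Ideal.span {X.presheaf.germ V z hz g})
    {W : X.Opens} (hW : IsAffineOpen W) (s : Γ(X, W)) : s ∈ (different φ).ideal ⟨W, hW⟩ ↔
      ∀ (x : X) (hx : x ∈ W), X.presheaf.germ W x hx s ∈ stalkDifferent φ x := by
  have h := congrFun (ofIdeals_iInf_comap_germ (stalkDifferent φ) hL) ⟨W, hW⟩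
  exact (iff_of_eq (congrArg (s ∈ ·) h)).trans (mem_iInf_comap_germ (stalkDifferent φ))

end LocallyPrincipal

namespace NewtonSetting

variable {k : Type u} [Field k] {D : NewtonSetting k}

/-- The equation of the different on an open subset of the domain of a chart. -/
noncomputable abbrev Chart.gOn (c : Chart D) {W : D.X.Opens} (h : W ≤ c.V) : Γ(D.X, W) :=
  (D.X.presheaf.map (homOfLE h).op).hom c.g

lemma mem_IΔ_ideal {W : D.X.Opens} (hW : IsAffineOpen W) (s : Γ(D.X, W)) :
    s ∈ D.IΔ.ideal ⟨W, hW⟩ ↔ ∀ (x : D.X) (hx : x ∈ W), D.X.presheaf.germ W x hx s ∈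
      stalkDifferent D.φ x := by
  refine mem_different_ideal D.φ (fun x ↦ ?_) hW s
  obtain ⟨c, hx⟩ := D.exists_chart x
  exact ⟨c.V, hx, c.g, fun z hz ↦ c.stalkDifferent_eq hz⟩

lemma Chart.IΔ_ideal (c : Chart D) {W : D.X.Opens} (hW : IsAffineOpen W) (h : W ≤ c.V) :
    D.IΔ.ideal ⟨W, hW⟩ = Ideal.span {c.gOn h} := by
  ext s
  rw [mem_IΔ_ideal, ← iInf_comap_germ_eq_span (stalkDifferent D.φ) c.g
    (fun z hz ↦ c.stalkDifferent_eq hz) hW h, mem_iInf_comap_germ]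

lemma Chart.comap_IΔ_ideal (c : Chart D) {S : Scheme.{u}} (q : S ⟶ D.X) {W : S.Opens}
    (hW : IsAffineOpen W) (h : W ≤ q ⁻¹ᵁ c.V) :
    (D.IΔ.comap q).ideal ⟨W, hW⟩ = Ideal.span {(q.appLE c.V W h).hom c.g} := by
  refine (comap_ideal D.IΔ q hW c.isAffineOpen_V h).trans ?_
  rw [c.IΔ_ideal c.isAffineOpen_V le_rfl, Ideal.map_span, Set.image_singleton]
  congr 2
  exact congrArg _ (ConcreteCategory.congr_hom (D.X.presheaf.map_id _) c.g)

end NewtonSetting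

end Newton

/-! ### Morphisms to the relative spectrum -/

namespace Newton

section General

variable {X Y Z S P : Scheme.{u}}

lemma appLE_eq_of_eq {f g : X ⟶ Y} (h : f = g) {V : Y.Opens} {W : X.Opens} (e : W ≤ f ⁻¹ᵁ V)
    (e' : W ≤ g ⁻¹ᵁ V) : f.appLE V W e = g.appLE V W e' := by
  subst h; rfl

lemma appLE_appLE_apply (f : X ⟶ Y) (g : Y ⟶ Z) {U : Z.Opens} {V : Y.Opens} {W : X.Opens}
    (e₁ : V ≤ g ⁻¹ᵁ U) (e₂ : W ≤ f ⁻¹ᵁ V) (e : W ≤ (f ≫ g) ⁻¹ᵁ U) (z : Γ(Z, U)) :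
    (f.appLE V W e₂).hom ((g.appLE U V e₁).hom z) = ((f ≫ g).appLE U W e).hom z :=
  ConcreteCategory.congr_hom (Scheme.Hom.appLE_comp_appLE f g U V W e₁ e₂) z

/-- A morphism to a scheme, restricted to an open subset that is mapped to an affine open subset, is
given by a ring map. -/
lemma ι_comp_eq_toSpecΓ (t : S ⟶ X) {V : X.Opens} (hV : IsAffineOpen V) {S' : S.Opens}
    (e : S' ≤ t ⁻¹ᵁ V) : S'.ι ≫ t = S'.toSpecΓ ≫ Spec.map (t.appLE V S' e) ≫ hV.fromSpec := by
  rw [Scheme.Opens.toSpecΓ_SpecMap_appLE_assoc, hV.toSpecΓ_fromSpec, Scheme.Hom.resLE_comp_ι]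

lemma ι_comp_eq_of_appLE_eq (t t' : S ⟶ X) {V : X.Opens} (hV : IsAffineOpen V) {S' : S.Opens}
    (e : S' ≤ t ⁻¹ᵁ V) (e' : S' ≤ t' ⁻¹ᵁ V)
    (h : ∀ s, (t.appLE V S' e).hom s = (t'.appLE V S' e').hom s) :
    S'.ι ≫ t = S'.ι ≫ t' := by
  rw [ι_comp_eq_toSpecΓ t hV e, ι_comp_eq_toSpecΓ t' hV e']
  congr 3
  ext s
  exact h s

/-- Two morphisms to a separated scheme that agree on a schematically dense subscheme agree. -/
lemma ext_of_isSchemeTheoreticallyDominant {f g : X ⟶ Y} (s : Y ⟶ Z) [IsSeparated s]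
    (h : f ≫ s = g ≫ s) (i : P ⟶ X) [IsSchemeTheoreticallyDominant i] (hi : i ≫ f = i ≫ g) :
    f = g := by
  let X' : Over Z := Over.mk (f ≫ s)
  let Y' : Over Z := Over.mk s
  let P' : Over Z := Over.mk (i ≫ f ≫ s)
  let f' : X' ⟶ Y' := Over.homMk f
  let g' : X' ⟶ Y' := Over.homMk g
  let i' : P' ⟶ X' := Over.homMk i
  have : IsSeparated Y'.hom := ‹_›
  have hi' : i' ≫ f' = i' ≫ g' := by ext1; exact hi
  have hfac : (equalizer.lift i' hi').left ≫ (equalizer.ι f' g').left = i := by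
    rw [← Over.comp_left, equalizer.lift_ι]; rfl
  have : IsIso (equalizer.ι f' g').left := by
    rw [IsClosedImmersion.isIso_iff_ker_eq_bot, ← le_bot_iff, ← i.ker_eq_bot]
    exact (Scheme.Hom.le_ker_comp _ _).trans_eq (congrArg Scheme.Hom.ker hfac)
  rw [← cancel_epi (equalizer.ι f' g').left]
  exact congr($(equalizer.condition f' g').left)

lemma isIso_appLE_opensRange (f : X ⟶ Y) [IsOpenImmersion f] {T : Y.Opens} (hT : T = f.opensRange)
    (e : ⊤ ≤ f ⁻¹ᵁ T) : IsIso (f.appLE T ⊤ e) := by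
  obtain rfl : T = f ''ᵁ ⊤ := by rw [hT, Scheme.Hom.image_top_eq_opensRange]
  rw [← f.appIso_hom' ⊤]
  infer_instance

/-- Morphisms over `Z` to a scheme that exist locally on the source exist globally, provided that
they are determined by their restriction to a schematically dense subscheme. -/
lemma exists_lift_of_forall_exists_opens (p : Y ⟶ Z) (h : S ⟶ Z) (i : P ⟶ S) [QuasiCompact i]
    [IsSchemeTheoreticallyDominant i]
    (huniq : ∀ {S' P' : Scheme.{u}} (t t' : S' ⟶ Y) (u : S' ⟶ S) (i' : P' ⟶ S') (v : P' ⟶ P)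
      [QuasiCompact i'] [IsSchemeTheoreticallyDominant i'], i' ≫ u = v ≫ i →
      t ≫ p = u ≫ h → t' ≫ p = u ≫ h → t = t')
    (H : ∀ s : S, ∃ S' : S.Opens, s ∈ S' ∧ ∃ t : S'.toScheme ⟶ Y, t ≫ p = S'.ι ≫ h) :
    ∃ t : S ⟶ Y, t ≫ p = h := by
  choose U hU t ht using H
  let 𝒰 : S.OpenCover := S.openCoverOfIsOpenCover U (.mk (top_le_iff.mp fun s _ ↦
    TopologicalSpace.Opens.mem_iSup.mpr ⟨s, hU s⟩))
  have hglue (x y : S) :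
      pullback.fst (U x).ι (U y).ι ≫ t x = pullback.snd (U x).ι (U y).ι ≫ t y := by
    have : Flat (pullback.fst (U x).ι (U y).ι ≫ (U x).ι) := inferInstance
    refine huniq _ _ (pullback.fst (U x).ι (U y).ι ≫ (U x).ι)
      (pullback.snd i (pullback.fst (U x).ι (U y).ι ≫ (U x).ι)) (pullback.fst _ _)
      pullback.condition.symm ?_ ?_
    · rw [Category.assoc, ht, Category.assoc]
    · rw [Category.assoc, ht, ← pullback.condition_assoc, Category.assoc]
  refine ⟨𝒰.glueMorphisms t hglue, Scheme.Cover.hom_ext 𝒰 _ _ fun x ↦ ?_⟩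
  exact (Category.assoc _ _ _).symm.trans
    ((congrArg (· ≫ p) (Scheme.Cover.ι_glueMorphisms 𝒰 t hglue x)).trans (ht x))

end General

namespace QCSubalgebra

variable {U Z : Scheme.{u}} {ν : U ⟶ Z} [QuasiCompact ν] [QuasiSeparated ν] (A : QCSubalgebra ν)

lemma preimage_le_fromSource (W : Z.affineOpens) :
    ν ⁻¹ᵁ W.1 ≤ A.fromSource ⁻¹ᵁ (A.toBase ⁻¹ᵁ W.1) := by
  rw [← Scheme.Hom.comp_preimage, A.fromSource_toBase]

lemma isAffineOpen_toBase_preimage (W : Z.affineOpens) : IsAffineOpen (A.toBase ⁻¹ᵁ W.1) :=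
  W.2.preimage A.toBase

/-- The functions on the part of `Spec A` over an affine open subset `W` are the elements of
`A(W)`. -/
lemma exists_isIso_comp_subtype_eq_fromSource (W : Z.affineOpens) :
    ∃ κ : Γ(A.relSpec, A.toBase ⁻¹ᵁ W.1) ⟶ .of (A.ring W), IsIso κ ∧
      A.fromSource.appLE (A.toBase ⁻¹ᵁ W.1) (ν ⁻¹ᵁ W.1) (A.preimage_le_fromSource W) =
        κ ≫ CommRingCat.ofHom (A.ring W).subtype := by
  have e : ⊤ ≤ A.ιAffine W ⁻¹ᵁ (A.toBase ⁻¹ᵁ W.1) := by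
    rw [A.toBase_preimage W]; simp
  have hiso := isIso_appLE_opensRange (A.ιAffine W) (A.toBase_preimage W) e
  refine ⟨(A.ιAffine W).appLE (A.toBase ⁻¹ᵁ W.1) ⊤ e ≫ (Scheme.ΓSpecIso _).hom, inferInstance, ?_⟩
  rw [← cancel_mono (ν ⁻¹ᵁ W.1).topIso.inv]
  have h1 : A.fromSource.appLE (A.toBase ⁻¹ᵁ W.1) (ν ⁻¹ᵁ W.1) (A.preimage_le_fromSource W) ≫
      (ν ⁻¹ᵁ W.1).topIso.inv = ((ν ⁻¹ᵁ W.1).ι ≫ A.fromSource).appLE (A.toBase ⁻¹ᵁ W.1) ⊤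
        (by rw [Scheme.Hom.comp_preimage]; exact (ν ⁻¹ᵁ W.1).ι_preimage_self.ge.trans
              ((ν ⁻¹ᵁ W.1).ι.preimage_mono (A.preimage_le_fromSource W))) := by
    rw [← Scheme.Hom.appLE_comp_appLE _ _ _ (ν ⁻¹ᵁ W.1) _ (A.preimage_le_fromSource W)
      (ν ⁻¹ᵁ W.1).ι_preimage_self.ge]
    congr 1
    rw [Scheme.Opens.topIso_inv, Scheme.Opens.ι_appLE]
    rfl
  rw [h1]
  have h2 := A.ι_fromSource W
  simp_rw [h2, fromSourceAux]
  have h3 := Scheme.Hom.appLE_comp_appLE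
    ((ν ⁻¹ᵁ W.1).toSpecΓ ≫ Spec.map (CommRingCat.ofHom (A.ring W).subtype)) (A.ιAffine W)
    (A.toBase ⁻¹ᵁ W.1) ⊤ ⊤ e le_top
  simp_rw [Category.assoc] at h3
  refine h3.symm.trans ?_
  refine Eq.trans ?_ (Category.assoc _ _ _).symm
  refine Eq.trans ?_ (Category.assoc _ _ _).symm
  have h4 := Scheme.ΓSpecIso_naturality (CommRingCat.ofHom (A.ring W).subtype)
  have h5 :
      ((ν ⁻¹ᵁ W.1).toSpecΓ ≫ Spec.map (CommRingCat.ofHom (A.ring W).subtype)).appLE ⊤ ⊤ le_top =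
      (Spec.map (CommRingCat.ofHom (A.ring W).subtype)).appTop ≫ (ν ⁻¹ᵁ W.1).toSpecΓ.appTop := by
    rw [← Scheme.Hom.comp_appTop, Scheme.Hom.appTop, Scheme.Hom.app_eq_appLE]
    rfl
  refine congrArg ((A.ιAffine W).appLE (A.toBase ⁻¹ᵁ W.1) ⊤ e ≫ ·) (h5.trans ?_)
  rw [(ν ⁻¹ᵁ W.1).toSpecΓ_appTop, ← Category.assoc]
  exact (congrArg (· ≫ (ν ⁻¹ᵁ W.1).topIso.inv) h4).trans (Category.assoc _ _ _)

lemma fromSource_mem (W : Z.affineOpens) (s : Γ(A.relSpec, A.toBase ⁻¹ᵁ W.1)) :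
    (A.fromSource.appLE _ _ (A.preimage_le_fromSource W)).hom s ∈ A.ring W := by
  obtain ⟨κ, -, h⟩ := A.exists_isIso_comp_subtype_eq_fromSource W
  rw [h]
  exact (κ.hom s).2

lemma exists_fromSource_eq (W : Z.affineOpens) {f : Γ(U, ν ⁻¹ᵁ W.1)} (hf : f ∈ A.ring W) :
    ∃ s, (A.fromSource.appLE _ _ (A.preimage_le_fromSource W)).hom s = f := by
  obtain ⟨κ, _, h⟩ := A.exists_isIso_comp_subtype_eq_fromSource W
  refine ⟨(inv κ).hom ⟨f, hf⟩, ?_⟩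
  rw [h]
  exact congrArg Subtype.val (ConcreteCategory.congr_hom (IsIso.inv_hom_id κ) ⟨f, hf⟩)

lemma fromSource_injective (W : Z.affineOpens) : Function.Injective
    (A.fromSource.appLE _ _ (A.preimage_le_fromSource W)).hom := by
  obtain ⟨κ, _, h⟩ := A.exists_isIso_comp_subtype_eq_fromSource W
  rw [h]
  exact Subtype.val_injective.comp (ConcreteCategory.bijective_of_isIso κ).1

instance isSchemeTheoreticallyDominant_fromSource :
    IsSchemeTheoreticallyDominant A.fromSource := by
  refine ⟨Scheme.IdealSheafData.ext_of_iSup_eq_top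
    (fun W : Z.affineOpens ↦ ⟨_, A.isAffineOpen_toBase_preimage W⟩) ?_ fun W ↦ ?_⟩
  · rw [← Scheme.Hom.preimage_iSup, iSup_affineOpens_eq_top]; rfl
  · rw [Scheme.Hom.ker_apply, Scheme.IdealSheafData.ideal_bot, Pi.bot_apply,
      ← RingHom.injective_iff_ker_eq_bot]
    intro s s' h
    apply A.fromSource_injective W
    exact congrArg (U.presheaf.map (homOfLE (A.preimage_le_fromSource W)).op).hom h

lemma fromSource_toBase_appLE (W : Z.affineOpens) (z : Γ(Z, W.1)) :
    (A.fromSource.appLE _ _ (A.preimage_le_fromSource W)).hom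
      ((A.toBase.appLE W.1 (A.toBase ⁻¹ᵁ W.1) le_rfl).hom z) = toPush ν W.1 z := by
  have e : ν ⁻¹ᵁ W.1 ≤ (A.fromSource ≫ A.toBase) ⁻¹ᵁ W.1 := A.preimage_le_fromSource W
  refine (appLE_appLE_apply A.fromSource A.toBase le_rfl (A.preimage_le_fromSource W) e z).trans ?_
  rw [toPush, Scheme.Hom.app_eq_appLE]
  exact ConcreteCategory.congr_hom (appLE_eq_of_eq A.fromSource_toBase e le_rfl) z

/-- Two morphisms to `Spec A` with the same composite with `Spec A ⟶ Z` are equal if they agree,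
locally on the source, on generators of `A`. -/
lemma hom_ext_of_generators (G : ∀ W : Z.affineOpens, Set Γ(U, ν ⁻¹ᵁ W.1))
    (hG : ∀ W, A.ring W = Subring.closure (Set.range (toPush ν W.1) ∪ G W)) {S : Scheme.{u}}
    {t t' : S ⟶ A.relSpec} (h : t ≫ A.toBase = t' ≫ A.toBase)
    (H : ∀ s : S, ∃ (W : Z.affineOpens) (S' : S.Opens), s ∈ S' ∧
      ∃ (e : S' ≤ t ⁻¹ᵁ (A.toBase ⁻¹ᵁ W.1)) (e' : S' ≤ t' ⁻¹ᵁ (A.toBase ⁻¹ᵁ W.1)),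
      ∀ b, (A.fromSource.appLE _ _ (A.preimage_le_fromSource W)).hom b ∈ G W →
        (t.appLE _ S' e).hom b = (t'.appLE _ S' e').hom b) : t = t' := by
  refine Scheme.hom_ext_of_forall _ _ fun s ↦ ?_
  obtain ⟨W, S', hs, e, e', hS'⟩ := H s
  refine ⟨S', hs, ι_comp_eq_of_appLE_eq t t' (A.isAffineOpen_toBase_preimage W) e e'
    fun b ↦ ?_⟩
  set q := (A.fromSource.appLE _ _ (A.preimage_le_fromSource W)).hom with hq
  have hb : q b ∈ A.ring W := A.fromSource_mem W b
  have hinj : Function.Injective q := A.fromSource_injective W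
  have hex {f} (hf : f ∈ A.ring W) : ∃ s, q s = f := A.exists_fromSource_eq W hf
  have hA : Subring.closure (Set.range (toPush ν W.1) ∪ G W) ≤ A.ring W := (hG W).ge
  suffices H : ∀ f ∈ A.ring W, ∀ b, q b = f →
      (t.appLE _ S' e).hom b = (t'.appLE _ S' e').hom b from H _ hb b rfl
  intro f hf
  rw [hG] at hf
  induction hf using Subring.closure_induction with
  | mem f hf =>
    rcases hf with ⟨z, rfl⟩ | hf
    · intro b hb
      have e₀ : A.toBase ⁻¹ᵁ W.1 ≤ A.toBase ⁻¹ᵁ W.1 := le_rfl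
      obtain rfl : b = (A.toBase.appLE W.1 _ e₀).hom z := by
        apply hinj
        exact hb.trans (A.fromSource_toBase_appLE W z).symm
      exact (appLE_appLE_apply t A.toBase e₀ e e z).trans
        ((ConcreteCategory.congr_hom (appLE_eq_of_eq h e e') z).trans
          (appLE_appLE_apply t' A.toBase e₀ e' e' z).symm)
    · rintro b rfl
      exact hS' b hf
  | zero =>
    intro b hb
    obtain rfl : b = 0 := hinj (hb.trans (map_zero q).symm)
    rw [map_zero, map_zero]
  | one =>
    intro b hb
    obtain rfl : b = 1 := hinj (hb.trans (map_one q).symm)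
    rw [map_one, map_one]
  | add x y hx hy ihx ihy =>
    intro b hb
    obtain ⟨bx, rfl⟩ := hex (hA hx)
    obtain ⟨b', rfl⟩ := hex (hA hy)
    obtain rfl : b = bx + b' := hinj (hb.trans (map_add q _ _).symm)
    rw [map_add, map_add, ihx _ rfl, ihy _ rfl]
  | neg x hx ihx =>
    intro b hb
    obtain ⟨bx, rfl⟩ := hex (hA hx)
    obtain rfl : b = -bx := hinj (hb.trans (map_neg q _).symm)
    rw [map_neg, map_neg, ihx _ rfl]
  | mul x y hx hy ihx ihy =>
    intro b hb
    obtain ⟨bx, rfl⟩ := hex (hA hx)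
    obtain ⟨b', rfl⟩ := hex (hA hy)
    obtain rfl : b = bx * b' := hinj (hb.trans (map_mul q _ _).symm)
    rw [map_mul, map_mul, ihx _ rfl, ihy _ rfl]

/-- A ring map from the sections of `A` determines a local lift. -/
lemma exists_lift_of_ringHom {S : Scheme.{u}} (h : S ⟶ Z) (W : Z.affineOpens) {S' : S.Opens}
    (e : S' ≤ h ⁻¹ᵁ W.1) (β : A.ring W →+* Γ(S, S'))
    (hβ : ∀ z, β ⟨toPush ν W.1 z, A.app_mem W z⟩ = (h.appLE W.1 S' e).hom z) :
    ∃ t : S'.toScheme ⟶ A.relSpec, t ≫ A.toBase = S'.ι ≫ h := by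
  refine ⟨S'.toSpecΓ ≫ Spec.map (CommRingCat.ofHom β) ≫ A.ιAffine W, ?_⟩
  rw [ι_comp_eq_toSpecΓ h W.2 e, Category.assoc, Category.assoc, ιAffine_toBase,
    ← Spec.map_comp_assoc]
  congr 3
  ext z
  exact hβ z

section IsOpenImmersion

variable [IsOpenImmersion ν]

lemma isOpenImmersion_ιAffine_toBase (W : Z.affineOpens) (hW : W.1 ≤ ν.opensRange) :
    IsOpenImmersion (A.ιAffine W ≫ A.toBase) := by
  have : IsIso (ν.app W.1) := ν.isIso_app W.1 hW
  have hb : Function.Bijective (ν.app W.1).hom := ConcreteCategory.bijective_of_isIso (ν.app W.1)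
  have : IsIso (CommRingCat.ofHom ((toPush ν W.1).codRestrict (A.ring W) (A.app_mem W))) := by
    rw [ConcreteCategory.isIso_iff_bijective]
    refine ⟨fun x y h ↦ hb.1 (congrArg Subtype.val h), fun y ↦ ?_⟩
    obtain ⟨x, hx⟩ := hb.2 y.1
    exact ⟨x, Subtype.ext hx⟩
  rw [ιAffine_toBase]
  have := W.2.isOpenImmersion_fromSpec
  infer_instance

/-- Over the image of `U`, the morphism `Spec A ⟶ Z` is an isomorphism. -/
lemma ext_of_toBase_eq {S : Scheme.{u}} {t t' : S ⟶ A.relSpec}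
    (h : t ≫ A.toBase = t' ≫ A.toBase) (hU : ∀ s, (t ≫ A.toBase) s ∈ ν.opensRange) : t = t' := by
  refine Scheme.hom_ext_of_forall _ _ fun s ↦ ?_
  obtain ⟨W, hW, hsW, hle⟩ := exists_isAffineOpen_mem_and_subset (hU s)
  let W' : Z.affineOpens := ⟨W, hW⟩
  have := A.isOpenImmersion_ιAffine_toBase W' hle
  let S' := (t ≫ A.toBase) ⁻¹ᵁ W
  have hr (t₀ : S ⟶ A.relSpec) (h₀ : t₀ ≫ A.toBase = t ≫ A.toBase) :
      ∃ l, l ≫ A.ιAffine W' = S'.ι ≫ t₀ := by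
    refine ⟨IsOpenImmersion.lift (A.ιAffine W') (S'.ι ≫ t₀) ?_, IsOpenImmersion.lift_fac _ _ _⟩
    rintro _ ⟨x, rfl⟩
    have h1 : t₀ x.1 ∈ A.toBase ⁻¹ᵁ W := by
      have : (t₀ ≫ A.toBase) x.1 ∈ W := by rw [h₀]; exact x.2
      exact this
    rw [show W = W'.1 from rfl, A.toBase_preimage W'] at h1
    exact h1
  obtain ⟨l, hl⟩ := hr t rfl
  obtain ⟨l', hl'⟩ := hr t' h.symm
  refine ⟨S', hsW, ?_⟩
  rw [← hl, ← hl']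
  congr 1
  rw [← cancel_mono (A.ιAffine W' ≫ A.toBase), reassoc_of% hl, reassoc_of% hl', h]

lemma eq_fromSource_of_toBase_eq {S : Scheme.{u}} {t : S ⟶ A.relSpec} {a : S ⟶ U}
    (h : t ≫ A.toBase = a ≫ ν) : t = a ≫ A.fromSource := by
  refine A.ext_of_toBase_eq (by rw [h, Category.assoc, fromSource_toBase]) fun s ↦ ?_
  rw [h]
  exact ⟨a s, rfl⟩

lemma isPullback_fromSource : IsPullback A.fromSource (𝟙 U) A.toBase ν := by
  refine ⟨⟨by rw [fromSource_toBase, Category.id_comp]⟩, ⟨PullbackCone.IsLimit.mk _ (fun s ↦ s.snd)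
    (fun s ↦ (A.eq_fromSource_of_toBase_eq s.condition).symm) (fun s ↦ Category.comp_id _)
    fun s m _ h ↦ (Category.comp_id m).symm.trans h⟩⟩

instance isOpenImmersion_fromSource : IsOpenImmersion A.fromSource :=
  MorphismProperty.of_isPullback A.isPullback_fromSource.flip ‹_›

lemma toBase_preimage_opensRange : A.toBase ⁻¹ᵁ ν.opensRange = A.fromSource.opensRange := by
  apply TopologicalSpace.Opens.ext
  have := Scheme.image_preimage_eq_of_isPullback A.isPullback_fromSource.flip Set.univ
  simpa using this.symm

/-- Morphisms to `Spec A` are determined by the composite with `Spec A ⟶ Z`, if a schematically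
dense subscheme of the source is mapped to `U`. -/
lemma hom_ext_of_isSchemeTheoreticallyDominant {S P : Scheme.{u}} {t t' : S ⟶ A.relSpec}
    (h : t ≫ A.toBase = t' ≫ A.toBase) (i : P ⟶ S) [IsSchemeTheoreticallyDominant i] {a : P ⟶ U}
    (hi : i ≫ t ≫ A.toBase = a ≫ ν) : t = t' := by
  refine ext_of_isSchemeTheoreticallyDominant A.toBase h i ?_
  rw [A.eq_fromSource_of_toBase_eq (a := a) ((Category.assoc _ _ _).trans hi),
    A.eq_fromSource_of_toBase_eq (t := i ≫ t') (a := a) (by rw [Category.assoc, ← h, hi])]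

/-- The universal property of `Spec A`: a morphism `h : S ⟶ Z`, which maps a schematically dense
subscheme `P` of `S` to `U`, lifts to `Spec A` if the generators of `A` extend from functions on `P`
to functions on `S`, locally on `S`. -/
lemma _root_.Newton.SectionFamily.exists_relSpec_lift (F : SectionFamily ν) {S P : Scheme.{u}}
    (h : S ⟶ Z) (i : P ⟶ S) [QuasiCompact i] [IsSchemeTheoreticallyDominant i] (a : P ⟶ U)
    (w : i ≫ h = a ≫ ν)
    (H : ∀ s : S, ∃ (W : Z.affineOpens) (S' : S.Opens), s ∈ S' ∧ ∃ (_ : S' ≤ h ⁻¹ᵁ W.1)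
      (e : i ⁻¹ᵁ S' ≤ a ⁻¹ᵁ (ν ⁻¹ᵁ W.1)), ∀ f ∈ F.carrier W,
        ∃ b, (i.app S').hom b = (a.appLE (ν ⁻¹ᵁ W.1) (i ⁻¹ᵁ S') e).hom f) :
    ∃ t : S ⟶ F.adjoin.relSpec, t ≫ F.adjoin.toBase = h := by
  refine exists_lift_of_forall_exists_opens F.adjoin.toBase h i ?_ fun s ↦ ?_
  · intro S' P' t t' u i' v _ _ huv ht ht'
    refine F.adjoin.hom_ext_of_isSchemeTheoreticallyDominant (ht.trans ht'.symm) i' (a := v ≫ a) ?_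
    rw [ht, ← Category.assoc, huv, Category.assoc, w, Category.assoc]
  · obtain ⟨W, S', hs, e, e', hf⟩ := H s
    have hinj : Function.Injective (i.app S').hom := i.app_injective S'
    let α := (a.appLE (ν ⁻¹ᵁ W.1) (i ⁻¹ᵁ S') e').hom
    have hα : ∀ z, α (toPush ν W.1 z) = (i.app S').hom ((h.appLE W.1 S' e).hom z) := by
      intro z
      have e₁ : i ⁻¹ᵁ S' ≤ (a ≫ ν) ⁻¹ᵁ W.1 := e'
      have e₂ : i ⁻¹ᵁ S' ≤ (i ≫ h) ⁻¹ᵁ W.1 := i.preimage_mono e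
      rw [toPush, Scheme.Hom.app_eq_appLE, Scheme.Hom.app_eq_appLE]
      exact (appLE_appLE_apply a ν le_rfl e' e₁ z).trans
        ((ConcreteCategory.congr_hom (appLE_eq_of_eq w e₂ e₁).symm z).trans
          (appLE_appLE_apply i h e le_rfl e₂ z).symm)
    have hle : F.adjoin.ring W ≤ (i.app S').hom.range.comap α := by
      refine Subring.closure_le.mpr ?_
      rintro _ (⟨z, rfl⟩ | hfW)
      · exact ⟨_, (hα z).symm⟩
      · exact hf _ hfW
    let β : F.adjoin.ring W →+* Γ(S, S') :=
      (RingEquiv.ofLeftInverse (Function.leftInverse_invFun hinj)).symm.toRingHom.comp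
        (α.restrict (F.adjoin.ring W) (i.app S').hom.range fun x hx ↦ hle hx)
    obtain ⟨t, ht⟩ := F.adjoin.exists_lift_of_ringHom h W e β fun z ↦ by
      apply (RingEquiv.ofLeftInverse (Function.leftInverse_invFun hinj)).injective
      refine (RingEquiv.apply_symm_apply _ _).trans (Subtype.ext (hα z))
    exact ⟨S', hs, t, ht⟩

end IsOpenImmersion

end QCSubalgebra

end Newton

/-! ### Infinitesimally close morphisms -/

namespace Newton

section PullGerm

variable {X Y S T : Scheme.{u}}

/-- The germ at `s` of the pullback along `q` of a function that is defined near `q s`. -/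
noncomputable def pullGerm (q : S ⟶ X) (s : S) {V : X.Opens} (h : q s ∈ V) :
    Γ(X, V) →+* S.presheaf.stalk s :=
  (q.stalkMap s).hom.comp (X.presheaf.germ V (q s) h).hom

lemma pullGerm_eq_germ (q : S ⟶ X) {s : S} {V : X.Opens} {S' : S.Opens} (e : S' ≤ q ⁻¹ᵁ V)
    (hs : s ∈ S') (h : q s ∈ V) (b : Γ(X, V)) :
    pullGerm q s h b = S.presheaf.germ S' s hs ((q.appLE V S' e).hom b) :=
  stalkMap_germ q e hs b

lemma pullGerm_comp_eq_germ (h : S ⟶ X) (q : X ⟶ Y) {s : S} {V : Y.Opens} {W : X.Opens}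
    {S' : S.Opens} (e₁ : W ≤ q ⁻¹ᵁ V) (e : S' ≤ h ⁻¹ᵁ W) (hs : s ∈ S') (hV : (h ≫ q) s ∈ V)
    (b : Γ(Y, V)) : pullGerm (h ≫ q) s hV b =
      S.presheaf.germ S' s hs ((h.appLE W S' e).hom ((q.appLE V W e₁).hom b)) := by
  have e' : S' ≤ (h ≫ q) ⁻¹ᵁ V := e.trans (h.preimage_mono e₁)
  rw [appLE_appLE_apply h q e₁ e e']
  exact pullGerm_eq_germ _ e' hs hV b

lemma pullGerm_res (q : S ⟶ X) (s : S) {V V' : X.Opens} (e : V' ≤ V) (h : q s ∈ V')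
    (h' : q s ∈ V) (b : Γ(X, V)) :
    pullGerm q s h ((X.presheaf.map (homOfLE e).op).hom b) = pullGerm q s h' b :=
  congrArg (q.stalkMap s).hom (germ_res_apply e h b)

lemma stalkMap_comp_apply (w : T ⟶ S) (q : S ⟶ X) (t : T) (b : X.presheaf.stalk ((w ≫ q) t)) :
    ((w ≫ q).stalkMap t).hom b = (w.stalkMap t).hom ((q.stalkMap (w t)).hom b) :=
  ConcreteCategory.congr_hom (Scheme.Hom.stalkMap_comp w q t) b

lemma pullGerm_comp (w : T ⟶ S) (q : S ⟶ X) (t : T) {V : X.Opens} (h : (w ≫ q) t ∈ V)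
    (h' : q (w t) ∈ V) (b : Γ(X, V)) :
    pullGerm (w ≫ q) t h b = (w.stalkMap t).hom (pullGerm q (w t) h' b) :=
  stalkMap_comp_apply w q t _

lemma pullGerm_comp' (q : S ⟶ X) (f : X ⟶ Y) (s : S) {V : Y.Opens} {V' : X.Opens}
    (e : V' ≤ f ⁻¹ᵁ V) (h : (q ≫ f) s ∈ V) (h' : q s ∈ V') (a : Γ(Y, V)) :
    pullGerm (q ≫ f) s h a = pullGerm q s h' ((f.appLE V V' e).hom a) := by
  refine (pullGerm_comp q f s h h a).trans ?_
  exact congrArg (q.stalkMap s).hom (stalkMap_germ f e h' a)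

lemma isUnit_appLE (q : S ⟶ X) {V : X.Opens} {S' : S.Opens} (e : S' ≤ q ⁻¹ᵁ V) (g : Γ(X, V))
    (h : S' ≤ q ⁻¹ᵁ X.basicOpen g) : IsUnit ((q.appLE V S' e).hom g) := by
  have h1 := RingedSpace.isUnit_res_basicOpen X.toRingedSpace g
  have h2 := Scheme.Hom.map_appLE q h (homOfLE (X.basicOpen_le g)).op
  have h3 := h1.map (q.appLE (X.basicOpen g) S' h).hom
  exact (ConcreteCategory.congr_hom h2 g) ▸ h3

end PullGerm

namespace NewtonSetting

variable {k : Type u} [Field k] (D : NewtonSetting k) {S T : Scheme.{u}}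

/-- The stalk at `s` of the ideal of the preimage of the different under `q`. -/
noncomputable def pullDifferent (q : S ⟶ D.X) (s : S) : Ideal (S.presheaf.stalk s) :=
  (stalkDifferent D.φ (q s)).map (q.stalkMap s).hom

variable {D}

lemma Chart.pullDifferent_eq (c : Chart D) (q : S ⟶ D.X) {s : S} (h : q s ∈ c.V) :
    D.pullDifferent q s = Ideal.span {pullGerm q s h c.g} := by
  rw [pullDifferent, c.stalkDifferent_eq h, Ideal.map_span, Set.image_singleton]
  rfl

lemma pullDifferent_comp (w : T ⟶ S) (q : S ⟶ D.X) (t : T) :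
    D.pullDifferent (w ≫ q) t = (D.pullDifferent q (w t)).map (w.stalkMap t).hom := by
  rw [pullDifferent, pullDifferent, Ideal.map_map]
  congr 1
  exact congrArg CommRingCat.Hom.hom (Scheme.Hom.stalkMap_comp w q t)

lemma Chart.isUnit_germ_iff (c : Chart D) {x : D.X} (hx : x ∈ c.V) :
    IsUnit (D.X.presheaf.germ c.V x hx c.g) ↔ x ∈ etaleLocus D.φ := by
  rw [← D.X.mem_basicOpen c.g x hx, c.basicOpen_g]
  exact ⟨fun h ↦ h.2, fun h ↦ ⟨hx, h⟩⟩

lemma pullDifferent_eq_top_iff (q : S ⟶ D.X) (s : S) :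
    D.pullDifferent q s = ⊤ ↔ q s ∈ etaleLocus D.φ := by
  obtain ⟨c, hc⟩ := D.exists_chart (q s)
  rw [c.pullDifferent_eq q hc, Ideal.span_singleton_eq_top, ← c.isUnit_germ_iff hc]
  exact isUnit_map_iff (q.stalkMap s).hom _

variable (D) in
/-- Two morphisms `q₁, q₂ : S ⟶ X` are close of order `r` if the preimages of the different agree,
if `q₁` and `q₂` agree modulo its `(r - 1)`-st power and if `q₁ ≫ φ` and `q₂ ≫ φ` agree modulo its
`r`-th power. Where the different pulls back to the unit ideal, both morphisms meet the étale locus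
and nothing else is required; in particular the images of a point may differ. -/
structure Close (r : ℕ) (q₁ q₂ : S ⟶ D.X) : Prop where
  pullDifferent_eq : ∀ s, D.pullDifferent q₁ s = D.pullDifferent q₂ s
  eq_top_or : ∀ s, D.pullDifferent q₁ s = ⊤ ∨ q₁ s = q₂ s
  sub_mem : ∀ (s : S) (V : D.X.Opens) (h₁ : q₁ s ∈ V) (h₂ : q₂ s ∈ V) (b : Γ(D.X, V)),
    pullGerm q₁ s h₁ b - pullGerm q₂ s h₂ b ∈ D.pullDifferent q₁ s ^ (r - 1)
  sub_mem' : ∀ (s : S) (V : D.Y.Opens) (h₁ : (q₁ ≫ D.φ) s ∈ V) (h₂ : (q₂ ≫ D.φ) s ∈ V)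
    (a : Γ(D.Y, V)), pullGerm (q₁ ≫ D.φ) s h₁ a - pullGerm (q₂ ≫ D.φ) s h₂ a ∈
      D.pullDifferent q₁ s ^ r

namespace Close

variable {r : ℕ} {q₁ q₂ q₃ : S ⟶ D.X}

lemma refl (r : ℕ) (q : S ⟶ D.X) : D.Close r q q where
  pullDifferent_eq _ := rfl
  eq_top_or _ := .inr rfl
  sub_mem _ _ _ _ _ := by rw [sub_self]; exact zero_mem _
  sub_mem' _ _ _ _ _ := by rw [sub_self]; exact zero_mem _

lemma symm (h : D.Close r q₁ q₂) : D.Close r q₂ q₁ where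
  pullDifferent_eq s := (h.pullDifferent_eq s).symm
  eq_top_or s := (h.pullDifferent_eq s) ▸ (h.eq_top_or s).imp_right Eq.symm
  sub_mem s V h₁ h₂ b := by
    rw [← h.pullDifferent_eq, ← neg_sub]; exact neg_mem (h.sub_mem s V h₂ h₁ b)
  sub_mem' s V h₁ h₂ b := by
    rw [← h.pullDifferent_eq, ← neg_sub]; exact neg_mem (h.sub_mem' s V h₂ h₁ b)

lemma trans (h : D.Close r q₁ q₂) (h' : D.Close r q₂ q₃) : D.Close r q₁ q₃ where
  pullDifferent_eq s := (h.pullDifferent_eq s).trans (h'.pullDifferent_eq s)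
  eq_top_or s := by
    rcases h.eq_top_or s with h1 | h1
    · exact .inl h1
    · rw [h.pullDifferent_eq, h1]; exact h'.eq_top_or s
  sub_mem s V h₁ h₃ b := by
    rcases h.eq_top_or s with h1 | h1
    · rw [h1, Ideal.top_pow]; trivial
    · have h₂ : q₂ s ∈ V := h1 ▸ h₁
      rw [← sub_add_sub_cancel _ (pullGerm q₂ s h₂ b)]
      exact add_mem (h.sub_mem s V h₁ h₂ b) (h.pullDifferent_eq s ▸ h'.sub_mem s V h₂ h₃ b)
  sub_mem' s V h₁ h₃ b := by
    rcases h.eq_top_or s with h1 | h1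
    · rw [h1, Ideal.top_pow]; trivial
    · have h₂ : (q₂ ≫ D.φ) s ∈ V := by
        rw [Scheme.Hom.comp_apply] at h₁ ⊢; exact h1 ▸ h₁
      rw [← sub_add_sub_cancel _ (pullGerm (q₂ ≫ D.φ) s h₂ b)]
      exact add_mem (h.sub_mem' s V h₁ h₂ b) (h.pullDifferent_eq s ▸ h'.sub_mem' s V h₂ h₃ b)

lemma mono {r' : ℕ} (hr : r' ≤ r) (h : D.Close r q₁ q₂) : D.Close r' q₁ q₂ where
  pullDifferent_eq := h.pullDifferent_eq
  eq_top_or := h.eq_top_or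
  sub_mem s V h₁ h₂ b := Ideal.pow_le_pow_right (by omega) (h.sub_mem s V h₁ h₂ b)
  sub_mem' s V h₁ h₂ b := Ideal.pow_le_pow_right hr (h.sub_mem' s V h₁ h₂ b)

lemma comp (h : D.Close r q₁ q₂) (w : T ⟶ S) : D.Close r (w ≫ q₁) (w ≫ q₂) where
  pullDifferent_eq t := by rw [pullDifferent_comp, pullDifferent_comp, h.pullDifferent_eq]
  eq_top_or t := by
    rcases h.eq_top_or (w t) with h1 | h1
    · left; rw [pullDifferent_comp, h1, Ideal.map_top]
    · right; rw [Scheme.Hom.comp_apply, Scheme.Hom.comp_apply, h1]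
  sub_mem t V h₁ h₂ b := by
    rw [pullGerm_comp w q₁ t h₁ h₁, pullGerm_comp w q₂ t h₂ h₂, ← map_sub, pullDifferent_comp,
      ← Ideal.map_pow]
    exact Ideal.mem_map_of_mem _ (h.sub_mem (w t) V h₁ h₂ b)
  sub_mem' t V h₁ h₂ b := by
    have e₁ : pullGerm ((w ≫ q₁) ≫ D.φ) t h₁ b = _ := pullGerm_comp w (q₁ ≫ D.φ) t h₁ h₁ b
    have e₂ : pullGerm ((w ≫ q₂) ≫ D.φ) t h₂ b = _ := pullGerm_comp w (q₂ ≫ D.φ) t h₂ h₂ b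
    rw [e₁, e₂, ← map_sub, pullDifferent_comp, ← Ideal.map_pow]
    exact Ideal.mem_map_of_mem _ (h.sub_mem' (w t) V h₁ h₂ b)

lemma mem_etaleLocus_iff (h : D.Close r q₁ q₂) (s : S) :
    q₁ s ∈ etaleLocus D.φ ↔ q₂ s ∈ etaleLocus D.φ := by
  rw [← pullDifferent_eq_top_iff, h.pullDifferent_eq, pullDifferent_eq_top_iff]

lemma preimage_etaleLocus_eq (h : D.Close r q₁ q₂) :
    q₁ ⁻¹ᵁ etaleLocus D.φ = q₂ ⁻¹ᵁ etaleLocus D.φ :=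
  TopologicalSpace.Opens.ext (Set.ext h.mem_etaleLocus_iff)

end Close

/-- The étale locus is schematically dense, because the Jacobian is a nonzerodivisor. -/
instance isSchemeTheoreticallyDominant_etaleLocus_ι :
    IsSchemeTheoreticallyDominant (etaleLocus D.φ).ι := by
  refine ⟨Scheme.IdealSheafData.ext_of_iSup_eq_top
    (fun x : D.X ↦ ⟨(D.exists_chart x).choose.V, (D.exists_chart x).choose.isAffineOpen_V⟩) ?_
      fun x ↦ ?_⟩
  · exact top_le_iff.mp fun x _ ↦ TopologicalSpace.Opens.mem_iSup.mpr
      ⟨x, (D.exists_chart x).choose_spec⟩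
  · generalize (D.exists_chart x).choose = c
    rw [Scheme.Hom.ker_apply, Scheme.IdealSheafData.ideal_bot, Pi.bot_apply,
      ← RingHom.injective_iff_ker_eq_bot, injective_iff_map_eq_zero]
    intro s hs
    have hloc := c.isAffineOpen_V.isLocalization_basicOpen c.g
    have hs' : (D.X.presheaf.map (homOfLE (D.X.basicOpen_le c.g)).op).hom s = 0 := by
      have hle : D.X.basicOpen c.g ≤ (etaleLocus D.φ).ι ''ᵁ ((etaleLocus D.φ).ι ⁻¹ᵁ c.V) := by
        rw [c.basicOpen_g, Scheme.Hom.image_preimage_eq_opensRange_inf, Scheme.Opens.opensRange_ι,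
          inf_comm]
      rw [Scheme.Opens.ι_app] at hs
      refine Eq.trans ?_ ((congrArg (D.X.presheaf.map (homOfLE hle).op).hom hs).trans (map_zero _))
      exact ConcreteCategory.congr_hom (D.X.presheaf.map_comp _ (homOfLE hle).op) s
    obtain ⟨⟨_, n, rfl⟩, hn⟩ := (IsLocalization.map_eq_zero_iff (.powers c.g)
      Γ(D.X, D.X.basicOpen c.g) s).mp hs'
    exact (mul_left_mem_nonZeroDivisors_eq_zero_iff (pow_mem c.regular n)).mp hn

/-- The preimage of the étale locus under `q` is schematically dense. -/
def Good (q : S ⟶ D.X) : Prop := IsSchemeTheoreticallyDominant (q ⁻¹ᵁ etaleLocus D.φ).ι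

instance quasiCompact_preimage_ι (q : S ⟶ D.X) : QuasiCompact (q ⁻¹ᵁ etaleLocus D.φ).ι :=
  MorphismProperty.of_isPullback (isPullback_morphismRestrict q (etaleLocus D.φ))
    (inferInstanceAs (QuasiCompact (etaleLocus D.φ).ι))

/-- Schematic density of the étale locus is preserved by flat base change. -/
lemma good_of_flat (q : S ⟶ D.X) [Flat q] : Good q :=
  .of_isPullback (isPullback_morphismRestrict q (etaleLocus D.φ))

end NewtonSetting

end Newton

/-! ### Twists by the different -/

namespace Newton

namespace NewtonSetting

variable {k : Type u} [Field k] {D : NewtonSetting k} {U Z S P : Scheme.{u}} {ν : U ⟶ Z}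
  {q : Z ⟶ D.X}

lemma Chart.isUnit_toPush (c : Chart D) (hq : ∀ u, q (ν u) ∈ etaleLocus D.φ) {W : Z.Opens}
    (h : W ≤ q ⁻¹ᵁ c.V) : IsUnit (toPush ν W ((q.appLE c.V W h).hom c.g)) := by
  have e : ν ⁻¹ᵁ W ≤ (ν ≫ q) ⁻¹ᵁ c.V := ν.preimage_mono h
  have h1 := isUnit_appLE (ν ≫ q) e c.g fun u hu ↦ by
    rw [c.basicOpen_g]; exact ⟨e hu, hq u⟩
  rwa [← appLE_appLE_apply ν q h le_rfl e, ← Scheme.Hom.app_eq_appLE] at h1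

variable [QuasiCompact ν] [QuasiSeparated ν]

lemma Chart.mem_twist_iff (c : Chart D) {I : Z.IdealSheafData}
    (hJ : ∀ W, ((D.IΔ.comap q).ideal W).FG) (n : ℕ) {W : Z.Opens} (hW : IsAffineOpen W)
    (h : W ≤ q ⁻¹ᵁ c.V) (f : Γ(U, ν ⁻¹ᵁ W)) :
    f ∈ (twist (ν := ν) I (D.IΔ.comap q) hJ n).carrier ⟨W, hW⟩ ↔
      ∃ i ∈ I.ideal ⟨W, hW⟩, toPush ν W ((q.appLE c.V W h).hom c.g) ^ n * f = toPush ν W i := by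
  have hI := c.comap_IΔ_ideal q hW h
  constructor
  · intro hf
    obtain ⟨i, hi, e⟩ := hf ((q.appLE c.V W h).hom c.g ^ n) (by
      rw [hI]; exact Ideal.pow_mem_pow (Ideal.mem_span_singleton_self _) n)
    exact ⟨i, hi, by rw [← e, map_pow]⟩
  · rintro ⟨i, hi, e⟩ t ht
    rw [hI, Ideal.span_singleton_pow, Ideal.mem_span_singleton'] at ht
    obtain ⟨a, rfl⟩ := ht
    exact ⟨a * i, Ideal.mul_mem_left _ _ hi, by
      rw [map_mul, map_mul, map_pow, mul_assoc, e]⟩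

/-- A function `i` in the ideal `I` becomes divisible by the `n`-th power of the equation of the
different on `Spec A`, if `A` contains the twist of `I` by `n` times the different. -/
lemma Chart.exists_pow_mul_eq (c : Chart D) (hq : ∀ u, q (ν u) ∈ etaleLocus D.φ)
    (A : QCSubalgebra ν) {I : Z.IdealSheafData} (hJ : ∀ W, ((D.IΔ.comap q).ideal W).FG) (n : ℕ)
    (hA : ∀ W, (twist (ν := ν) I (D.IΔ.comap q) hJ n).carrier W ⊆ A.ring W) {W : Z.Opens}
    (hW : IsAffineOpen W) (h : W ≤ q ⁻¹ᵁ c.V) (e : A.toBase ⁻¹ᵁ W ≤ (A.toBase ≫ q) ⁻¹ᵁ c.V)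
    {i : Γ(Z, W)} (hi : i ∈ I.ideal ⟨W, hW⟩) :
    ∃ ρ, ((A.toBase ≫ q).appLE c.V _ e).hom c.g ^ n * ρ = (A.toBase.appLE W _ le_rfl).hom i := by
  obtain ⟨v, hv⟩ := (c.isUnit_toPush hq h).pow n
  have hf : (↑v⁻¹ * toPush ν W i : Γ(U, ν ⁻¹ᵁ W)) ∈ A.ring ⟨W, hW⟩ := by
    refine hA _ ((c.mem_twist_iff hJ n hW h _).mpr ⟨i, hi, ?_⟩)
    rw [← hv, Units.mul_inv_cancel_left]
  obtain ⟨ρ, hρ⟩ := A.exists_fromSource_eq ⟨W, hW⟩ hf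
  refine ⟨ρ, A.fromSource_injective ⟨W, hW⟩ ?_⟩
  have h1 := A.fromSource_toBase_appLE ⟨W, hW⟩ i
  have h2 := A.fromSource_toBase_appLE ⟨W, hW⟩ ((q.appLE c.V W h).hom c.g)
  rw [← appLE_appLE_apply A.toBase q h le_rfl e, map_mul, map_pow]
  refine (congrArg₂ (fun x y ↦ x ^ n * y) h2 hρ).trans (Eq.trans ?_ h1.symm)
  rw [← hv, Units.mul_inv_cancel_left]

/-- Conversely, the elements of the twist of `I` are quotients of elements of `I`. -/
lemma Chart.exists_eq_pow_mul (c : Chart D)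
    (A : QCSubalgebra ν) {I : Z.IdealSheafData} (hJ : ∀ W, ((D.IΔ.comap q).ideal W).FG) (n : ℕ)
    {W : Z.Opens} (hW : IsAffineOpen W) (h : W ≤ q ⁻¹ᵁ c.V)
    (e : A.toBase ⁻¹ᵁ W ≤ (A.toBase ≫ q) ⁻¹ᵁ c.V) (ρ : Γ(A.relSpec, A.toBase ⁻¹ᵁ W))
    (hρ : (A.fromSource.appLE _ _ (A.preimage_le_fromSource ⟨W, hW⟩)).hom ρ ∈
      (twist (ν := ν) I (D.IΔ.comap q) hJ n).carrier ⟨W, hW⟩) : ∃ i ∈ I.ideal ⟨W, hW⟩,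
    ((A.toBase ≫ q).appLE c.V _ e).hom c.g ^ n * ρ = (A.toBase.appLE W _ le_rfl).hom i := by
  obtain ⟨i, hi, hiρ⟩ := (c.mem_twist_iff hJ n hW h _).mp hρ
  refine ⟨i, hi, A.fromSource_injective ⟨W, hW⟩ ?_⟩
  have h1 := A.fromSource_toBase_appLE ⟨W, hW⟩ i
  have h2 := A.fromSource_toBase_appLE ⟨W, hW⟩ ((q.appLE c.V W h).hom c.g)
  rw [← appLE_appLE_apply A.toBase q h le_rfl e, map_mul, map_pow]
  refine (congrArg (fun x ↦ x ^ n * _) h2).trans (Eq.trans ?_ h1.symm)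
  exact hiρ

/-- The elements of the twist of `I` by `n` times the different extend to functions on `S`, if the
elements of `I` become divisible by the `n`-th power of the equation of the different on `S`. -/
lemma Chart.exists_app_eq (c : Chart D) (hq : ∀ u, q (ν u) ∈ etaleLocus D.φ)
    {I : Z.IdealSheafData} (hJ : ∀ W, ((D.IΔ.comap q).ideal W).FG) (n : ℕ) {h : S ⟶ Z} {i : P ⟶ S}
    {a : P ⟶ U} (w : i ≫ h = a ≫ ν) {W : Z.Opens} (hW : IsAffineOpen W) (hWV : W ≤ q ⁻¹ᵁ c.V)
    {S' : S.Opens} (e : S' ≤ h ⁻¹ᵁ W) (e' : i ⁻¹ᵁ S' ≤ a ⁻¹ᵁ (ν ⁻¹ᵁ W))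
    (hI : ∀ z ∈ I.ideal ⟨W, hW⟩, (h.appLE W S' e).hom z ∈
      Ideal.span {(h.appLE W S' e).hom ((q.appLE c.V W hWV).hom c.g) ^ n})
    {f : Γ(U, ν ⁻¹ᵁ W)} (hf : f ∈ (twist (ν := ν) I (D.IΔ.comap q) hJ n).carrier ⟨W, hW⟩) :
    ∃ b, (i.app S').hom b = (a.appLE (ν ⁻¹ᵁ W) (i ⁻¹ᵁ S') e').hom f := by
  set γ := (q.appLE c.V W hWV).hom c.g
  have hα (z : Γ(Z, W)) : (a.appLE (ν ⁻¹ᵁ W) (i ⁻¹ᵁ S') e').hom (toPush ν W z) =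
      (i.app S').hom ((h.appLE W S' e).hom z) := by
    have e₁ : i ⁻¹ᵁ S' ≤ (a ≫ ν) ⁻¹ᵁ W := e'
    have e₂ : i ⁻¹ᵁ S' ≤ (i ≫ h) ⁻¹ᵁ W := i.preimage_mono e
    rw [toPush, Scheme.Hom.app_eq_appLE, Scheme.Hom.app_eq_appLE]
    exact (appLE_appLE_apply a ν le_rfl e' e₁ z).trans
      ((ConcreteCategory.congr_hom (appLE_eq_of_eq w e₂ e₁).symm z).trans
        (appLE_appLE_apply i h e le_rfl e₂ z).symm)
  obtain ⟨z, hz, hzf⟩ := (c.mem_twist_iff hJ n hW hWV f).mp hf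
  obtain ⟨b, hb⟩ := Ideal.mem_span_singleton'.mp (hI z hz)
  refine ⟨b, ?_⟩
  have hu := ((c.isUnit_toPush hq hWV).map (a.appLE (ν ⁻¹ᵁ W) (i ⁻¹ᵁ S') e').hom).pow n
  apply hu.mul_left_cancel
  rw [← map_pow, ← map_mul _ _ f, hzf, hα, ← hb, mul_comm, ← map_pow, hα, map_pow, map_mul]

end NewtonSetting

end Newton

/-! ### Morphisms to `Γ_r` and pairs of close morphisms -/

namespace Newton

namespace NewtonSetting

variable {k : Type u} [Field k] {D : NewtonSetting k} {S P : Scheme.{u}}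

variable (D) in
/-- The generators of the algebra `𝒜_r`. -/
noncomputable abbrev family (r : ℕ) : SectionFamily D.j :=
  ((twist D.I₁ D.D₁ D.D₁_fg (r - 1)).union (twist D.I₂ D.D₁ D.D₁_fg r)).union
    ((twist D.I₁ D.D₂ D.D₂_fg (r - 1)).union (twist D.I₂ D.D₂ D.D₂_fg r))

variable (D) in
lemma pr₁_j_mem (u : D.UU.toScheme) : D.pr₁ (D.j u) ∈ etaleLocus D.φ := u.2.1

variable (D) in
lemma pr₂_j_mem (u : D.UU.toScheme) : D.pr₂ (D.j u) ∈ etaleLocus D.φ := u.2.2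

lemma subset_ring_𝒜 (r : ℕ) (W : D.XX.affineOpens) :
    (D.family r).carrier W ⊆ (D.𝒜 r).ring W := fun _ hs ↦ Subring.subset_closure (.inr hs)

lemma mem_span_pow_of_germ {S' : S.Opens} (hS' : IsAffineOpen S') (z γ : Γ(S, S')) (n : ℕ)
    (h : ∀ (s : S) (hs : s ∈ S'), S.presheaf.germ S' s hs z ∈
      Ideal.span {S.presheaf.germ S' s hs γ} ^ n) : z ∈ Ideal.span {γ ^ n} := by
  rw [hS'.mem_ideal_iff]
  intro s hs
  have := h s hs
  rw [Ideal.span_singleton_pow, ← map_pow] at this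
  rwa [Ideal.map_span, Set.image_singleton]

section Ideals

variable {r : ℕ} {q₁ q₂ : S ⟶ D.X} {h : S ⟶ D.XX} {W : D.XX.Opens} (hW : IsAffineOpen W)
  {S' : S.Opens} (e : S' ≤ h ⁻¹ᵁ W)

include hW

lemma germ_mem_of_mem_I₁ (hq : D.Close r (h ≫ D.pr₁) (h ≫ D.pr₂)) {V : D.X.Opens}
    (hV : IsAffineOpen V) (e₁ : W ≤ D.pr₁ ⁻¹ᵁ V) (e₂ : W ≤ D.pr₂ ⁻¹ᵁ V) {z : Γ(D.XX, W)}
    (hz : z ∈ D.I₁.ideal ⟨W, hW⟩) (s : S) (hs : s ∈ S') :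
    S.presheaf.germ S' s hs ((h.appLE W S' e).hom z) ∈
      D.pullDifferent (h ≫ D.pr₁) s ^ (r - 1) := by
  suffices H : D.I₁.ideal ⟨W, hW⟩ ≤ (D.pullDifferent (h ≫ D.pr₁) s ^ (r - 1)).comap
      ((S.presheaf.germ S' s hs).hom.comp (h.appLE W S' e).hom) from H hz
  rw [D.I₁_ideal hW hV e₁ e₂, Ideal.span_le]
  rintro _ ⟨b, rfl⟩
  have h₁ : (h ≫ D.pr₁) s ∈ V := e₁ (e hs)
  have h₂ : (h ≫ D.pr₂) s ∈ V := e₂ (e hs)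
  have key := hq.sub_mem s V h₁ h₂ b
  rw [pullGerm_comp_eq_germ h D.pr₁ e₁ e hs, pullGerm_comp_eq_germ h D.pr₂ e₂ e hs, ← map_sub,
    ← map_sub] at key
  exact key

lemma germ_mem_of_mem_I₂ (hq : D.Close r (h ≫ D.pr₁) (h ≫ D.pr₂)) {V : D.Y.Opens}
    (hV : IsAffineOpen V) (e₁ : W ≤ (D.pr₁ ≫ D.φ) ⁻¹ᵁ V) (e₂ : W ≤ (D.pr₂ ≫ D.φ) ⁻¹ᵁ V)
    {z : Γ(D.XX, W)} (hz : z ∈ D.I₂.ideal ⟨W, hW⟩) (s : S) (hs : s ∈ S') :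
    S.presheaf.germ S' s hs ((h.appLE W S' e).hom z) ∈ D.pullDifferent (h ≫ D.pr₁) s ^ r := by
  suffices H : D.I₂.ideal ⟨W, hW⟩ ≤ (D.pullDifferent (h ≫ D.pr₁) s ^ r).comap
      ((S.presheaf.germ S' s hs).hom.comp (h.appLE W S' e).hom) from H hz
  rw [D.I₂_ideal hW hV e₁ e₂, Ideal.span_le]
  rintro _ ⟨b, rfl⟩
  have h₁ : (h ≫ D.pr₁ ≫ D.φ) s ∈ V := e₁ (e hs)
  have h₂ : (h ≫ D.pr₂ ≫ D.φ) s ∈ V := e₂ (e hs)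
  have key := hq.sub_mem' s V h₁ h₂ b
  simp_rw [Category.assoc] at key
  rw [pullGerm_comp_eq_germ h (D.pr₁ ≫ D.φ) e₁ e hs, pullGerm_comp_eq_germ h (D.pr₂ ≫ D.φ) e₂ e hs,
    ← map_sub, ← map_sub] at key
  exact key

end Ideals

/-- A pair of close morphisms comes from a morphism to `Γ_r`, if the preimage of the étale locus is
schematically dense. -/
lemma Close.exists_lift {r : ℕ} {q₁ q₂ : S ⟶ D.X} (hq : D.Close r q₁ q₂) (hg : Good q₁)
    (hk : q₁ ≫ D.pX = q₂ ≫ D.pX) : ∃ t : S ⟶ D.Γ r, t ≫ D.p₁ r = q₁ ∧ t ≫ D.p₂ r = q₂ := by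
  obtain ⟨h, rfl, rfl⟩ : ∃ h : S ⟶ D.XX, h ≫ D.pr₁ = q₁ ∧ h ≫ D.pr₂ = q₂ :=
    ⟨pullback.lift q₁ q₂ hk, pullback.lift_fst _ _ _, pullback.lift_snd _ _ _⟩
  suffices H : ∃ t : S ⟶ D.Γ r, t ≫ D.π r = h by
    obtain ⟨t, ht⟩ := H
    exact ⟨t, by rw [p₁, ← Category.assoc, ht], by rw [p₂, ← Category.assoc, ht]⟩
  set O : S.Opens := (h ≫ D.pr₁) ⁻¹ᵁ etaleLocus D.φ with hO
  have : IsSchemeTheoreticallyDominant O.ι := hg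
  have hOUU : O = h ⁻¹ᵁ D.UU := by
    rw [UU, Scheme.Hom.preimage_inf, ← Scheme.Hom.comp_preimage, ← Scheme.Hom.comp_preimage,
      ← hq.preimage_etaleLocus_eq, inf_idem]
  let a : O.toScheme ⟶ D.UU.toScheme := IsOpenImmersion.lift D.j (O.ι ≫ h) (by
    rintro _ ⟨x, rfl⟩
    rw [Scheme.Opens.range_ι]
    exact hOUU.le x.2)
  have ha : O.ι ≫ h = a ≫ D.j := (IsOpenImmersion.lift_fac _ _ _).symm
  refine (D.family r).exists_relSpec_lift h O.ι a ha fun s ↦ ?_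
  -- on the étale locus every function extends; elsewhere divisibility of the pullbacks is used
  by_cases hs : s ∈ O
  · obtain ⟨W, hW, hsW, -⟩ := exists_isAffineOpen_mem_and_subset (U := ⊤) (x := h s) trivial
    refine ⟨⟨W, hW⟩, O ⊓ h ⁻¹ᵁ W, ⟨hs, hsW⟩, inf_le_right, ?_, fun f _ ↦ ?_⟩
    · rw [← Scheme.Hom.comp_preimage, ← ha, Scheme.Hom.comp_preimage]
      exact O.ι.preimage_mono inf_le_right
    · have : IsIso (O.ι.app (O ⊓ h ⁻¹ᵁ W)) := O.ι.isIso_app _ (by simp)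
      exact (ConcreteCategory.bijective_of_isIso (O.ι.app (O ⊓ h ⁻¹ᵁ W))).2 _
  · have hs₁ : (h ≫ D.pr₁) s = (h ≫ D.pr₂) s :=
      (hq.eq_top_or s).resolve_left fun h ↦ hs ((pullDifferent_eq_top_iff _ _).mp h)
    have hs₁' : D.pr₁ (h s) = D.pr₂ (h s) := hs₁
    obtain ⟨c, hc⟩ := D.exists_chart (D.pr₁ (h s))
    have hc' : D.pr₂ (h s) ∈ c.V := by rw [← hs₁']; exact hc
    obtain ⟨W, hW, hsW, hWV⟩ := exists_isAffineOpen_mem_and_subset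
      (U := D.pr₁ ⁻¹ᵁ c.V ⊓ D.pr₂ ⁻¹ᵁ c.V) (x := h s) ⟨hc, hc'⟩
    obtain ⟨S', hS', hsS', hSW⟩ := exists_isAffineOpen_mem_and_subset (U := h ⁻¹ᵁ W) (x := s) hsW
    have e₁ : W ≤ D.pr₁ ⁻¹ᵁ c.V := hWV.trans inf_le_left
    have e₂ : W ≤ D.pr₂ ⁻¹ᵁ c.V := hWV.trans inf_le_right
    have e₁' : W ≤ (D.pr₁ ≫ D.φ) ⁻¹ᵁ c.Y' := e₁.trans (D.pr₁.preimage_mono c.le)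
    have e₂' : W ≤ (D.pr₂ ≫ D.φ) ⁻¹ᵁ c.Y' := e₂.trans (D.pr₂.preimage_mono c.le)
    have e' : O.ι ⁻¹ᵁ S' ≤ a ⁻¹ᵁ (D.j ⁻¹ᵁ W) := by
      rw [← Scheme.Hom.comp_preimage, ← ha, Scheme.Hom.comp_preimage]
      exact O.ι.preimage_mono hSW
    -- on `S'` the preimage of the different has the same equation via both projections
    have hd₁ (t) (ht : t ∈ S') : D.pullDifferent (h ≫ D.pr₁) t = Ideal.span
        {S.presheaf.germ S' t ht ((h.appLE W S' hSW).hom ((D.pr₁.appLE c.V W e₁).hom c.g))} := by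
      have h₁ : (h ≫ D.pr₁) t ∈ c.V := e₁ (hSW ht)
      rw [c.pullDifferent_eq _ h₁, pullGerm_comp_eq_germ h D.pr₁ e₁ hSW ht]
    have hd₂ (t) (ht : t ∈ S') : D.pullDifferent (h ≫ D.pr₁) t = Ideal.span
        {S.presheaf.germ S' t ht ((h.appLE W S' hSW).hom ((D.pr₂.appLE c.V W e₂).hom c.g))} := by
      have h₂ : (h ≫ D.pr₂) t ∈ c.V := e₂ (hSW ht)
      rw [hq.pullDifferent_eq, c.pullDifferent_eq _ h₂, pullGerm_comp_eq_germ h D.pr₂ e₂ hSW ht]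
    have hI₁ := fun z hz ↦ germ_mem_of_mem_I₁ hW hSW hq c.isAffineOpen_V e₁ e₂ (z := z) hz
    have hI₂ := fun z hz ↦ germ_mem_of_mem_I₂ hW hSW hq c.isAffineOpen_Y' e₁' e₂' (z := z) hz
    refine ⟨⟨W, hW⟩, S', hsS', hSW, e', fun f hf ↦ ?_⟩
    rcases hf with (hf | hf) | (hf | hf)
    · exact c.exists_app_eq D.pr₁_j_mem D.D₁_fg (r - 1) ha hW e₁ hSW e' (fun z hz ↦
        mem_span_pow_of_germ hS' _ _ _ fun t ht ↦ hd₁ t ht ▸ hI₁ z hz t ht) hf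
    · exact c.exists_app_eq D.pr₁_j_mem D.D₁_fg r ha hW e₁ hSW e' (fun z hz ↦
        mem_span_pow_of_germ hS' _ _ _ fun t ht ↦ hd₁ t ht ▸ hI₂ z hz t ht) hf
    · exact c.exists_app_eq D.pr₂_j_mem D.D₂_fg (r - 1) ha hW e₂ hSW e' (fun z hz ↦
        mem_span_pow_of_germ hS' _ _ _ fun t ht ↦ hd₂ t ht ▸ hI₁ z hz t ht) hf
    · exact c.exists_app_eq D.pr₂_j_mem D.D₂_fg r ha hW e₂ hSW e' (fun z hz ↦
        mem_span_pow_of_germ hS' _ _ _ fun t ht ↦ hd₂ t ht ▸ hI₂ z hz t ht) hf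

end NewtonSetting

end Newton

/-! ### The projections of `Γ_r` are close -/

namespace Newton

namespace NewtonSetting

variable {k : Type u} [Field k] {D : NewtonSetting k}

lemma Chart.germ_mem {U Z : Scheme.{u}} {ν : U ⟶ Z} {q : Z ⟶ D.X} [QuasiCompact ν]
    [QuasiSeparated ν] (c : Chart D) (hq : ∀ u, q (ν u) ∈ etaleLocus D.φ)
    (A : QCSubalgebra ν) {I : Z.IdealSheafData} (hJ : ∀ W, ((D.IΔ.comap q).ideal W).FG) (n : ℕ)
    (hA : ∀ W, (twist (ν := ν) I (D.IΔ.comap q) hJ n).carrier W ⊆ A.ring W) {W : Z.Opens}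
    (hW : IsAffineOpen W) (h : W ≤ q ⁻¹ᵁ c.V) {i : Γ(Z, W)} (hi : i ∈ I.ideal ⟨W, hW⟩)
    {x : A.relSpec} (hx : x ∈ A.toBase ⁻¹ᵁ W) :
    A.relSpec.presheaf.germ (A.toBase ⁻¹ᵁ W) x hx ((A.toBase.appLE W _ le_rfl).hom i) ∈
      D.pullDifferent (A.toBase ≫ q) x ^ n := by
  have e : A.toBase ⁻¹ᵁ W ≤ (A.toBase ≫ q) ⁻¹ᵁ c.V := A.toBase.preimage_mono h
  obtain ⟨ρ, hρ⟩ := c.exists_pow_mul_eq hq A hJ n hA hW h e hi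
  have hxV : (A.toBase ≫ q) x ∈ c.V := e hx
  rw [← hρ, map_mul, map_pow, c.pullDifferent_eq _ hxV, pullGerm_eq_germ _ e hx]
  exact Ideal.mul_mem_right _ _ (Ideal.pow_mem_pow (Ideal.mem_span_singleton_self _) n)

lemma exists_I₁_ideal_eq_top (z : D.XX) (hz : z ∉ Set.range (pullback.diagonal D.pX))
    {O : D.XX.Opens} (hO : z ∈ O) : ∃ (W : D.XX.Opens) (hW : IsAffineOpen W), z ∈ W ∧ W ≤ O ∧
      D.I₁.ideal ⟨W, hW⟩ = ⊤ := by
  have := D.isSeparated_X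
  let O' : D.XX.Opens := ⟨(Set.range (pullback.diagonal D.pX))ᶜ,
    (pullback.diagonal D.pX).isClosedEmbedding.isClosed_range.isOpen_compl⟩
  obtain ⟨W, hW, hzW, hle⟩ := exists_isAffineOpen_mem_and_subset (U := O ⊓ O') (x := z) ⟨hO, hz⟩
  refine ⟨W, hW, hzW, hle.trans inf_le_left, ?_⟩
  rw [I₁, Scheme.Hom.ker_apply, Ideal.eq_top_iff_one, RingHom.mem_ker]
  have hbot : (pullback.diagonal D.pX) ⁻¹ᵁ W = ⊥ := by
    ext x
    simp only [TopologicalSpace.Opens.coe_bot, Set.mem_empty_iff_false, iff_false]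
    exact fun hx ↦ (hle hx).2 ⟨x, rfl⟩
  have : Subsingleton Γ(D.X, (pullback.diagonal D.pX) ⁻¹ᵁ W) := by rw [hbot]; infer_instance
  exact Subsingleton.elim _ _

section

variable {r : ℕ} {W : D.XX.Opens} (hW : IsAffineOpen W) {c : Chart D} {x : D.Γ r}
  (hx : x ∈ D.π r ⁻¹ᵁ W)

/-- The image in the stalk of `Γ_r` of a function on an open subset of `X × X`. -/
noncomputable def πGerm (r : ℕ) {x : D.Γ r} {W : D.XX.Opens} (hx : x ∈ D.π r ⁻¹ᵁ W) :
    Γ(D.XX, W) →+* (D.Γ r).presheaf.stalk x :=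
  ((D.Γ r).presheaf.germ (D.π r ⁻¹ᵁ W) x hx).hom.comp ((D.π r).appLE W _ le_rfl).hom

lemma πGerm_mem_p₁_of_mem_I₁ (h : W ≤ D.pr₁ ⁻¹ᵁ c.V) {z : Γ(D.XX, W)}
    (hz : z ∈ D.I₁.ideal ⟨W, hW⟩) : πGerm r hx z ∈ D.pullDifferent (D.p₁ r) x ^ (r - 1) :=
  c.germ_mem D.pr₁_j_mem (D.𝒜 r) D.D₁_fg (r - 1)
    (fun W _ hf ↦ subset_ring_𝒜 r W (.inl (.inl hf))) hW h hz hx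

lemma πGerm_mem_p₁_of_mem_I₂ (h : W ≤ D.pr₁ ⁻¹ᵁ c.V) {z : Γ(D.XX, W)}
    (hz : z ∈ D.I₂.ideal ⟨W, hW⟩) : πGerm r hx z ∈ D.pullDifferent (D.p₁ r) x ^ r :=
  c.germ_mem D.pr₁_j_mem (D.𝒜 r) D.D₁_fg r
    (fun W _ hf ↦ subset_ring_𝒜 r W (.inl (.inr hf))) hW h hz hx

lemma πGerm_mem_p₂_of_mem_I₁ (h : W ≤ D.pr₂ ⁻¹ᵁ c.V) {z : Γ(D.XX, W)}
    (hz : z ∈ D.I₁.ideal ⟨W, hW⟩) : πGerm r hx z ∈ D.pullDifferent (D.p₂ r) x ^ (r - 1) :=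
  c.germ_mem D.pr₂_j_mem (D.𝒜 r) D.D₂_fg (r - 1)
    (fun W _ hf ↦ subset_ring_𝒜 r W (.inr (.inl hf))) hW h hz hx

end

/-- The restrictions of the two projections of `X × X` to the diagonal agree. -/
lemma pr₁_eq_pr₂_of_mem_range {z : D.XX} (hz : z ∈ Set.range (pullback.diagonal D.pX)) :
    D.pr₁ z = D.pr₂ z := by
  obtain ⟨x, rfl⟩ := hz
  rw [← Scheme.Hom.comp_apply, ← Scheme.Hom.comp_apply, pullback.diagonal_fst,
    pullback.diagonal_snd]

/-- The twists `I₁((r - 1)D)` and `I₂(rD)` in `𝒜_r` make the elements of `I₁` and `I₂` divisible by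
the powers of the equation of the different that occur in the definition of closeness. The preimages
of the different agree because `r - 1 ≥ 1`: then the two pullbacks of its equation differ by a
multiple of either of them. -/
lemma close_p₁_p₂ {r : ℕ} (hr : 2 ≤ r) : D.Close r (D.p₁ r) (D.p₂ r) := by
  -- away from the diagonal both projections meet the étale locus
  have key₁ (x : D.Γ r) (hx : D.π r x ∉ Set.range (pullback.diagonal D.pX)) :
      D.pullDifferent (D.p₁ r) x = ⊤ ∧ D.pullDifferent (D.p₂ r) x = ⊤ := by
    have aux {q : D.Γ r ⟶ D.X} (h : 1 ∈ D.pullDifferent q x ^ (r - 1)) :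
        D.pullDifferent q x = ⊤ :=
      (Ideal.eq_top_iff_one _).mpr (Ideal.pow_le_self (by omega) h)
    obtain ⟨c, hc⟩ := D.exists_chart (D.pr₁ (D.π r x))
    obtain ⟨c', hc'⟩ := D.exists_chart (D.pr₂ (D.π r x))
    obtain ⟨W, hW, hxW, hle, htop⟩ := exists_I₁_ideal_eq_top (D.π r x) hx
      (O := D.pr₁ ⁻¹ᵁ c.V ⊓ D.pr₂ ⁻¹ᵁ c'.V) ⟨hc, hc'⟩
    have h1 : (1 : Γ(D.XX, W)) ∈ D.I₁.ideal ⟨W, hW⟩ := htop ▸ Submodule.mem_top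
    have e1 : πGerm r (x := x) hxW 1 = 1 := map_one _
    exact ⟨aux (e1 ▸ πGerm_mem_p₁_of_mem_I₁ hW hxW (hle.trans inf_le_left) h1),
      aux (e1 ▸ πGerm_mem_p₂_of_mem_I₁ hW hxW (hle.trans inf_le_right) h1)⟩
  have key₂ (x : D.Γ r) (hx : D.π r x ∈ Set.range (pullback.diagonal D.pX)) :
      D.p₁ r x = D.p₂ r x := pr₁_eq_pr₂_of_mem_range hx
  -- differences of pullbacks of functions on `X` are divisible on `Γ_r`
  have key₃ (x : D.Γ r) (hx : D.π r x ∈ Set.range (pullback.diagonal D.pX)) (V : D.X.Opens)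
      (h₁ : D.p₁ r x ∈ V) (h₂ : D.p₂ r x ∈ V) (b : Γ(D.X, V)) :
      pullGerm (D.p₁ r) x h₁ b - pullGerm (D.p₂ r) x h₂ b ∈ D.pullDifferent (D.p₁ r) x ^ (r - 1) ∧
      pullGerm (D.p₁ r) x h₁ b - pullGerm (D.p₂ r) x h₂ b ∈
        D.pullDifferent (D.p₂ r) x ^ (r - 1) := by
    have hz := pr₁_eq_pr₂_of_mem_range hx
    obtain ⟨c, hc⟩ := D.exists_chart (D.pr₁ (D.π r x))
    obtain ⟨V', hV', hxV', hle⟩ := exists_isAffineOpen_mem_and_subset (U := V ⊓ c.V)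
      (x := D.pr₁ (D.π r x)) ⟨h₁, hc⟩
    have hxV'' : D.pr₂ (D.π r x) ∈ V' := hz ▸ hxV'
    obtain ⟨W, hW, hxW, hWle⟩ := exists_isAffineOpen_mem_and_subset
      (U := D.pr₁ ⁻¹ᵁ V' ⊓ D.pr₂ ⁻¹ᵁ V') (x := D.π r x) ⟨hxV', hxV''⟩
    have e₁ : W ≤ D.pr₁ ⁻¹ᵁ V' := hWle.trans inf_le_left
    have e₂ : W ≤ D.pr₂ ⁻¹ᵁ V' := hWle.trans inf_le_right
    set b' := (D.X.presheaf.map (homOfLE (hle.trans inf_le_left)).op).hom b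
    have hmem : (D.pr₁.appLE V' W e₁).hom b' - (D.pr₂.appLE V' W e₂).hom b' ∈
        D.I₁.ideal ⟨W, hW⟩ := by
      rw [D.I₁_ideal hW hV' e₁ e₂]; exact Ideal.subset_span ⟨b', rfl⟩
    have hb : pullGerm (D.p₁ r) x h₁ b - pullGerm (D.p₂ r) x h₂ b = πGerm r (x := x) hxW
        ((D.pr₁.appLE V' W e₁).hom b' - (D.pr₂.appLE V' W e₂).hom b') := by
      rw [← pullGerm_res (D.p₁ r) x (hle.trans inf_le_left) hxV' h₁ b,
        ← pullGerm_res (D.p₂ r) x (hle.trans inf_le_left) hxV'' h₂ b, map_sub]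
      exact congrArg₂ (· - ·) (pullGerm_comp_eq_germ (D.π r) D.pr₁ e₁ le_rfl hxW hxV' b')
        (pullGerm_comp_eq_germ (D.π r) D.pr₂ e₂ le_rfl hxW hxV'' b')
    rw [hb]
    have hVc : V' ≤ c.V := hle.trans inf_le_right
    exact ⟨πGerm_mem_p₁_of_mem_I₁ hW hxW (e₁.trans (D.pr₁.preimage_mono hVc)) hmem,
      πGerm_mem_p₂_of_mem_I₁ hW hxW (e₂.trans (D.pr₂.preimage_mono hVc)) hmem⟩
  refine ⟨fun x ↦ ?_, fun x ↦ ?_, fun x V h₁ h₂ b ↦ ?_, fun x V h₁ h₂ a ↦ ?_⟩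
  · by_cases hx : D.π r x ∈ Set.range (pullback.diagonal D.pX)
    · obtain ⟨c, hc⟩ := D.exists_chart (D.p₁ r x)
      have hc' : D.p₂ r x ∈ c.V := key₂ x hx ▸ hc
      obtain ⟨h1, h2⟩ := key₃ x hx c.V hc hc' c.g
      have hd₁ := c.pullDifferent_eq (D.p₁ r) hc
      have hd₂ := c.pullDifferent_eq (D.p₂ r) hc'
      replace h1 := Ideal.pow_le_self (by omega) h1
      replace h2 := Ideal.pow_le_self (by omega) h2
      apply le_antisymm
      · rw [hd₁, Ideal.span_singleton_le_iff_mem,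
          ← sub_add_cancel (pullGerm (D.p₁ r) x hc c.g) (pullGerm (D.p₂ r) x hc' c.g)]
        exact add_mem h2 (hd₂ ▸ Ideal.mem_span_singleton_self _)
      · rw [hd₂, Ideal.span_singleton_le_iff_mem,
          ← sub_sub_cancel (pullGerm (D.p₁ r) x hc c.g) (pullGerm (D.p₂ r) x hc' c.g)]
        exact sub_mem (hd₁ ▸ Ideal.mem_span_singleton_self _) h1
    · rw [(key₁ x hx).1, (key₁ x hx).2]
  · by_cases hx : D.π r x ∈ Set.range (pullback.diagonal D.pX)
    · exact .inr (key₂ x hx)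
    · exact .inl (key₁ x hx).1
  · by_cases hx : D.π r x ∈ Set.range (pullback.diagonal D.pX)
    · exact (key₃ x hx V h₁ h₂ b).1
    · rw [(key₁ x hx).1, Ideal.top_pow]; trivial
  · by_cases hx : D.π r x ∈ Set.range (pullback.diagonal D.pX)
    · have hz := pr₁_eq_pr₂_of_mem_range hx
      obtain ⟨c, hc⟩ := D.exists_chart (D.pr₁ (D.π r x))
      have hc' : D.pr₂ (D.π r x) ∈ c.V := hz ▸ hc
      obtain ⟨V', hV', hxV', hle⟩ := exists_isAffineOpen_mem_and_subset (U := V)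
        (x := D.φ (D.pr₁ (D.π r x))) h₁
      have hxV'' : D.φ (D.pr₂ (D.π r x)) ∈ V' := hz ▸ hxV'
      obtain ⟨W, hW, hxW, hWle⟩ := exists_isAffineOpen_mem_and_subset
        (U := ((D.pr₁ ≫ D.φ) ⁻¹ᵁ V' ⊓ (D.pr₂ ≫ D.φ) ⁻¹ᵁ V') ⊓ D.pr₁ ⁻¹ᵁ c.V) (x := D.π r x)
        ⟨⟨hxV', hxV''⟩, hc⟩
      have e₁ : W ≤ (D.pr₁ ≫ D.φ) ⁻¹ᵁ V' := (hWle.trans inf_le_left).trans inf_le_left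
      have e₂ : W ≤ (D.pr₂ ≫ D.φ) ⁻¹ᵁ V' := (hWle.trans inf_le_left).trans inf_le_right
      set a' := (D.Y.presheaf.map (homOfLE hle).op).hom a
      have hmem : ((D.pr₁ ≫ D.φ).appLE V' W e₁).hom a' - ((D.pr₂ ≫ D.φ).appLE V' W e₂).hom a' ∈
          D.I₂.ideal ⟨W, hW⟩ := by
        rw [D.I₂_ideal hW hV' e₁ e₂]; exact Ideal.subset_span ⟨a', rfl⟩
      have hb : pullGerm (D.p₁ r ≫ D.φ) x h₁ a - pullGerm (D.p₂ r ≫ D.φ) x h₂ a =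
          πGerm r (x := x) hxW
            (((D.pr₁ ≫ D.φ).appLE V' W e₁).hom a' - ((D.pr₂ ≫ D.φ).appLE V' W e₂).hom a') := by
        rw [← pullGerm_res (D.p₁ r ≫ D.φ) x hle hxV' h₁ a,
          ← pullGerm_res (D.p₂ r ≫ D.φ) x hle hxV'' h₂ a, map_sub]
        exact congrArg₂ (· - ·)
          (pullGerm_comp_eq_germ (D.π r) (D.pr₁ ≫ D.φ) e₁ le_rfl hxW hxV' a')
          (pullGerm_comp_eq_germ (D.π r) (D.pr₂ ≫ D.φ) e₂ le_rfl hxW hxV'' a')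
      rw [hb]
      exact πGerm_mem_p₁_of_mem_I₂ hW hxW (hWle.trans inf_le_right) hmem
    · rw [(key₁ x hx).1, Ideal.top_pow]; trivial

end NewtonSetting

end Newton

/-! ### The Newton equations -/

namespace Newton

open MvPolynomial in
/-- First order Taylor expansion, together with the expansion of the partial derivatives. -/
lemma exists_taylor {k A n : Type*} [CommRing k] [CommRing A] [Fintype n] [DecidableEq n]
    (c : k →+* A) (x : n → A) (τ : A) (p : MvPolynomial n k) : ∃ q : MvPolynomial n A,
    eval₂Hom (C.comp c) (fun i ↦ C (x i) + C τ * X i) p = C (eval₂Hom c x p) +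
      C τ * ∑ j, C (eval₂Hom c x (pderiv j p)) * X j + C τ ^ 2 * q ∧
    ∀ l, eval₂Hom (C.comp c) (fun i ↦ C (x i) + C τ * X i) (pderiv l p) =
      C (eval₂Hom c x (pderiv l p)) + C τ * pderiv l q := by
  induction p using MvPolynomial.induction_on with
  | C a => exact ⟨0, by simp, by simp⟩
  | add p p' hp hp' =>
    obtain ⟨q, hq, hq'⟩ := hp
    obtain ⟨q', hq₂, hq₂'⟩ := hp'
    refine ⟨q + q', ?_, fun l ↦ ?_⟩
    · simp only [map_add, hq, hq₂, add_mul, Finset.sum_add_distrib]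
      ring
    · simp only [map_add, hq', hq₂']
      ring
  | mul_X p i hp =>
    obtain ⟨q, hq, hq'⟩ := hp
    set s := ∑ j, C (eval₂Hom c x (pderiv j p)) * (X j : MvPolynomial n A) with hs
    refine ⟨q * C (x i) + C τ * q * X i + s * X i, ?_, fun l ↦ ?_⟩
    · have : ∑ j, C (eval₂Hom c x (pderiv j (p * X i))) * (X j : MvPolynomial n A) =
          s * C (x i) + C (eval₂Hom c x p) * X i := by
        simp only [Derivation.leibniz, smul_eq_mul, map_add, map_mul, add_mul,
          Finset.sum_add_distrib, pderiv_X, hs, Finset.sum_mul, eval₂Hom_X']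
        rw [add_comm]
        congr 1
        · exact Finset.sum_congr rfl fun j _ ↦ by ring
        · rw [Finset.sum_eq_single i]
          · simp
          · intro j _ hj; simp [Pi.single_eq_of_ne' hj]
          · simp
      rw [this]
      simp only [map_mul, hq, eval₂Hom_X']
      ring
    · have hds : pderiv l s = C (eval₂Hom c x (pderiv l p)) := by
        rw [hs, map_sum, Finset.sum_eq_single l]
        · simp
        · intro j _ hj; simp [pderiv_X, Pi.single_eq_of_ne hj]
        · simp
      rcases eq_or_ne l i with rfl | hl
      · simp only [Derivation.leibniz, smul_eq_mul, map_add, map_mul, hq, hq', hds, eval₂Hom_X',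
          pderiv_X_self, pderiv_C, map_one]
        ring
      · simp only [Derivation.leibniz, smul_eq_mul, map_add, map_mul, hq, hq', hds, eval₂Hom_X',
          pderiv_X_of_ne hl.symm, pderiv_C, map_zero]
        ring

section NewtonAlgebra

variable {k A n : Type*} [CommRing k] [CommRing A] [Fintype n] [DecidableEq n] (c : k →+* A)
  (x : n → A) (τ : A)

/-- The remainder of second order in the Taylor expansion of `p (x + τ X)`. -/
noncomputable def taylorRem (p : MvPolynomial n k) : MvPolynomial n A :=
  (exists_taylor c x τ p).choose

/-- Evaluation at `x + τ X`. -/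
noncomputable def evalShift : MvPolynomial n k →+* MvPolynomial n A :=
  MvPolynomial.eval₂Hom (MvPolynomial.C.comp c)
    (fun i ↦ MvPolynomial.C (x i) + MvPolynomial.C τ * MvPolynomial.X i)

open MvPolynomial

lemma evalShift_eq (p : MvPolynomial n k) : evalShift c x τ p = C (eval₂Hom c x p) +
    C τ * ∑ j, C (eval₂Hom c x (pderiv j p)) * X j + C τ ^ 2 * taylorRem c x τ p :=
  (exists_taylor c x τ p).choose_spec.1

lemma evalShift_pderiv (p : MvPolynomial n k) (l : n) : evalShift c x τ (pderiv l p) =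
    C (eval₂Hom c x (pderiv l p)) + C τ * pderiv l (taylorRem c x τ p) :=
  (exists_taylor c x τ p).choose_spec.2 l

variable (F : n → MvPolynomial n k) (h : A) (w : n → A)

/-- The Jacobian matrix of `F` at the point `x`. -/
noncomputable abbrev jac : Matrix n n A := (jacobiMat F).map (eval₂Hom c x)

/-- The equations for the vector `u` in a solution `x + τ u` of `F (x + τ u) = F x + τ g w`, where
`g` is the Jacobian determinant at `x` and `τ = g h`. Taylor expansion gives
`J u + τ R(u) = g w`, and multiplication by the adjugate of the Jacobian matrix `J` and division by
`g` give `u = adj(J) (w - h R(u))`, as in Newton's method. -/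
noncomputable def newtonRel (i : n) : MvPolynomial n A :=
  X i - ∑ j, C ((jac c x F).adjugate i j) * (C (w j) - C h * taylorRem c x τ (F j))

/-- The Jacobian matrix of the Newton equations. -/
noncomputable def newtonMat : Matrix n n (MvPolynomial n A) :=
  1 + (C h : MvPolynomial n A) • ((jac c x F).adjugate.map C *
    Matrix.of fun j l ↦ pderiv l (taylorRem c x τ (F j)))

lemma pderiv_newtonRel (i l : n) :
    pderiv l (newtonRel c x τ F h w i) = newtonMat c x τ F h i l := by
  have hX : pderiv l (X i : MvPolynomial n A) = (1 : Matrix n n (MvPolynomial n A)) i l := by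
    rcases eq_or_ne i l with rfl | hl
    · simp
    · rw [pderiv_X_of_ne hl, Matrix.one_apply_ne hl]
  rw [newtonRel, map_sub, hX, map_sum, newtonMat, Matrix.add_apply, sub_eq_add_neg,
    ← Finset.sum_neg_distrib, Matrix.smul_apply, Matrix.mul_apply, smul_eq_mul, Finset.mul_sum]
  refine congrArg _ (Finset.sum_congr rfl fun j _ ↦ ?_)
  simp only [Matrix.map_apply, Matrix.of_apply, Derivation.leibniz, map_sub, pderiv_C, smul_eq_mul,
    mul_zero, add_zero, zero_sub]
  ring

lemma map_mul_map_adjugate : (jac c x F).map C * (jac c x F).adjugate.map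
    (C : A →+* MvPolynomial n A) = (C (jac c x F).det : MvPolynomial n A) •
      (1 : Matrix n n (MvPolynomial n A)) := by
  rw [← Matrix.map_mul, Matrix.mul_adjugate]
  ext i j : 2
  by_cases hij : i = j
  · subst hij; simp
  · simp [Matrix.one_apply_ne hij]

/-- The Jacobian at the shifted point is divisible by the Jacobian at the original point. -/
lemma evalShift_det (hτ : τ = (jac c x F).det * h) :
    evalShift c x τ (jacobiMat F).det = C (jac c x F).det * (newtonMat c x τ F h).det := by
  have h1 : (jacobiMat F).map (evalShift c x τ) = (jac c x F).map C * newtonMat c x τ F h := by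
    rw [newtonMat, mul_add, mul_one, Matrix.mul_smul, ← mul_assoc, map_mul_map_adjugate]
    ext i l : 2
    simp only [Matrix.map_apply, jacobiMat, Matrix.of_apply, Matrix.add_apply, Matrix.smul_apply,
      Matrix.smul_mul, one_mul, smul_eq_mul]
    rw [evalShift_pderiv, hτ, map_mul]
    ring_nf
  have h3 := congrArg Matrix.det h1
  rw [Matrix.det_mul] at h3
  have h4 := RingHom.map_det (evalShift c x τ) (jacobiMat F)
  have h5 := RingHom.map_det (C : A →+* MvPolynomial n A) (jac c x F)
  simp only [RingHom.mapMatrix_apply] at h4 h5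
  rw [h4, h5]
  exact h3

/-- The values of `F` at the shifted point, in terms of the Newton equations. -/
lemma evalShift_apply (hτ : τ = (jac c x F).det * h) (i : n) :
    evalShift c x τ (F i) = C (eval₂Hom c x (F i)) + C (τ * (jac c x F).det * w i) +
      C τ * ∑ j, C (jac c x F i j) * newtonRel c x τ F h w j := by
  have h1 : ∑ j, C (jac c x F i j) * newtonRel c x τ F h w j =
      ∑ j, C (jac c x F i j) * X j -
        C (jac c x F).det * (C (w i) - C h * taylorRem c x τ (F i)) := by
    have h2 := congrFun (congrArg (Matrix.mulVec · fun l ↦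
      (C (w l) - C h * taylorRem c x τ (F l) : MvPolynomial n A)) (map_mul_map_adjugate c x F)) i
    rw [← Matrix.mulVec_mulVec, Matrix.smul_mulVec, Matrix.one_mulVec] at h2
    simp only [Matrix.mulVec, dotProduct, Matrix.map_apply, Pi.smul_apply, smul_eq_mul] at h2
    simp only [newtonRel, mul_sub, Finset.sum_sub_distrib, ← h2, Matrix.map_apply]
  rw [h1, evalShift_eq]
  simp only [Matrix.map_apply, jacobiMat, Matrix.of_apply]
  rw [hτ]
  simp only [map_mul]
  ring

end NewtonAlgebra

end Newton

/-! ### The universal pair of close ring maps -/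

namespace Newton

open MvPolynomial

section

variable {P : Type*} [CommRing P] {n : Type*} (rel : n → P) (d : P)

/-- The ring obtained from `P` by imposing the relations `rel` and inverting `d`. -/
abbrev SolRing := Localization.Away (Ideal.Quotient.mk (Ideal.span (Set.range rel)) d)

/-- The canonical map to `SolRing`. -/
noncomputable def solMk : P →+* SolRing rel d :=
  (algebraMap (P ⧸ Ideal.span (Set.range rel)) (SolRing rel d)).comp (Ideal.Quotient.mk _)

lemma solMk_rel (i : n) : solMk rel d (rel i) = 0 := by
  have h : Ideal.Quotient.mk (Ideal.span (Set.range rel)) (rel i) = 0 :=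
    Ideal.Quotient.eq_zero_iff_mem.mpr (Ideal.subset_span ⟨i, rfl⟩)
  exact (congrArg (algebraMap _ (SolRing rel d)) h).trans (map_zero _)

lemma isUnit_solMk : IsUnit (solMk rel d d) :=
  IsLocalization.Away.algebraMap_isUnit (Ideal.Quotient.mk (Ideal.span (Set.range rel)) d)

lemma solRing_hom_ext {R : Type*} [CommRing R] {θ θ' : SolRing rel d →+* R}
    (h : θ.comp (solMk rel d) = θ'.comp (solMk rel d)) : θ = θ' :=
  IsLocalization.ringHom_ext (.powers (Ideal.Quotient.mk (Ideal.span (Set.range rel)) d))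
    (Ideal.Quotient.ringHom_ext h)

lemma exists_solRing_lift {R : Type*} [CommRing R]
    (p : P →+* R) (h : ∀ i, p (rel i) = 0)
    (h' : IsUnit (p d)) : ∃ θ : SolRing rel d →+* R, θ.comp (solMk rel d) = p := by
  let q : P ⧸ Ideal.span (Set.range rel) →+* R := Ideal.Quotient.lift _ p fun a ha ↦ by
    have : Ideal.span (Set.range rel) ≤ RingHom.ker p := by
      rw [Ideal.span_le]; rintro _ ⟨i, rfl⟩; exact h i
    exact this ha
  have hq : IsUnit (q (Ideal.Quotient.mk (Ideal.span (Set.range rel)) d)) := h'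
  exact ⟨IsLocalization.Away.lift _ hq, RingHom.ext fun a ↦
    IsLocalization.Away.lift_eq _ hq (Ideal.Quotient.mk _ a)⟩

end

lemma etale_solRing {A : Type*} [CommRing A] {n : Type} [Fintype n] [DecidableEq n]
    (rel : n → MvPolynomial n A) (d : MvPolynomial n A)
    (hd : (Matrix.of fun i j ↦ pderiv j (rel i)).det = d) : Algebra.Etale A (SolRing rel d) := by
  let P : Algebra.PreSubmersivePresentation A (MvPolynomial n A ⧸ Ideal.span (Set.range rel)) n n :=
    .naive (v := rel) id Function.injective_id
  have hJ : P.jacobian = Ideal.Quotient.mk _ d := by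
    rw [P.jacobian_eq_jacobiMatrix_det, ← hd, ← Matrix.det_transpose]
    have : P.jacobiMatrix.transpose = Matrix.of fun i j ↦ pderiv j (rel i) := by
      ext1 i j
      exact Algebra.PreSubmersivePresentation.jacobiMatrix_naive ..
    rw [this]
    rfl
  have : IsLocalization.Away P.jacobian (SolRing rel d) := by
    rw [hJ]; infer_instance
  exact etale_of_isLocalization_away_jacobian P

lemma eval₂Hom_pair {k B : Type*} [CommRing k] [CommRing B] {σ κ : Type}
    (ψ : MvPolynomial (σ ⊕ κ) k →+* B) (p : MvPolynomial (σ ⊕ κ) k) :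
    eval₂Hom (C.comp (ψ.comp C)) (fun i ↦ (C (ψ (X i)) : MvPolynomial κ B)) p = C (ψ p) := by
  have : eval₂Hom (C.comp (ψ.comp C)) (fun i ↦ C (ψ (X i))) = (C : B →+* MvPolynomial κ B).comp ψ :=
    MvPolynomial.ringHom_ext (fun a ↦ by simp) fun i ↦ by simp
  rw [this]; rfl

section

variable {k : Type u} [CommRing k] {B : Type u} [CommRing B] {σ κ : Type} [Fintype σ] [Fintype κ]
  [DecidableEq σ] [DecidableEq κ] (ψ : MvPolynomial (σ ⊕ κ) k →+* B)
  (F : σ ⊕ κ → MvPolynomial (σ ⊕ κ) k) (m : ℕ)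

/-- The relation between ring maps `α, β : B → R` that corresponds to closeness of order `m + 2` on
charts. -/
structure ClosePair {R : Type*} [CommRing R] (α β : B →+* R) : Prop where
  scalars : ∀ a, β (ψ (C a)) = α (ψ (C a))
  coord : ∀ i, ∃ u, β (ψ (X i)) - α (ψ (X i)) = α (ψ (jacobiMat F).det) ^ (m + 1) * u
  comp : ∀ l, ∃ v, β (ψ (F (.inr l))) - α (ψ (F (.inr l))) = α (ψ (jacobiMat F).det) ^ (m + 2) * v
  unit : ∃ δ, IsUnit δ ∧ β (ψ (jacobiMat F).det) = α (ψ (jacobiMat F).det) * δ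

/-- The scalars in `B[v]`. -/
noncomputable abbrev pairC : k →+* MvPolynomial κ B := C.comp (ψ.comp C)

/-- The coordinates of `B`, as elements of `B[v]`. -/
noncomputable abbrev pairX (i : σ ⊕ κ) : MvPolynomial κ B := C (ψ (X i))

/-- The Jacobian determinant, as an element of `B[v]`. -/
noncomputable abbrev pairG : MvPolynomial κ B := C (ψ (jacobiMat F).det)

/-- The equations for the difference quotients `u` at the universal point of `B[v]`. -/
noncomputable abbrev pairRel : σ ⊕ κ → MvPolynomial (σ ⊕ κ) (MvPolynomial κ B) :=
  newtonRel (pairC ψ) (pairX ψ) (pairG ψ F ^ (m + 1)) F (pairG ψ F ^ m) (Sum.elim (fun _ ↦ 0) X)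

/-- The Jacobian determinant of `pairRel`. -/
noncomputable abbrev pairDet : MvPolynomial (σ ⊕ κ) (MvPolynomial κ B) :=
  (newtonMat (pairC ψ) (pairX ψ) (pairG ψ F ^ (m + 1)) F (pairG ψ F ^ m)).det

/-- Evaluation at the shifted point `x + g ^ (m + 1) u`. -/
noncomputable abbrev pairShift :
    MvPolynomial (σ ⊕ κ) k →+* MvPolynomial (σ ⊕ κ) (MvPolynomial κ B) :=
  evalShift (pairC ψ) (pairX ψ) (pairG ψ F ^ (m + 1))

lemma det_jac_pair : (jac (pairC ψ) (pairX ψ) F).det = pairG ψ F := by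
  have := RingHom.map_det (eval₂Hom (pairC ψ) (pairX (κ := κ) ψ)) (jacobiMat F)
  rw [RingHom.mapMatrix_apply] at this
  rw [← this, eval₂Hom_pair]

lemma pairG_pow : pairG ψ F ^ (m + 1) = (jac (pairC ψ) (pairX ψ) F).det * pairG ψ F ^ m := by
  rw [det_jac_pair]; ring

lemma pairShift_det : pairShift ψ F m (jacobiMat F).det = C (pairG ψ F) * pairDet ψ F m := by
  rw [pairShift, evalShift_det _ _ _ _ _ (pairG_pow ψ F m), det_jac_pair]

lemma pairShift_X (i : σ ⊕ κ) :
    pairShift ψ F m (X i) = C (C (ψ (X i))) + C (pairG ψ F) ^ (m + 1) * X i := by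
  simp [pairShift, evalShift]

lemma pairShift_C (a : k) : pairShift ψ F m (C a) = C (C (ψ (C a))) := by
  simp [pairShift, evalShift]

lemma pairShift_apply (i : σ ⊕ κ) : pairShift ψ F m (F i) = C (C (ψ (F i))) +
    C (pairG ψ F) ^ (m + 2) * C (Sum.elim (fun _ ↦ 0) X i) +
    C (pairG ψ F) ^ (m + 1) * ∑ j, C (jac (pairC ψ) (pairX ψ) F i j) * pairRel ψ F m j := by
  rw [pairShift, evalShift_apply _ _ _ _ _ (Sum.elim (fun _ ↦ 0) X) (pairG_pow ψ F m),
    eval₂Hom_pair, det_jac_pair]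
  simp only [map_mul, map_pow]
  ring

/-- The ring that carries the universal close pair: the Newton equations, with their Jacobian
determinant inverted. -/
abbrev PairRing : Type u := SolRing (pairRel ψ F m) (pairDet ψ F m)

/-- The solution of the Newton equations in `PairRing`. -/
noncomputable abbrev pairMk : MvPolynomial (σ ⊕ κ) (MvPolynomial κ B) →+* PairRing ψ F m :=
  solMk (pairRel ψ F m) (pairDet ψ F m)

lemma pairMk_pairRel (i : σ ⊕ κ) : pairMk ψ F m (pairRel ψ F m i) = 0 := solMk_rel _ _ i

lemma etale_pairRing : Algebra.Etale (MvPolynomial κ B) (PairRing ψ F m) := by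
  refine etale_solRing _ _ (congrArg Matrix.det (Matrix.ext fun i l ↦ ?_))
  exact pderiv_newtonRel _ _ _ _ _ _ i l

/-- The first map of the universal close pair. -/
noncomputable def pairα : B →+* PairRing ψ F m := ((pairMk ψ F m).comp C).comp C

lemma flat_pairα : (pairα ψ F m).Flat := by
  have h1 : ((pairMk ψ F m).comp C).Flat := by
    change (algebraMap (MvPolynomial κ B) (PairRing ψ F m)).Flat
    have := etale_pairRing ψ F m
    rw [RingHom.flat_algebraMap_iff]; infer_instance
  have h2 : (C : B →+* MvPolynomial κ B).Flat := by
    rw [← algebraMap_eq, RingHom.flat_algebraMap_iff]; infer_instance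
  exact RingHom.Flat.comp h2 h1

lemma exists_pairβ (hψ : Function.Surjective ψ)
    (hker : RingHom.ker ψ = Ideal.span (Set.range (F ∘ Sum.inl))) : ∃ β : B →+* PairRing ψ F m,
    ∀ p, β (ψ p) = pairMk ψ F m (pairShift ψ F m p) := by
  have h : RingHom.ker ψ ≤ RingHom.ker ((pairMk ψ F m).comp (pairShift ψ F m)) := by
    rw [hker, Ideal.span_le]
    rintro _ ⟨i, rfl⟩
    have h0 : ψ (F (.inl i)) = 0 := by
      rw [← RingHom.mem_ker, hker]; exact Ideal.subset_span ⟨i, rfl⟩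
    simp [RingHom.mem_ker, pairShift_apply, pairMk_pairRel, h0]
  exact ⟨ψ.liftOfSurjective hψ ⟨_, h⟩, ψ.liftOfRightInverse_comp_apply _ _ ⟨_, h⟩⟩

variable (hψ : Function.Surjective ψ) (hker : RingHom.ker ψ = Ideal.span (Set.range (F ∘ Sum.inl)))

/-- The second map of the universal close pair. -/
noncomputable def pairβ : B →+* PairRing ψ F m := (exists_pairβ ψ F m hψ hker).choose

lemma pairβ_apply (p) : pairβ ψ F m hψ hker (ψ p) = pairMk ψ F m (pairShift ψ F m p) :=
  (exists_pairβ ψ F m hψ hker).choose_spec p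

lemma pairβ_X (i) : pairβ ψ F m hψ hker (ψ (X i)) - pairα ψ F m (ψ (X i)) =
    pairα ψ F m (ψ (jacobiMat F).det) ^ (m + 1) * pairMk ψ F m (X i) := by
  rw [pairβ_apply, pairShift_X]
  simp [pairα]

lemma pairβ_inr (l) : pairβ ψ F m hψ hker (ψ (F (.inr l))) - pairα ψ F m (ψ (F (.inr l))) =
    pairα ψ F m (ψ (jacobiMat F).det) ^ (m + 2) * pairMk ψ F m (C (X l)) := by
  rw [pairβ_apply, pairShift_apply]
  simp [pairα, pairMk_pairRel]

lemma closePair_pair : ClosePair ψ F m (pairα ψ F m) (pairβ ψ F m hψ hker) where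
  scalars a := by rw [pairβ_apply, pairShift_C]; rfl
  coord i := ⟨_, pairβ_X ψ F m hψ hker i⟩
  comp l := ⟨_, pairβ_inr ψ F m hψ hker l⟩
  unit := ⟨_, isUnit_solMk _ _, by rw [pairβ_apply, pairShift_det, map_mul]; rfl⟩

/-- The universal difference quotients are determined, because they can be recovered by division by
powers of the equation of the different. -/
lemma pair_hom_ext {R : Type*} [CommRing R] {θ θ' : PairRing ψ F m →+* R}
    (hα : θ.comp (pairα ψ F m) = θ'.comp (pairα ψ F m))
    (hβ : θ.comp (pairβ ψ F m hψ hker) = θ'.comp (pairβ ψ F m hψ hker))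
    (hg : θ (pairα ψ F m (ψ (jacobiMat F).det)) ∈ nonZeroDivisors R) : θ = θ' := by
  have ha (b) : θ (pairα ψ F m b) = θ' (pairα ψ F m b) := congr($hα b)
  have hb (b) : θ (pairβ ψ F m hψ hker b) = θ' (pairβ ψ F m hψ hker b) := congr($hβ b)
  refine solRing_hom_ext _ _ (MvPolynomial.ringHom_ext' (MvPolynomial.ringHom_ext' hα
    fun l ↦ ?_) fun i ↦ ?_)
  · have h1 := congrArg θ (pairβ_inr ψ F m hψ hker l)
    have h2 := congrArg θ' (pairβ_inr ψ F m hψ hker l)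
    simp only [map_sub, map_mul, map_pow, ← ha, ← hb] at h1 h2
    exact (mul_cancel_left_mem_nonZeroDivisors (pow_mem hg _)).mp (h1.symm.trans h2)
  · have h1 := congrArg θ (pairβ_X ψ F m hψ hker i)
    have h2 := congrArg θ' (pairβ_X ψ F m hψ hker i)
    simp only [map_sub, map_mul, map_pow, ← ha, ← hb] at h1 h2
    exact (mul_cancel_left_mem_nonZeroDivisors (pow_mem hg _)).mp (h1.symm.trans h2)

/-- The universal property of the universal close pair. -/
theorem ClosePair.exists_lift {R : Type*} [CommRing R] {α β : B →+* R}
    (h : ClosePair ψ F m α β) (hg : α (ψ (jacobiMat F).det) ∈ nonZeroDivisors R) :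
    ∃ θ : PairRing ψ F m →+* R, θ.comp (pairα ψ F m) = α ∧ θ.comp (pairβ ψ F m hψ hker) = β := by
  choose u hu using h.coord
  choose v hv using h.comp
  obtain ⟨δ, hδ, hδ'⟩ := h.unit
  set γ := α (ψ (jacobiMat F).det)
  let p : MvPolynomial (σ ⊕ κ) (MvPolynomial κ B) →+* R := eval₂Hom (eval₂Hom α v) u
  have hpC (b : B) : p (C (C b)) = α b := by simp [p]
  have hpS (q) : p (pairShift ψ F m q) = β (ψ q) := by
    have : p.comp (pairShift ψ F m) = β.comp ψ := by
      refine MvPolynomial.ringHom_ext (fun a ↦ ?_) fun i ↦ ?_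
      · rw [RingHom.comp_apply, RingHom.comp_apply, pairShift_C, hpC, h.scalars]
      · rw [RingHom.comp_apply, RingHom.comp_apply, pairShift_X, map_add, hpC, map_mul, map_pow,
          hpC, show p (X i) = u i by simp [p], ← hu i]
        ring
    exact congr($this q)
  -- the known values of `F` give the product of the Jacobian matrix with the Newton equations;
  -- multiply by the adjugate, and cancel the determinant `γ`
  have hsum (i) : ∑ j, p (C (jac (pairC ψ) (pairX ψ) F i j)) * p (pairRel ψ F m j) = 0 := by
    refine (mul_cancel_left_mem_nonZeroDivisors (pow_mem hg (m + 1))).mp ?_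
    have h1 := congrArg p (pairShift_apply ψ F m i)
    rw [hpS, map_add, map_add, map_mul, map_mul, map_pow, map_pow, hpC, hpC, map_sum] at h1
    simp only [map_mul] at h1
    rw [mul_zero]
    rcases i with i | l
    · have h0 : ψ (F (.inl i)) = 0 := by
        rw [← RingHom.mem_ker, hker]; exact Ideal.subset_span ⟨i, rfl⟩
      simpa [h0] using h1.symm
    · have h2 : p (C (Sum.elim (fun _ : σ ↦ 0) X (Sum.inr l : σ ⊕ κ))) = v l := by simp [p]
      rw [h2, ← hv l] at h1
      linear_combination -h1
  have hrel (j) : p (pairRel ψ F m j) = 0 := by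
    set M := (jac (pairC ψ) (pairX ψ) F).map (p.comp C) with hM
    have hdet : M.det = γ := by
      have h1 := RingHom.map_det (p.comp C) (jac (pairC ψ) (pairX (κ := κ) ψ) F)
      rw [RingHom.mapMatrix_apply, det_jac_pair] at h1
      exact h1.symm.trans (hpC _)
    have h1 := congrArg (M.adjugate.mulVec ·) (show M.mulVec (p ∘ pairRel ψ F m) = 0 from
      funext hsum)
    simp only [Matrix.mulVec_mulVec, Matrix.adjugate_mul, hdet, Matrix.smul_mulVec,
      Matrix.one_mulVec, Matrix.mulVec_zero] at h1
    exact (mul_right_mem_nonZeroDivisors_eq_zero_iff hg).mp ((mul_comm _ _).trans (congrFun h1 j))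
  obtain ⟨θ, hθ⟩ := exists_solRing_lift _ _ p hrel (by
    have h1 := congrArg p (pairShift_det ψ F m)
    rw [hpS, map_mul, hpC, hδ'] at h1
    rwa [← (mul_cancel_left_mem_nonZeroDivisors hg).mp h1])
  have hθ' (q) : θ (pairMk ψ F m q) = p q := congr($hθ q)
  refine ⟨θ, RingHom.ext fun b ↦ (hθ' _).trans (hpC b), RingHom.ext fun b ↦ ?_⟩
  obtain ⟨q, rfl⟩ := hψ b
  rw [RingHom.comp_apply, pairβ_apply, hθ', hpS]

end

end Newton

/-! ### Closeness in charts -/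

namespace Newton

section Affine

variable {X S : Scheme.{u}} {q₁ q₂ : S ⟶ X} {s : S} {V : X.Opens}

/-- Two morphisms whose values on the functions on an affine open subset agree modulo the maximal
ideal agree at the point. -/
lemma apply_eq_of_sub_mem_maximalIdeal (hV : IsAffineOpen V) (h₁ : q₁ s ∈ V) (h₂ : q₂ s ∈ V)
    (H : ∀ b : Γ(X, V), pullGerm q₁ s h₁ b - pullGerm q₂ s h₂ b ∈
    IsLocalRing.maximalIdeal (S.presheaf.stalk s)) : q₁ s = q₂ s := by
  have key (q : S ⟶ X) (h : q s ∈ V) (b : Γ(X, V)) : q s ∈ X.basicOpen b ↔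
      pullGerm q s h b ∉ IsLocalRing.maximalIdeal (S.presheaf.stalk s) := by
    rw [X.mem_basicOpen b _ h, IsLocalRing.notMem_maximalIdeal]
    exact (isUnit_map_iff (q.stalkMap s).hom _).symm
  have hb (b : Γ(X, V)) : q₁ s ∈ X.basicOpen b ↔ q₂ s ∈ X.basicOpen b := by
    rw [key q₁ h₁, key q₂ h₂, not_iff_not]
    refine ⟨fun h ↦ ?_, fun h ↦ ?_⟩
    · simpa using sub_mem h (H b)
    · simpa using add_mem (H b) h
  refine Inseparable.eq (inseparable_iff_forall_isOpen.mpr fun W hW ↦ ⟨fun h ↦ ?_, fun h ↦ ?_⟩)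
  · obtain ⟨b, hbW, hb'⟩ := hV.exists_basicOpen_le (V := ⟨W, hW⟩) ⟨q₁ s, h⟩ h₁
    exact hbW ((hb b).mp hb')
  · obtain ⟨b, hbW, hb'⟩ := hV.exists_basicOpen_le (V := ⟨W, hW⟩) ⟨q₂ s, h⟩ h₂
    exact hbW ((hb b).mpr hb')

lemma sub_mem_of_isAffineOpen (hV : IsAffineOpen V) (h₁ : q₁ s ∈ V) (h₂ : q₂ s ∈ V)
    (I : Ideal (S.presheaf.stalk s)) (hq : q₁ s = q₂ s)
    (H : ∀ b : Γ(X, V), pullGerm q₁ s h₁ b - pullGerm q₂ s h₂ b ∈ I) {V' : X.Opens}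
    (h₁' : q₁ s ∈ V') (h₂' : q₂ s ∈ V') (b : Γ(X, V')) :
    pullGerm q₁ s h₁' b - pullGerm q₂ s h₂' b ∈ I := by
  obtain ⟨g, hgV, hg₁⟩ := hV.exists_basicOpen_le ⟨q₁ s, h₁'⟩ h₁
  have hg₂ : q₂ s ∈ X.basicOpen g := hq ▸ hg₁
  have := hV.isLocalization_basicOpen g
  have h : (Ideal.Quotient.mk I).comp (pullGerm q₁ s hg₁) =
      (Ideal.Quotient.mk I).comp (pullGerm q₂ s hg₂) := by
    refine IsLocalization.ringHom_ext (.powers g) (RingHom.ext fun a ↦ ?_)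
    refine Ideal.Quotient.eq.mpr ?_
    have e₁ := pullGerm_res q₁ s (X.basicOpen_le g) hg₁ h₁ a
    have e₂ := pullGerm_res q₂ s (X.basicOpen_le g) hg₂ h₂ a
    exact e₁ ▸ e₂ ▸ H a
  rw [← pullGerm_res q₁ s hgV hg₁, ← pullGerm_res q₂ s hgV hg₂]
  exact Ideal.Quotient.eq.mp congr($h _)

end Affine

/-- Ring maps from an unramified algebra that agree modulo `I`, and modulo `I ^ n` on the base ring,
agree modulo `I ^ n`. -/
lemma sub_mem_of_formallyUnramified {A B R : Type*} [CommRing A] [CommRing B] [CommRing R]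
    {y : A →+* B} (hy : y.FormallyUnramified) {α β : B →+* R} {I : Ideal R} {n : ℕ}
    (h : ∀ a, α (y a) - β (y a) ∈ I ^ n) (h' : ∀ b, α b - β b ∈ I) (b : B) :
    α b - β b ∈ I ^ n := by
  let := y.toAlgebra
  let := ((Ideal.Quotient.mk (I ^ n)).comp (α.comp y)).toAlgebra
  have : Algebra.FormallyUnramified A B := hy
  let g₁ : B →ₐ[A] R ⧸ I ^ n := { (Ideal.Quotient.mk (I ^ n)).comp α with commutes' := fun _ ↦ rfl }
  let g₂ : B →ₐ[A] R ⧸ I ^ n := { (Ideal.Quotient.mk (I ^ n)).comp β with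
    commutes' := fun a ↦ (Ideal.Quotient.eq.mpr (h a)).symm }
  have key : g₁ = g₂ := by
    refine Algebra.FormallyUnramified.ext (I := I.map (Ideal.Quotient.mk (I ^ n))) ⟨n, ?_⟩
      fun x ↦ ?_
    · rw [← Ideal.map_pow, Ideal.map_quotient_self, Ideal.zero_eq_bot]
    · refine Ideal.Quotient.eq.mpr ?_
      have := Ideal.mem_map_of_mem (Ideal.Quotient.mk (I ^ n)) (h' x)
      rwa [map_sub] at this
  exact Ideal.Quotient.eq.mp congr($key b)

lemma sub_mem_of_mvPolynomial {k n R : Type*} [CommRing k] [CommRing R] {I : Ideal R}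
    {ψ₁ ψ₂ : MvPolynomial n k →+* R} (hC : ∀ a, ψ₁ (.C a) = ψ₂ (.C a))
    (hX : ∀ i, ψ₁ (.X i) - ψ₂ (.X i) ∈ I) (p : MvPolynomial n k) : ψ₁ p - ψ₂ p ∈ I := by
  have h : (Ideal.Quotient.mk I).comp ψ₁ = (Ideal.Quotient.mk I).comp ψ₂ :=
    MvPolynomial.ringHom_ext (fun a ↦ congrArg _ (hC a)) fun i ↦ Ideal.Quotient.eq.mpr (hX i)
  exact Ideal.Quotient.eq.mp congr($h p)

namespace NewtonSetting

open MvPolynomial (C)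

variable {k : Type u} [Field k] {D : NewtonSetting k} {S : Scheme.{u}} {q₁ q₂ : S ⟶ D.X}

lemma pullGerm_scalars {q : S ⟶ D.X} (s : S) {V : D.X.Opens} (h : q s ∈ V) {S' : S.Opens}
    (hs : s ∈ S') (e : S' ≤ q ⁻¹ᵁ V) (a : k) : pullGerm q s h (scalars D.pX V a) =
      S.presheaf.germ S' s hs (scalars (q ≫ D.pX) S' a) := by
  rw [pullGerm_eq_germ q e hs h]
  exact congrArg (S.presheaf.germ S' s hs).hom (appLE_scalars rfl e a)

/-- Closeness can be checked on the coordinates of a chart. -/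
lemma Chart.close (c : Chart D) {r : ℕ} (hr : 2 ≤ r) (hk : q₁ ≫ D.pX = q₂ ≫ D.pX)
    (h₁ : ∀ s, q₁ s ∈ c.V) (h₂ : ∀ s, q₂ s ∈ c.V)
    (hd : ∀ s, D.pullDifferent q₁ s = D.pullDifferent q₂ s)
    (hX : ∀ s i, pullGerm q₁ s (h₁ s) (c.ψ (.X i)) - pullGerm q₂ s (h₂ s) (c.ψ (.X i)) ∈
      D.pullDifferent q₁ s ^ (r - 1))
    (hY : ∀ s l, pullGerm q₁ s (h₁ s) (c.ψ (c.comp l)) - pullGerm q₂ s (h₂ s) (c.ψ (c.comp l)) ∈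
      D.pullDifferent q₁ s ^ r) : D.Close r q₁ q₂ := by
  have hC (s) (a : k) : pullGerm q₁ s (h₁ s) (scalars D.pX c.V a) =
      pullGerm q₂ s (h₂ s) (scalars D.pX c.V a) := by
    rw [pullGerm_scalars s (h₁ s) (S' := ⊤) trivial (fun s _ ↦ h₁ s),
      pullGerm_scalars s (h₂ s) (S' := ⊤) trivial (fun s _ ↦ h₂ s), hk]
  have hC' (a : k) : c.ψ (C a) = scalars D.pX c.V a := congr($c.ψ_C a)
  have hB (s) (b : Γ(D.X, c.V)) : pullGerm q₁ s (h₁ s) b - pullGerm q₂ s (h₂ s) b ∈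
      D.pullDifferent q₁ s ^ (r - 1) := by
    obtain ⟨p, rfl⟩ := c.surjective_ψ b
    refine sub_mem_of_mvPolynomial (ψ₁ := (pullGerm q₁ s (h₁ s)).comp c.ψ)
      (ψ₂ := (pullGerm q₂ s (h₂ s)).comp c.ψ) (fun a ↦ ?_) (hX s) p
    rw [RingHom.comp_apply, RingHom.comp_apply, hC', hC]
  have hq (s) : D.pullDifferent q₁ s = ⊤ ∨ q₁ s = q₂ s := by
    by_cases h : D.pullDifferent q₁ s = ⊤
    · exact .inl h
    · exact .inr (apply_eq_of_sub_mem_maximalIdeal c.isAffineOpen_V (h₁ s) (h₂ s) fun b ↦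
        IsLocalRing.le_maximalIdeal h (Ideal.pow_le_self (by omega) (hB s b)))
  refine ⟨hd, hq, fun s V' h₁' h₂' b ↦ ?_, fun s V' h₁' h₂' a ↦ ?_⟩
  · rcases hq s with h | h
    · rw [h, Ideal.top_pow]; trivial
    · exact sub_mem_of_isAffineOpen c.isAffineOpen_V (h₁ s) (h₂ s) _ h (hB s) h₁' h₂' b
  · rcases hq s with h | h
    · rw [h, Ideal.top_pow]; trivial
    · have e₁ : (q₁ ≫ D.φ) s ∈ c.Y' := c.le (h₁ s)
      have e₂ : (q₂ ≫ D.φ) s ∈ c.Y' := c.le (h₂ s)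
      have h' : (q₁ ≫ D.φ) s = (q₂ ≫ D.φ) s := by
        rw [Scheme.Hom.comp_apply, Scheme.Hom.comp_apply, h]
      refine sub_mem_of_isAffineOpen c.isAffineOpen_Y' e₁ e₂ _ h' (fun b ↦ ?_) h₁' h₂' a
      have hφ₁ := pullGerm_comp' q₁ D.φ s c.le e₁ (h₁ s)
      have hφ₂ := pullGerm_comp' q₂ D.φ s c.le e₂ (h₂ s)
      refine sub_mem_of_formallyUnramified c.etale_y.formallyUnramified (fun p ↦ ?_) (fun b ↦ ?_) b
      · refine sub_mem_of_mvPolynomial (ψ₁ := (pullGerm (q₁ ≫ D.φ) s e₁).comp c.y)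
          (ψ₂ := (pullGerm (q₂ ≫ D.φ) s e₂).comp c.y) (fun a ↦ ?_) (fun l ↦ ?_) p
        · have hy : c.y (C a) = scalars D.pY c.Y' a := congr($c.y_C a)
          have := appLE_scalars D.φ_comp c.le a
          rw [RingHom.comp_apply, RingHom.comp_apply, hφ₁, hφ₂, hy, this, hC]
        · rw [RingHom.comp_apply, RingHom.comp_apply, hφ₁, hφ₂, c.appLE_y]
          exact hY s l
      · rw [hφ₁, hφ₂]
        exact Ideal.pow_le_self (by omega) (hB s _)

end NewtonSetting

end Newton

/-! ### The universal pair of close morphisms to a chart -/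

namespace Newton

namespace NewtonSetting

variable {k : Type u} [Field k] {D : NewtonSetting k} {S : Scheme.{u}} {q₁ q₂ : S ⟶ D.X}

/-- The equation of the different remains a nonzerodivisor. -/
lemma Good.mem_nonZeroDivisors {q : S ⟶ D.X} (hg : Good q) (c : Chart D) {S' : S.Opens}
    (e : S' ≤ q ⁻¹ᵁ c.V) : (q.appLE c.V S' e).hom c.g ∈ nonZeroDivisors Γ(S, S') := by
  have : IsSchemeTheoreticallyDominant (q ⁻¹ᵁ etaleLocus D.φ).ι := hg
  have hu := c.isUnit_toPush (ν := (q ⁻¹ᵁ etaleLocus D.φ).ι) (q := q) (fun u ↦ u.2) e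
  refine mem_nonZeroDivisors_iff_right.mpr fun z hz ↦ ?_
  apply (q ⁻¹ᵁ etaleLocus D.φ).ι.app_injective S'
  have h := congrArg ((q ⁻¹ᵁ etaleLocus D.φ).ι.app S').hom hz
  rw [map_mul, map_zero] at h
  exact (hu.mul_left_eq_zero.mp h).trans (map_zero _).symm

lemma pullGerm_specTo {X : Scheme.{u}} {V : X.Opens} (hV : IsAffineOpen V) {R : CommRingCat.{u}}
    (ρ : Γ(X, V) ⟶ R) (s : Spec R) (h : specTo hV ρ s ∈ V) (b : Γ(X, V)) :
    pullGerm (specTo hV ρ) s h b =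
      (Spec R).presheaf.germ ⊤ s trivial ((Scheme.ΓSpecIso R).inv.hom (ρ.hom b)) := by
  rw [pullGerm_eq_germ _ (specTo_mem hV ρ) trivial h, specTo_appLE]
  rfl

/-- The map on global sections given by a morphism to an affine scheme. -/
noncomputable def evSpec {R : CommRingCat.{u}} (θ : S ⟶ Spec R) : R →+* Γ(S, ⊤) :=
  ((Scheme.ΓSpecIso R).inv ≫ θ.appLE ⊤ ⊤ le_top).hom

lemma evSpec_injective {R : CommRingCat.{u}} {θ θ' : S ⟶ Spec R} (h : evSpec θ = evSpec θ') :
    θ = θ' := by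
  refine ext_of_isAffine ?_
  have h' : (Scheme.ΓSpecIso R).inv ≫ θ.appLE ⊤ ⊤ le_top =
      (Scheme.ΓSpecIso R).inv ≫ θ'.appLE ⊤ ⊤ le_top :=
    CommRingCat.hom_ext h
  rw [cancel_epi] at h'
  rwa [Scheme.Hom.appTop, Scheme.Hom.app_eq_appLE, Scheme.Hom.appTop, Scheme.Hom.app_eq_appLE]

lemma le_comp_specTo {X : Scheme.{u}} {V : X.Opens} (hV : IsAffineOpen V) {R : CommRingCat.{u}}
    (ρ : Γ(X, V) ⟶ R) (θ : S ⟶ Spec R) : ⊤ ≤ (θ ≫ specTo hV ρ) ⁻¹ᵁ V :=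
  fun s _ ↦ specTo_mem hV ρ (x := θ s) trivial

lemma evSpec_comp {X : Scheme.{u}} {V : X.Opens} (hV : IsAffineOpen V) {R : CommRingCat.{u}}
    (ρ : Γ(X, V) ⟶ R) (θ : S ⟶ Spec R) :
    (evSpec θ).comp ρ.hom = ((θ ≫ specTo hV ρ).appLE V ⊤ (le_comp_specTo hV ρ θ)).hom := by
  ext b
  rw [← appLE_appLE_apply θ _ (specTo_mem hV ρ) le_top, specTo_appLE]
  rfl

lemma evSpec_comp_eq {X : Scheme.{u}} {V : X.Opens} (hV : IsAffineOpen V) {R : CommRingCat.{u}}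
    {ρ : Γ(X, V) ⟶ R} {θ θ' : S ⟶ Spec R} (h : θ ≫ specTo hV ρ = θ' ≫ specTo hV ρ) :
    (evSpec θ).comp ρ.hom = (evSpec θ').comp ρ.hom := by
  rw [evSpec_comp hV, evSpec_comp hV]
  exact congrArg _ (appLE_eq_of_eq h _ _)

lemma _root_.Newton.ClosePair.specTo_pX {c : Chart D} {m : ℕ} {R : CommRingCat.{u}}
    {α β : Γ(D.X, c.V) ⟶ R} (h : ClosePair c.ψ c.F m α.hom β.hom) :
    specTo c.isAffineOpen_V α ≫ D.pX = specTo c.isAffineOpen_V β ≫ D.pX := by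
  rw [specTo_comp D.pX _ (isAffineOpen_top _) le_top,
    specTo_comp D.pX _ (isAffineOpen_top _) le_top]
  congr 1
  rw [← cancel_epi (Scheme.ΓSpecIso (.of k)).inv]
  ext a
  have hC : c.ψ (.C a) = scalars D.pX c.V a := congr($c.ψ_C a)
  have := h.scalars a
  rw [hC] at this
  exact this.symm

/-- A close pair of ring maps gives a close pair of morphisms. -/
lemma _root_.Newton.ClosePair.close {c : Chart D} {m : ℕ} {R : CommRingCat.{u}}
    {α β : Γ(D.X, c.V) ⟶ R} (h : ClosePair c.ψ c.F m α.hom β.hom) :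
    D.Close (m + 2) (specTo c.isAffineOpen_V α) (specTo c.isAffineOpen_V β) := by
  have h₁ (s) : specTo c.isAffineOpen_V α s ∈ c.V := specTo_mem c.isAffineOpen_V α trivial
  have h₂ (s) : specTo c.isAffineOpen_V β s ∈ c.V := specTo_mem c.isAffineOpen_V β trivial
  let G (s : Spec R) : R →+* (Spec R).presheaf.stalk s :=
    ((Spec R).presheaf.germ ⊤ s trivial).hom.comp (Scheme.ΓSpecIso R).inv.hom
  have hα (s) (b) : pullGerm (specTo c.isAffineOpen_V α) s (h₁ s) b = G s (α.hom b) :=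
    pullGerm_specTo ..
  have hβ (s) (b) : pullGerm (specTo c.isAffineOpen_V β) s (h₂ s) b = G s (β.hom b) :=
    pullGerm_specTo ..
  have hd (s) : D.pullDifferent (specTo c.isAffineOpen_V α) s = Ideal.span {G s (α.hom c.g)} := by
    rw [c.pullDifferent_eq _ (h₁ s), hα]
  refine c.close (by omega) h.specTo_pX h₁ h₂ (fun s ↦ ?_) (fun s i ↦ ?_) fun s l ↦ ?_
  · obtain ⟨δ, hδ, e⟩ := h.unit
    rw [hd, c.pullDifferent_eq _ (h₂ s), hβ]
    have e' : β.hom c.g = α.hom c.g * δ := e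
    rw [e', map_mul, Ideal.span_singleton_mul_right_unit (hδ.map (G s))]
  · obtain ⟨u, hu⟩ := h.coord i
    rw [hα, hβ, ← map_sub, ← neg_sub, hu, hd, map_neg, neg_mem_iff, map_mul, map_pow]
    exact Ideal.mul_mem_right _ _ (Ideal.pow_mem_pow (Ideal.mem_span_singleton_self _) _)
  · obtain ⟨v, hv⟩ := h.comp l
    rw [hα, hβ, ← map_sub, ← neg_sub, hd, map_neg, neg_mem_iff]
    have hv' : β.hom (c.ψ (c.comp l)) - α.hom (c.ψ (c.comp l)) = α.hom c.g ^ (m + 2) * v := hv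
    rw [hv', map_mul, map_pow]
    exact Ideal.mul_mem_right _ _ (Ideal.pow_mem_pow (Ideal.mem_span_singleton_self _) _)

/-- A close pair of morphisms gives a close pair of ring maps over a chart. -/
lemma Close.closePair {m : ℕ} (hq : D.Close (m + 2) q₁ q₂) (hg : Good q₁)
    (hk : q₁ ≫ D.pX = q₂ ≫ D.pX) (c : Chart D) {S' : S.Opens} (hS' : IsAffineOpen S')
    (e₁ : S' ≤ q₁ ⁻¹ᵁ c.V) (e₂ : S' ≤ q₂ ⁻¹ᵁ c.V) :
    ClosePair c.ψ c.F m (q₁.appLE c.V S' e₁).hom (q₂.appLE c.V S' e₂).hom := by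
  have hγ := hg.mem_nonZeroDivisors c e₁
  set γ := (q₁.appLE c.V S' e₁).hom c.g with hγ'
  set γ' := (q₂.appLE c.V S' e₂).hom c.g with hγ''
  have hd (s) (hs : s ∈ S') : D.pullDifferent q₁ s = Ideal.span {S.presheaf.germ S' s hs γ} := by
    have h₁ : q₁ s ∈ c.V := e₁ hs
    rw [c.pullDifferent_eq q₁ h₁, pullGerm_eq_germ q₁ e₁ hs h₁]
  have hd' (s) (hs : s ∈ S') : D.pullDifferent q₁ s = Ideal.span {S.presheaf.germ S' s hs γ'} := by
    have h₂ : q₂ s ∈ c.V := e₂ hs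
    rw [hq.pullDifferent_eq, c.pullDifferent_eq q₂ h₂, pullGerm_eq_germ q₂ e₂ hs h₂]
  refine ⟨fun a ↦ ?_, fun i ↦ ?_, fun l ↦ ?_, ?_⟩
  · have hC : c.ψ (.C a) = scalars D.pX c.V a := congr($c.ψ_C a)
    rw [hC, appLE_scalars rfl e₁, appLE_scalars rfl e₂, hk]
  · have := mem_span_pow_of_germ hS' ((q₂.appLE c.V S' e₂).hom (c.ψ (.X i)) -
      (q₁.appLE c.V S' e₁).hom (c.ψ (.X i))) γ (m + 1) fun s hs ↦ by
        have h₁ : q₁ s ∈ c.V := e₁ hs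
        have h₂ : q₂ s ∈ c.V := e₂ hs
        rw [← hd s hs, map_sub, ← pullGerm_eq_germ q₂ e₂ hs h₂, ← pullGerm_eq_germ q₁ e₁ hs h₁,
          ← neg_sub]
        exact neg_mem (hq.sub_mem s c.V h₁ h₂ _)
    obtain ⟨u, hu⟩ := Ideal.mem_span_singleton.mp this
    exact ⟨u, hu⟩
  · have := mem_span_pow_of_germ hS' ((q₂.appLE c.V S' e₂).hom (c.ψ (c.comp l)) -
      (q₁.appLE c.V S' e₁).hom (c.ψ (c.comp l))) γ (m + 2) fun s hs ↦ by
        have h₁ : q₁ s ∈ c.V := e₁ hs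
        have h₂ : q₂ s ∈ c.V := e₂ hs
        have h₁' : (q₁ ≫ D.φ) s ∈ c.Y' := c.le h₁
        have h₂' : (q₂ ≫ D.φ) s ∈ c.Y' := c.le h₂
        rw [← hd s hs, map_sub, ← pullGerm_eq_germ q₂ e₂ hs h₂, ← pullGerm_eq_germ q₁ e₁ hs h₁,
          ← neg_sub, ← c.appLE_y, ← pullGerm_comp' q₁ D.φ s c.le h₁' h₁,
          ← pullGerm_comp' q₂ D.φ s c.le h₂' h₂]
        exact neg_mem (hq.sub_mem' s c.Y' h₁' h₂' _)
    obtain ⟨v, hv⟩ := Ideal.mem_span_singleton.mp this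
    exact ⟨v, hv⟩
  · have h1 := mem_span_pow_of_germ hS' γ γ' 1 fun s hs ↦ by
      rw [pow_one, ← hd' s hs, hd s hs]; exact Ideal.mem_span_singleton_self _
    have h2 := mem_span_pow_of_germ hS' γ' γ 1 fun s hs ↦ by
      rw [pow_one, ← hd s hs, hd' s hs]; exact Ideal.mem_span_singleton_self _
    rw [pow_one] at h1 h2
    obtain ⟨δ', hδ'⟩ := Ideal.mem_span_singleton.mp h1
    obtain ⟨δ, hδ⟩ := Ideal.mem_span_singleton.mp h2
    refine ⟨δ, IsUnit.of_mul_eq_one δ' ?_, hδ⟩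
    refine (mul_cancel_left_mem_nonZeroDivisors hγ).mp ?_
    rw [← mul_assoc, ← hδ, ← hδ', mul_one]

namespace Chart

variable (c : Chart D) (m : ℕ)

lemma ker_ψ' : RingHom.ker c.ψ = Ideal.span (Set.range (c.F ∘ Sum.inl)) := c.ker_ψ

/-- The affine scheme that carries the universal close pair of morphisms to a chart. -/
noncomputable abbrev pairSpec : Scheme.{u} := Spec (.of (PairRing c.ψ c.F m))

/-- The first morphism of the universal close pair. -/
noncomputable def pair₁ : c.pairSpec m ⟶ D.X :=
  specTo c.isAffineOpen_V (CommRingCat.ofHom (pairα c.ψ c.F m))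

/-- The second morphism of the universal close pair. -/
noncomputable def pair₂ : c.pairSpec m ⟶ D.X :=
  specTo c.isAffineOpen_V (CommRingCat.ofHom (pairβ c.ψ c.F m c.surjective_ψ c.ker_ψ'))

instance flat_pair₁ : Flat (c.pair₁ m) := by
  have : Flat (Spec.map (CommRingCat.ofHom (pairα c.ψ c.F m))) :=
    (HasRingHomProperty.Spec_iff (P := @Flat)).mpr (flat_pairα c.ψ c.F m)
  rw [pair₁, specTo]
  infer_instance

lemma close_pair : D.Close (m + 2) (c.pair₁ m) (c.pair₂ m) :=
  ClosePair.close (closePair_pair c.ψ c.F m c.surjective_ψ c.ker_ψ')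

lemma pair₁_pX : c.pair₁ m ≫ D.pX = c.pair₂ m ≫ D.pX :=
  ClosePair.specTo_pX (closePair_pair c.ψ c.F m c.surjective_ψ c.ker_ψ')

/-- A close pair of morphisms to a chart comes from a morphism to `pairSpec`. -/
lemma exists_pair_lift (hq : D.Close (m + 2) q₁ q₂) (hg : Good q₁)
    (hk : q₁ ≫ D.pX = q₂ ≫ D.pX) {S' : S.Opens} (hS' : IsAffineOpen S')
    (e₁ : S' ≤ q₁ ⁻¹ᵁ c.V) (e₂ : S' ≤ q₂ ⁻¹ᵁ c.V) : ∃ θ : S'.toScheme ⟶ c.pairSpec m,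
      θ ≫ c.pair₁ m = S'.ι ≫ q₁ ∧ θ ≫ c.pair₂ m = S'.ι ≫ q₂ := by
  obtain ⟨θ, h₁, h₂⟩ := (hq.closePair hg hk c hS' e₁ e₂).exists_lift c.ψ c.F m c.surjective_ψ
    c.ker_ψ' (hg.mem_nonZeroDivisors c e₁)
  refine ⟨S'.toSpecΓ ≫ Spec.map (CommRingCat.ofHom θ), ?_, ?_⟩
  · rw [ι_comp_eq_toSpecΓ q₁ c.isAffineOpen_V e₁, pair₁, specTo, Category.assoc,
      ← Spec.map_comp_assoc]
    congr 3
    ext1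
    exact h₁
  · rw [ι_comp_eq_toSpecΓ q₂ c.isAffineOpen_V e₂, pair₂, specTo, Category.assoc,
      ← Spec.map_comp_assoc]
    congr 3
    ext1
    exact h₂

/-- Morphisms to `pairSpec` are determined by the pair of morphisms to the chart. -/
lemma pairSpec_hom_ext {θ θ' : S ⟶ c.pairSpec m} (h₁ : θ ≫ c.pair₁ m = θ' ≫ c.pair₁ m)
    (h₂ : θ ≫ c.pair₂ m = θ' ≫ c.pair₂ m) (hg : Good (θ ≫ c.pair₁ m)) : θ = θ' := by
  refine evSpec_injective (pair_hom_ext c.ψ c.F m c.surjective_ψ c.ker_ψ'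
    (evSpec_comp_eq _ h₁) (evSpec_comp_eq _ h₂) ?_)
  have h := hg.mem_nonZeroDivisors c (le_comp_specTo _ _ θ)
  exact congr($(evSpec_comp c.isAffineOpen_V (CommRingCat.ofHom (pairα c.ψ c.F m)) θ) c.g) ▸ h

end Chart

end NewtonSetting

end Newton

/-! ### Flatness of the source morphism -/

namespace Newton

namespace NewtonSetting

variable {k : Type u} [Field k] {D : NewtonSetting k} {S : Scheme.{u}} {q₁ q₂ : S ⟶ D.X} {r : ℕ}

lemma p₁_pX (r : ℕ) : D.p₁ r ≫ D.pX = D.p₂ r ≫ D.pX := by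
  rw [p₁, p₂, Category.assoc, Category.assoc, pullback.condition]

lemma ν_π (r : ℕ) : D.ν r ≫ D.π r = D.j := (D.𝒜 r).fromSource_toBase

instance isOpenImmersion_ν (r : ℕ) : IsOpenImmersion (D.ν r) :=
  inferInstanceAs (IsOpenImmersion (D.𝒜 r).fromSource)

instance isSchemeTheoreticallyDominant_ν (r : ℕ) : IsSchemeTheoreticallyDominant (D.ν r) :=
  inferInstanceAs (IsSchemeTheoreticallyDominant (D.𝒜 r).fromSource)

lemma good_of_dominant {P : Scheme.{u}} (i : P ⟶ S) [IsSchemeTheoreticallyDominant i] (q : S ⟶ D.X)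
    (h : ∀ x, q (i x) ∈ etaleLocus D.φ) : Good q := by
  have hr : Set.range i ⊆ Set.range (q ⁻¹ᵁ etaleLocus D.φ).ι := by
    rw [Scheme.Opens.range_ι]
    rintro _ ⟨x, rfl⟩
    exact h x
  refine ⟨eq_bot_iff.mpr ?_⟩
  rw [← IsSchemeTheoreticallyDominant.ker_eq_bot i, ← IsOpenImmersion.lift_fac _ i hr]
  exact Scheme.Hom.le_ker_comp _ _

lemma Good.comp {T : Scheme.{u}} {q : S ⟶ D.X} (hg : Good q) (w : T ⟶ S) [Flat w] :
    Good (w ≫ q) := by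
  have : IsSchemeTheoreticallyDominant (q ⁻¹ᵁ etaleLocus D.φ).ι := hg
  exact .of_isPullback (isPullback_morphismRestrict w (q ⁻¹ᵁ etaleLocus D.φ))

lemma p₁_ν (x : D.UU.toScheme) : D.p₁ r (D.ν r x) ∈ etaleLocus D.φ := by
  rw [← Scheme.Hom.comp_apply, p₁, ← Category.assoc, ν_π, Scheme.Hom.comp_apply]
  exact D.pr₁_j_mem x

lemma good_p₁ (r : ℕ) : Good (D.p₁ r) := good_of_dominant (D.ν r) _ p₁_ν

lemma mem_opensRange_ν_iff (hr : 2 ≤ r) (γ : D.Γ r) :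
    γ ∈ (D.ν r).opensRange ↔ D.p₁ r γ ∈ etaleLocus D.φ := by
  refine ⟨fun ⟨x, hx⟩ ↦ hx ▸ p₁_ν x, fun h ↦ ?_⟩
  have h' := ((close_p₁_p₂ hr).mem_etaleLocus_iff γ).mp h
  change γ ∈ (D.𝒜 r).fromSource.opensRange
  rw [← (D.𝒜 r).toBase_preimage_opensRange, Scheme.Opens.opensRange_ι]
  exact ⟨h, h'⟩

/-- Morphisms to `Γ_r` are determined by the composites with `p₁` and `p₂`, if the étale locus has
schematically dense preimage. -/
lemma Γ_hom_ext (hr : 2 ≤ r) {t t' : S ⟶ D.Γ r} (h₁ : t ≫ D.p₁ r = t' ≫ D.p₁ r)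
    (h₂ : t ≫ D.p₂ r = t' ≫ D.p₂ r) (hg : Good (t ≫ D.p₁ r)) : t = t' := by
  have : IsSchemeTheoreticallyDominant ((t ≫ D.p₁ r) ⁻¹ᵁ etaleLocus D.φ).ι := hg
  have hπ : t ≫ D.π r = t' ≫ D.π r := pullback.hom_ext
    (by rw [Category.assoc, Category.assoc]; exact h₁)
    (by rw [Category.assoc, Category.assoc]; exact h₂)
  have hj : Set.range (((t ≫ D.p₁ r) ⁻¹ᵁ etaleLocus D.φ).ι ≫ t ≫ D.π r) ⊆ Set.range D.j := by
    rw [Scheme.Opens.range_ι]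
    rintro _ ⟨x, rfl⟩
    exact ⟨x.2, ((close_p₁_p₂ hr).mem_etaleLocus_iff (t x.1)).mp x.2⟩
  exact (D.𝒜 r).hom_ext_of_isSchemeTheoreticallyDominant hπ _
    (IsOpenImmersion.lift_fac D.j _ hj).symm

instance flat_ν_comp_p₁ : Flat (D.ν r ≫ D.p₁ r) := by
  rw [p₁, ← Category.assoc, ν_π]
  infer_instance

/-- Near a point of `Γ_r` over the different, the scheme `Γ_r` is isomorphic to an open subscheme of
the universal close pair of a chart, because both represent close pairs of morphisms. -/
lemma Chart.flat_ι_comp_p₁ (c : Chart D) {m : ℕ} {S' : (D.Γ (m + 2)).Opens} (hS' : IsAffineOpen S')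
    (e₁ : S' ≤ D.p₁ (m + 2) ⁻¹ᵁ c.V) (e₂ : S' ≤ D.p₂ (m + 2) ⁻¹ᵁ c.V) :
    Flat (S'.ι ≫ D.p₁ (m + 2)) := by
  have hr : 2 ≤ m + 2 := by omega
  obtain ⟨θ, hθ₁, hθ₂⟩ := c.exists_pair_lift m (close_p₁_p₂ hr) (good_p₁ _) (p₁_pX _) hS' e₁ e₂
  obtain ⟨β, hβ₁, hβ₂⟩ := (c.close_pair m).exists_lift (good_of_flat _) (c.pair₁_pX m)
  have hg : Good (S'.ι ≫ D.p₁ (m + 2)) := (good_p₁ _).comp _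
  have hθβ : θ ≫ β = S'.ι := by
    refine Γ_hom_ext hr ?_ ?_ ?_
    · rw [Category.assoc, hβ₁, hθ₁]
    · rw [Category.assoc, hβ₂, hθ₂]
    · rwa [Category.assoc, hβ₁, hθ₁]
  -- `θ` is an open immersion onto `β ⁻¹(S')`, with inverse `n`
  let O := β ⁻¹ᵁ S'
  let n : O.toScheme ⟶ S'.toScheme := IsOpenImmersion.lift S'.ι (O.ι ≫ β) (by
    rw [Scheme.Opens.range_ι]
    rintro _ ⟨x, rfl⟩
    exact x.2)
  have hn : n ≫ S'.ι = O.ι ≫ β := IsOpenImmersion.lift_fac ..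
  have hnθ : n ≫ θ = O.ι := by
    refine c.pairSpec_hom_ext m ?_ ?_ ?_
    · rw [Category.assoc, hθ₁, ← Category.assoc, hn, Category.assoc, hβ₁]
    · rw [Category.assoc, hθ₂, ← Category.assoc, hn, Category.assoc, hβ₂]
    · rw [Category.assoc, hθ₁, ← Category.assoc, hn, Category.assoc, hβ₁]
      exact good_of_flat _
  let θ' : S'.toScheme ⟶ O.toScheme := IsOpenImmersion.lift O.ι θ (by
    rw [Scheme.Opens.range_ι]
    rintro _ ⟨x, rfl⟩
    change β (θ x) ∈ S'
    rw [← Scheme.Hom.comp_apply, hθβ]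
    exact x.2)
  have hθ' : θ' ≫ O.ι = θ := IsOpenImmersion.lift_fac ..
  have : IsIso θ' := ⟨n, by rw [← cancel_mono S'.ι, Category.assoc, hn, ← Category.assoc, hθ', hθβ,
    Category.id_comp], by rw [← cancel_mono O.ι, Category.assoc, hθ', hnθ, Category.id_comp]⟩
  have : Flat θ := hθ' ▸ inferInstance
  rw [← hθ₁]
  infer_instance

/-- The source morphism of `Γ_r` is flat. -/
lemma flat_p₁ (hr : 2 ≤ r) : Flat (D.p₁ r) := by
  have : IsZariskiLocalAtSource @Flat := HasRingHomProperty.instIsZariskiLocalAtSource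
  have key (γ : D.Γ r) : ∃ S' : (D.Γ r).Opens, γ ∈ S' ∧ Flat (S'.ι ≫ D.p₁ r) := by
    by_cases hγ : D.p₁ r γ ∈ etaleLocus D.φ
    · refine ⟨(D.ν r).opensRange, (mem_opensRange_ν_iff hr γ).mpr hγ, ?_⟩
      rw [← Scheme.Hom.isoOpensRange_inv_comp, Category.assoc]
      infer_instance
    · obtain ⟨m, rfl⟩ := Nat.exists_eq_add_of_le' hr
      have h := ((close_p₁_p₂ hr).eq_top_or γ).resolve_left fun h ↦
        hγ ((pullDifferent_eq_top_iff _ _).mp h)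
      obtain ⟨c, hc⟩ := D.exists_chart (D.p₁ (m + 2) γ)
      obtain ⟨S', hS', hγS', hle⟩ := exists_isAffineOpen_mem_and_subset
        (U := D.p₁ (m + 2) ⁻¹ᵁ c.V ⊓ D.p₂ (m + 2) ⁻¹ᵁ c.V) ⟨hc, h.subst (motive := (· ∈ c.V)) hc⟩
      exact ⟨S', hγS', c.flat_ι_comp_p₁ hS' (hle.trans inf_le_left) (hle.trans inf_le_right)⟩
  choose S' hS' hflat using key
  refine (IsZariskiLocalAtSource.iff_of_iSup_eq_top S' (top_le_iff.mp fun γ _ ↦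
    TopologicalSpace.Opens.mem_iSup.mpr ⟨γ, hS' γ⟩)).mpr hflat

end NewtonSetting

end Newton

/-! ### The groupoid structure -/

namespace Newton

namespace NewtonSetting

variable {k : Type u} [Field k] {D : NewtonSetting k} {S T : Scheme.{u}} {q₁ q₂ : S ⟶ D.X} {r : ℕ}

lemma Close.good (hq : D.Close r q₁ q₂) (hg : Good q₁) : Good q₂ := by
  rw [Good, hq.preimage_etaleLocus_eq] at hg
  exact hg

/-- The morphism to `Γ_r` given by a close pair of morphisms to `X`. -/
noncomputable def Close.lift (hq : D.Close r q₁ q₂) (hg : Good q₁)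
    (hk : q₁ ≫ D.pX = q₂ ≫ D.pX) : S ⟶ D.Γ r := (hq.exists_lift hg hk).choose

@[simp] lemma Close.lift_p₁ (hq : D.Close r q₁ q₂) (hg : Good q₁)
    (hk : q₁ ≫ D.pX = q₂ ≫ D.pX) : hq.lift hg hk ≫ D.p₁ r = q₁ :=
  (hq.exists_lift hg hk).choose_spec.1

@[simp] lemma Close.lift_p₂ (hq : D.Close r q₁ q₂) (hg : Good q₁)
    (hk : q₁ ≫ D.pX = q₂ ≫ D.pX) : hq.lift hg hk ≫ D.p₂ r = q₂ :=
  (hq.exists_lift hg hk).choose_spec.2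

lemma good_id : Good (𝟙 D.X) := good_of_flat _

lemma good_p₂ (hr : 2 ≤ r) : Good (D.p₂ r) := (close_p₁_p₂ hr).good (good_p₁ r)

/-- The unit of the groupoid `Γ_r`. -/
noncomputable def Γunit (D : NewtonSetting k) (r : ℕ) : D.X ⟶ D.Γ r :=
  (Close.refl r (𝟙 D.X)).lift good_id rfl

@[simp] lemma Γunit_p₁ : D.Γunit r ≫ D.p₁ r = 𝟙 _ := Close.lift_p₁ ..

@[simp] lemma Γunit_p₂ : D.Γunit r ≫ D.p₂ r = 𝟙 _ := Close.lift_p₂ ..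

/-- The inverse of the groupoid `Γ_r`. -/
noncomputable def Γinv (hr : 2 ≤ r) : D.Γ r ⟶ D.Γ r :=
  (close_p₁_p₂ hr).symm.lift (good_p₂ hr) (p₁_pX r).symm

@[simp] lemma Γinv_p₁ (hr : 2 ≤ r) : Γinv hr ≫ D.p₁ r = D.p₂ r := Close.lift_p₁ ..

@[simp] lemma Γinv_p₂ (hr : 2 ≤ r) : Γinv hr ≫ D.p₂ r = D.p₁ r := Close.lift_p₂ ..

lemma close_comp (hr : 2 ≤ r) (a b : T ⟶ D.Γ r) (hab : a ≫ D.p₂ r = b ≫ D.p₁ r) :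
    D.Close r (a ≫ D.p₁ r) (b ≫ D.p₂ r) := by
  have h := (close_p₁_p₂ hr).comp a
  rw [hab] at h
  exact h.trans ((close_p₁_p₂ hr).comp b)

lemma good_fst_p₁ (hr : 2 ≤ r) : Good (pullback.fst (D.p₂ r) (D.p₁ r) ≫ D.p₁ r) := by
  have := flat_p₁ (D := D) hr
  exact (good_p₁ r).comp _

/-- The composition of the groupoid `Γ_r`. -/
noncomputable def Γcomp (hr : 2 ≤ r) : pullback (D.p₂ r) (D.p₁ r) ⟶ D.Γ r :=
  (close_comp hr _ _ pullback.condition).lift (good_fst_p₁ hr) (by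
    rw [Category.assoc, Category.assoc, p₁_pX, pullback.condition_assoc, p₁_pX])

@[simp] lemma Γcomp_p₁ (hr : 2 ≤ r) : Γcomp hr ≫ D.p₁ r = pullback.fst (D.p₂ r) (D.p₁ r) ≫ D.p₁ r :=
  Close.lift_p₁ ..

@[simp] lemma Γcomp_p₂ (hr : 2 ≤ r) : Γcomp hr ≫ D.p₂ r = pullback.snd (D.p₂ r) (D.p₁ r) ≫ D.p₂ r :=
  Close.lift_p₂ ..

/-- The composite of two composable `T`-points of `Γ_r`. -/
noncomputable abbrev Γmul (hr : 2 ≤ r) (a b : T ⟶ D.Γ r) (hab : a ≫ D.p₂ r = b ≫ D.p₁ r) :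
    T ⟶ D.Γ r := pullback.lift a b hab ≫ Γcomp hr

lemma Γmul_p₁ (hr : 2 ≤ r) (a b : T ⟶ D.Γ r) (hab : a ≫ D.p₂ r = b ≫ D.p₁ r) :
    Γmul hr a b hab ≫ D.p₁ r = a ≫ D.p₁ r := by
  rw [Γmul, Category.assoc, Γcomp_p₁, pullback.lift_fst_assoc]

lemma Γmul_p₂ (hr : 2 ≤ r) (a b : T ⟶ D.Γ r) (hab : a ≫ D.p₂ r = b ≫ D.p₁ r) :
    Γmul hr a b hab ≫ D.p₂ r = b ≫ D.p₂ r := by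
  rw [Γmul, Category.assoc, Γcomp_p₂, pullback.lift_snd_assoc]

lemma comp_Γmul (hr : 2 ≤ r) (t : S ⟶ T) (a b : T ⟶ D.Γ r) (hab : a ≫ D.p₂ r = b ≫ D.p₁ r)
    (a' b' : S ⟶ D.Γ r) (ha : t ≫ a = a') (hb : t ≫ b = b') (hab' : a' ≫ D.p₂ r = b' ≫ D.p₁ r) :
    t ≫ Γmul hr a b hab = Γmul hr a' b' hab' := by
  subst ha hb
  rw [Γmul, Γmul, ← Category.assoc]
  congr 1
  apply pullback.hom_ext
  · simp only [Category.assoc, pullback.lift_fst]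
  · simp only [Category.assoc, pullback.lift_snd]

/-- Associativity on test schemes with schematically dense étale locus. -/
lemma Γmul_assoc_of_good (hr : 2 ≤ r) (a b c : T ⟶ D.Γ r) (hab : a ≫ D.p₂ r = b ≫ D.p₁ r)
    (hbc : b ≫ D.p₂ r = c ≫ D.p₁ r) (hg : Good (a ≫ D.p₁ r)) :
    Γmul hr (Γmul hr a b hab) c (by rw [Γmul_p₂, hbc]) =
      Γmul hr a (Γmul hr b c hbc) (by rw [Γmul_p₁, hab]) := by
  apply Γ_hom_ext hr
  · simp only [Γmul_p₁]
  · simp only [Γmul_p₂]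
  · simpa only [Γmul_p₁] using hg

/-- Associativity is checked on the universal composable triple, which is flat over `X`. -/
lemma Γmul_assoc (hr : 2 ≤ r) (a b c : T ⟶ D.Γ r) (hab : a ≫ D.p₂ r = b ≫ D.p₁ r)
    (hbc : b ≫ D.p₂ r = c ≫ D.p₁ r) :
    Γmul hr (Γmul hr a b hab) c (by rw [Γmul_p₂, hbc]) =
      Γmul hr a (Γmul hr b c hbc) (by rw [Γmul_p₁, hab]) := by
  have := flat_p₁ (D := D) hr
  let Q := pullback (D.p₂ r) (D.p₁ r)
  let s : Q ⟶ D.X := pullback.snd (D.p₂ r) (D.p₁ r) ≫ D.p₂ r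
  let A : pullback s (D.p₁ r) ⟶ D.Γ r := pullback.fst s (D.p₁ r) ≫ pullback.fst (D.p₂ r) (D.p₁ r)
  let B : pullback s (D.p₁ r) ⟶ D.Γ r := pullback.fst s (D.p₁ r) ≫ pullback.snd (D.p₂ r) (D.p₁ r)
  let C : pullback s (D.p₁ r) ⟶ D.Γ r := pullback.snd s (D.p₁ r)
  have hAB : A ≫ D.p₂ r = B ≫ D.p₁ r := by simp only [A, B, Category.assoc, pullback.condition]
  have hBC : B ≫ D.p₂ r = C ≫ D.p₁ r := by
    simp only [B, C, Category.assoc, ← pullback.condition, s]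
  let t : T ⟶ pullback s (D.p₁ r) := pullback.lift (pullback.lift a b hab) c (by
    simp only [s, pullback.lift_snd_assoc, hbc])
  have hA : t ≫ A = a := by
    simp only [t, A, pullback.lift_fst, pullback.lift_fst_assoc]
  have hB : t ≫ B = b := by
    simp only [t, B, pullback.lift_fst_assoc, pullback.lift_snd]
  have hC : t ≫ C = c := by simp only [t, C, pullback.lift_snd]
  have key := congrArg (t ≫ ·) (Γmul_assoc_of_good hr A B C hAB hBC ((good_p₁ r).comp A))
  rwa [comp_Γmul hr t _ _ _ _ _ (comp_Γmul hr t A B hAB a b hA hB hab) hC,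
    comp_Γmul hr t _ _ _ _ _ hA (comp_Γmul hr t B C hBC b c hB hC hbc)] at key

lemma Γunit_mul (hr : 2 ≤ r) (a : T ⟶ D.Γ r) :
    Γmul hr (a ≫ D.p₁ r ≫ D.Γunit r) a (by simp) = a := by
  have h : Γmul hr (D.p₁ r ≫ D.Γunit r) (𝟙 _) (by simp) = 𝟙 _ := by
    apply Γ_hom_ext hr
    · rw [Γmul_p₁]; simp
    · rw [Γmul_p₂]
    · rw [Γmul_p₁]; simpa using good_p₁ r
  have key := congrArg (a ≫ ·) h
  rwa [comp_Γmul hr a _ _ _ _ a rfl (Category.comp_id a), Category.comp_id] at key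

lemma Γmul_unit (hr : 2 ≤ r) (a : T ⟶ D.Γ r) :
    Γmul hr a (a ≫ D.p₂ r ≫ D.Γunit r) (by simp) = a := by
  have h : Γmul hr (𝟙 _) (D.p₂ r ≫ D.Γunit r) (by simp) = 𝟙 _ := by
    apply Γ_hom_ext hr
    · rw [Γmul_p₁]
    · rw [Γmul_p₂]; simp
    · rw [Γmul_p₁]; simpa using good_p₁ r
  have key := congrArg (a ≫ ·) h
  rwa [comp_Γmul hr a _ _ _ a _ (Category.comp_id a) rfl, Category.comp_id] at key

lemma Γinv_mul (hr : 2 ≤ r) (a : T ⟶ D.Γ r) :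
    Γmul hr (a ≫ Γinv hr) a (by simp) = a ≫ D.p₂ r ≫ D.Γunit r := by
  have h : Γmul hr (Γinv hr) (𝟙 _) (by simp) = D.p₂ r ≫ D.Γunit r := by
    apply Γ_hom_ext hr
    · rw [Γmul_p₁]; simp
    · rw [Γmul_p₂]; simp
    · rw [Γmul_p₁]; simpa using good_p₂ hr
  have key := congrArg (a ≫ ·) h
  rwa [comp_Γmul hr a _ _ _ _ a rfl (Category.comp_id a)] at key

lemma Γmul_inv (hr : 2 ≤ r) (a : T ⟶ D.Γ r) :
    Γmul hr a (a ≫ Γinv hr) (by simp) = a ≫ D.p₁ r ≫ D.Γunit r := by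
  have h : Γmul hr (𝟙 _) (Γinv hr) (by simp) = D.p₁ r ≫ D.Γunit r := by
    apply Γ_hom_ext hr
    · rw [Γmul_p₁]; simp
    · rw [Γmul_p₂]; simp
    · rw [Γmul_p₁]; simpa using good_p₁ r
  have key := congrArg (a ≫ ·) h
  rwa [comp_Γmul hr a _ _ _ a _ (Category.comp_id a) rfl] at key

/-- The groupoid structure on `Γ_r`. -/
noncomputable def groupoid (D : NewtonSetting k) (hr : 2 ≤ r) :
    SchemeGroupoid (D.p₁ r) (D.p₂ r) where
  comp := Γcomp hr
  unit := D.Γunit r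
  inv := Γinv hr
  comp_source := Γcomp_p₁ hr
  comp_target := Γcomp_p₂ hr
  unit_source := Γunit_p₁
  unit_target := Γunit_p₂
  inv_source := Γinv_p₁ hr
  inv_target := Γinv_p₂ hr
  assoc := Γmul_assoc hr
  unit_comp := Γunit_mul hr
  comp_unit := Γmul_unit hr
  inv_comp := Γinv_mul hr
  comp_inv := Γmul_inv hr

lemma _root_.Newton.SchemeGroupoid.eq_of_eq {X Γ : Scheme.{u}} {p₁ p₂ : Γ ⟶ X}
    {G H : SchemeGroupoid p₁ p₂} (hc : G.comp = H.comp) (hu : G.unit = H.unit)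
    (hi : G.inv = H.inv) : G = H := by
  cases G; cases H
  dsimp only at hc hu hi
  subst hc hu hi
  rfl

/-- The groupoid structure is unique, because the structure morphisms have schematically dense étale
locus in their sources, by flatness of `p₁`, and are therefore determined by the composites with the
projections. -/
lemma groupoid_unique (hr : 2 ≤ r) (H : SchemeGroupoid (D.p₁ r) (D.p₂ r)) : H = D.groupoid hr := by
  apply SchemeGroupoid.eq_of_eq
  · refine Γ_hom_ext hr (H.comp_source.trans (D.groupoid hr).comp_source.symm)
      (H.comp_target.trans (D.groupoid hr).comp_target.symm) ?_
    rw [H.comp_source]; exact good_fst_p₁ hr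
  · refine Γ_hom_ext hr (H.unit_source.trans (D.groupoid hr).unit_source.symm)
      (H.unit_target.trans (D.groupoid hr).unit_target.symm) ?_
    rw [H.unit_source]; exact good_id
  · refine Γ_hom_ext hr (H.inv_source.trans (D.groupoid hr).inv_source.symm)
      (H.inv_target.trans (D.groupoid hr).inv_target.symm) ?_
    rw [H.inv_source]; exact good_p₂ hr

/-- The morphism `Γ_{r+1} ⟶ Γ_r`. -/
noncomputable def transition (D : NewtonSetting k) (hr : 2 ≤ r) : D.Γ (r + 1) ⟶ D.Γ r :=
  ((close_p₁_p₂ (by omega)).mono (Nat.le_succ r)).lift (good_p₁ _) (p₁_pX _)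

@[simp] lemma transition_p₁ (hr : 2 ≤ r) : D.transition hr ≫ D.p₁ r = D.p₁ (r + 1) :=
  Close.lift_p₁ ..

@[simp] lemma transition_p₂ (hr : 2 ≤ r) : D.transition hr ≫ D.p₂ r = D.p₂ (r + 1) :=
  Close.lift_p₂ ..

lemma transition_π (hr : 2 ≤ r) : D.transition hr ≫ D.π r = D.π (r + 1) :=
  pullback.hom_ext ((Category.assoc _ _ _).trans (transition_p₁ hr))
    ((Category.assoc _ _ _).trans (transition_p₂ hr))

lemma eq_transition (hr : 2 ≤ r) (g : D.Γ (r + 1) ⟶ D.Γ r) (hg : g ≫ D.π r = D.π (r + 1)) :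
    g = D.transition hr := by
  have h₁ : g ≫ D.p₁ r = D.p₁ (r + 1) := by rw [p₁, ← Category.assoc, hg, p₁]
  have h₂ : g ≫ D.p₂ r = D.p₂ (r + 1) := by rw [p₂, ← Category.assoc, hg, p₂]
  exact Γ_hom_ext hr (h₁.trans (transition_p₁ hr).symm) (h₂.trans (transition_p₂ hr).symm)
    (h₁ ▸ good_p₁ _)

lemma Γunit_transition (hr : 2 ≤ r) : D.Γunit (r + 1) ≫ D.transition hr = D.Γunit r :=
  Γ_hom_ext hr (by simp) (by simp) (by simpa using good_id)

lemma isHom_transition (hr : 2 ≤ r) (hr' : 2 ≤ r + 1) :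
    (D.groupoid hr').IsHom (D.groupoid hr) (D.transition hr) where
  source := transition_p₁ hr
  target := transition_p₂ hr
  unit := Γunit_transition hr
  inv := by
    change Γinv hr' ≫ D.transition hr = D.transition hr ≫ Γinv hr
    exact Γ_hom_ext hr (by simp) (by simp) (by simpa using good_p₂ hr')
  comp := by
    change Γcomp hr' ≫ D.transition hr = Γmul hr _ _ _
    refine Γ_hom_ext hr ?_ ?_ ?_
    · rw [Γmul_p₁]; simp
    · rw [Γmul_p₂]; simp
    · simpa using good_fst_p₁ hr'

end NewtonSetting

end Newton

/-! ### The transition morphism over the different -/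

namespace Newton

namespace NewtonSetting

variable {k : Type u} [Field k] {D : NewtonSetting k} {S T : Scheme.{u}} {q₁ q₂ : S ⟶ D.X} {r : ℕ}

lemma Chart.appLE_comp_ιΔ (c : Chart D) {q : S ⟶ D.X} (w : S ⟶ D.Δ) (hq : q = w ≫ D.ιΔ)
    {S' : S.Opens} (e : S' ≤ q ⁻¹ᵁ c.V) : (q.appLE c.V S' e).hom c.g = 0 := by
  subst hq
  have h : (D.ιΔ.app c.V).hom c.g = 0 := by
    have h1 : c.g ∈ D.IΔ.ideal ⟨c.V, c.isAffineOpen_V⟩ := by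
      rw [c.IΔ_ideal c.isAffineOpen_V le_rfl]
      refine Ideal.mem_span_singleton'.mpr ⟨1, ?_⟩
      simp [Chart.gOn]
    rw [← D.IΔ.ker_subschemeι, Scheme.Hom.ker_apply] at h1
    exact h1
  have h2 : (D.ιΔ.appLE c.V (D.ιΔ ⁻¹ᵁ c.V) le_rfl).hom c.g = 0 := by
    rw [← Scheme.Hom.app_eq_appLE]; exact h
  rw [← appLE_appLE_apply w D.ιΔ le_rfl e e]
  exact (congrArg _ h2).trans (map_zero _)

lemma pullDifferent_comp_ιΔ {q : S ⟶ D.X} (w : S ⟶ D.Δ) (hq : q = w ≫ D.ιΔ) (s : S) :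
    D.pullDifferent q s = ⊥ := by
  obtain ⟨c, hc⟩ := D.exists_chart (q s)
  rw [c.pullDifferent_eq q hc, pullGerm_eq_germ q (S' := q ⁻¹ᵁ c.V) le_rfl hc hc,
    c.appLE_comp_ιΔ w hq, map_zero, Ideal.span_singleton_zero]

/-- Close morphisms agree on the preimage of the different. -/
lemma Close.eq_of_comp_ιΔ (hr : 2 ≤ r) (hq : D.Close r q₁ q₂) (w : S ⟶ D.Δ)
    (hw : q₁ = w ≫ D.ιΔ) : q₁ = q₂ := by
  have hd := pullDifferent_comp_ιΔ w hw
  refine Scheme.hom_ext_of_forall _ _ fun s ↦ ?_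
  have hs : q₁ s = q₂ s := (hq.eq_top_or s).resolve_left fun h ↦ by
    rw [hd] at h; exact bot_ne_top h
  obtain ⟨V, hV, hsV, -⟩ := exists_isAffineOpen_mem_and_subset (U := ⊤) (x := q₁ s) trivial
  have hsV₂ : q₂ s ∈ V := hs ▸ hsV
  refine ⟨q₁ ⁻¹ᵁ V ⊓ q₂ ⁻¹ᵁ V, ⟨hsV, hsV₂⟩,
    ι_comp_eq_of_appLE_eq q₁ q₂ hV inf_le_left inf_le_right fun b ↦ ?_⟩
  refine TopCat.Presheaf.section_ext S.sheaf _ _ _ fun x hx ↦ ?_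
  have h := hq.sub_mem x V hx.1 hx.2 b
  rw [hd, Ideal.bot_pow (by omega), Ideal.mem_bot, sub_eq_zero] at h
  exact (pullGerm_eq_germ q₁ inf_le_left hx hx.1 b).symm.trans
    (h.trans (pullGerm_eq_germ q₂ inf_le_right hx hx.2 b))

lemma Γunit_π : D.Γunit r ≫ D.π r = pullback.diagonal D.pX :=
  pullback.hom_ext (((Category.assoc _ _ _).trans Γunit_p₁).trans (pullback.diagonal_fst _).symm)
    (((Category.assoc _ _ _).trans Γunit_p₂).trans (pullback.diagonal_snd _).symm)

lemma I₂_le : D.I₂ ≤ (pullback.diagonal D.pX).ker := by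
  have h : pullback.diagonal D.φ ≫ D.fiberProductι = pullback.diagonal D.pX := by
    apply pullback.hom_ext
    · rw [Category.assoc, ← pr₁, fiberProductι_pr₁, pullback.diagonal_fst, pullback.diagonal_fst]
    · rw [Category.assoc, ← pr₂, fiberProductι_pr₂, pullback.diagonal_snd, pullback.diagonal_snd]
  rw [I₂, ← h]
  exact Scheme.Hom.le_ker_comp _ _

section Generators

variable {q : D.XX ⟶ D.X} {I : D.XX.IdealSheafData} (hJ : ∀ W, ((D.IΔ.comap q).ideal W).FG)
  (n : ℕ) {W : D.XX.Opens} (hW : IsAffineOpen W) (c : Chart D) (h : W ≤ q ⁻¹ᵁ c.V)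
  {b : Γ(D.Γ r, D.π r ⁻¹ᵁ W)}
  (hb : ((D.𝒜 r).fromSource.appLE _ _ ((D.𝒜 r).preimage_le_fromSource ⟨W, hW⟩)).hom b ∈
    (twist (ν := D.j) I (D.IΔ.comap q) hJ n).carrier ⟨W, hW⟩)

include h hb in
/-- The generators of `𝒜_r` become divisible by the equation of the different in `𝒜_{r+1}`. -/
lemma exists_transition_eq_mul (hr : 2 ≤ r) {n' : ℕ} (hn : n' = n + 1)
    (hq : ∀ u, q (D.j u) ∈ etaleLocus D.φ)
    (hA : ∀ W, (twist (ν := D.j) I (D.IΔ.comap q) hJ n').carrier W ⊆ (D.𝒜 (r + 1)).ring W)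
    (hg : Good (D.π (r + 1) ≫ q)) (e : D.π (r + 1) ⁻¹ᵁ W ≤ (D.π (r + 1) ≫ q) ⁻¹ᵁ c.V)
    (ef : D.π (r + 1) ⁻¹ᵁ W ≤ D.transition hr ⁻¹ᵁ (D.π r ⁻¹ᵁ W)) :
    ∃ ρ, ((D.transition hr).appLE _ _ ef).hom b =
      ((D.π (r + 1) ≫ q).appLE c.V _ e).hom c.g * ρ := by
  subst hn
  have e₀ : D.π r ⁻¹ᵁ W ≤ (D.π r ≫ q) ⁻¹ᵁ c.V := (D.π r).preimage_mono h
  obtain ⟨i, hi, hib⟩ : ∃ i ∈ I.ideal ⟨W, hW⟩,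
      ((D.π r ≫ q).appLE c.V (D.π r ⁻¹ᵁ W) e₀).hom c.g ^ n * b =
        ((D.π r).appLE W (D.π r ⁻¹ᵁ W) le_rfl).hom i :=
    c.exists_eq_pow_mul (D.𝒜 r) hJ n hW h e₀ b hb
  obtain ⟨ρ, hρ⟩ : ∃ ρ, ((D.π (r + 1) ≫ q).appLE c.V (D.π (r + 1) ⁻¹ᵁ W) e).hom c.g ^ (n + 1) * ρ =
      ((D.π (r + 1)).appLE W (D.π (r + 1) ⁻¹ᵁ W) le_rfl).hom i :=
    c.exists_pow_mul_eq hq (D.𝒜 (r + 1)) hJ (n + 1) hA hW h e hi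
  refine ⟨ρ, ?_⟩
  have h1 := congrArg ((D.transition hr).appLE _ _ ef).hom hib
  rw [map_mul, map_pow] at h1
  have h2 := appLE_appLE_apply (D.transition hr) (D.π r ≫ q) e₀ ef
    (by rw [← Category.assoc, transition_π]; exact e) c.g
  have h3 := appLE_appLE_apply (D.transition hr) (D.π r) le_rfl ef
    (by rw [transition_π]) i
  have h2' := h2.trans (ConcreteCategory.congr_hom (appLE_eq_of_eq
    (by rw [← Category.assoc, transition_π]) _ e) c.g)
  have h3' := h3.trans (ConcreteCategory.congr_hom (appLE_eq_of_eq (transition_π hr) _ le_rfl) i)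
  refine (mul_cancel_left_mem_nonZeroDivisors (pow_mem (hg.mem_nonZeroDivisors c e) n)).mp ?_
  rw [← mul_assoc, ← pow_succ]
  refine Eq.trans ?_ hρ.symm
  refine Eq.trans ?_ h3'
  refine Eq.trans ?_ h1
  exact congrArg (fun x ↦ x ^ n * _) h2'.symm

include h hb in
/-- The generators of `𝒜_r` vanish at the unit. -/
lemma unit_generator_eq_zero (hI : I ≤ (pullback.diagonal D.pX).ker)
    (hg : Good (D.Γunit r ≫ D.π r ≫ q)) :
    ((D.Γunit r).app (D.π r ⁻¹ᵁ W)).hom b = 0 := by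
  have e₀ : D.π r ⁻¹ᵁ W ≤ (D.π r ≫ q) ⁻¹ᵁ c.V := (D.π r).preimage_mono h
  obtain ⟨i, hi, hib⟩ : ∃ i ∈ I.ideal ⟨W, hW⟩,
      ((D.π r ≫ q).appLE c.V (D.π r ⁻¹ᵁ W) e₀).hom c.g ^ n * b =
        ((D.π r).appLE W (D.π r ⁻¹ᵁ W) le_rfl).hom i :=
    c.exists_eq_pow_mul (D.𝒜 r) hJ n hW h e₀ b hb
  have h1 := congrArg ((D.Γunit r).appLE _ _ le_rfl).hom hib
  rw [map_mul, map_pow] at h1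
  have e₁ : D.Γunit r ⁻¹ᵁ (D.π r ⁻¹ᵁ W) ≤ (D.Γunit r ≫ D.π r ≫ q) ⁻¹ᵁ c.V :=
    (D.Γunit r).preimage_mono e₀
  have h2 := appLE_appLE_apply (D.Γunit r) (D.π r ≫ q) e₀ le_rfl e₁ c.g
  have h3 : ((D.Γunit r).appLE _ (D.Γunit r ⁻¹ᵁ (D.π r ⁻¹ᵁ W)) le_rfl).hom
      (((D.π r).appLE W _ le_rfl).hom i) = 0 := by
    refine (appLE_appLE_apply (D.Γunit r) (D.π r) le_rfl le_rfl le_rfl i).trans ?_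
    have h4 : (((D.Γunit r ≫ D.π r)).app W).hom i = 0 := by
      have := hI ⟨W, hW⟩ hi
      rw [Scheme.Hom.ker_apply] at this
      rw [Γunit_π]
      exact this
    rw [Scheme.Hom.app_eq_appLE] at h4
    exact h4
  rw [Scheme.Hom.app_eq_appLE]
  refine (mul_left_mem_nonZeroDivisors_eq_zero_iff (pow_mem (hg.mem_nonZeroDivisors c e₁) n)).mp ?_
  refine Eq.trans (congrArg (fun x ↦ x ^ n * _) h2.symm) ?_
  exact h1.trans h3

include h hb in
/-- The generators of `𝒜_r` do not distinguish the transition of a point over the different from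
the unit: they vanish on both. -/
lemma transition_generator_eq (hr : 2 ≤ r) {n' : ℕ} (hn : n' = n + 1)
    (hq : ∀ u, q (D.j u) ∈ etaleLocus D.φ)
    (hA : ∀ W, (twist (ν := D.j) I (D.IΔ.comap q) hJ n').carrier W ⊆ (D.𝒜 (r + 1)).ring W)
    (hI : I ≤ (pullback.diagonal D.pX).ker) (hg : Good (D.π (r + 1) ≫ q))
    (hg' : Good (D.Γunit r ≫ D.π r ≫ q)) (t : S ⟶ D.Γ (r + 1)) (w : S ⟶ D.Δ)
    (ht : t ≫ D.π (r + 1) ≫ q = w ≫ D.ιΔ)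
    (e : t ⁻¹ᵁ (D.π (r + 1) ⁻¹ᵁ W) ≤ (t ≫ D.transition hr) ⁻¹ᵁ (D.π r ⁻¹ᵁ W))
    (e' : t ⁻¹ᵁ (D.π (r + 1) ⁻¹ᵁ W) ≤ (w ≫ D.ιΔ ≫ D.Γunit r) ⁻¹ᵁ (D.π r ⁻¹ᵁ W)) :
    ((t ≫ D.transition hr).appLE _ _ e).hom b = ((w ≫ D.ιΔ ≫ D.Γunit r).appLE _ _ e').hom b := by
  have ef : D.π (r + 1) ⁻¹ᵁ W ≤ D.transition hr ⁻¹ᵁ (D.π r ⁻¹ᵁ W) := by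
    rw [← Scheme.Hom.comp_preimage, transition_π]
  have e₁ : D.π (r + 1) ⁻¹ᵁ W ≤ (D.π (r + 1) ≫ q) ⁻¹ᵁ c.V := (D.π (r + 1)).preimage_mono h
  have e₂ : t ⁻¹ᵁ (D.π (r + 1) ⁻¹ᵁ W) ≤ (t ≫ D.π (r + 1) ≫ q) ⁻¹ᵁ c.V := t.preimage_mono e₁
  obtain ⟨ρ, hρ⟩ := exists_transition_eq_mul hJ n hW c h hb hr hn hq hA hg e₁ ef
  have h₀ := unit_generator_eq_zero hJ n hW c h hb hI hg'
  rw [Scheme.Hom.app_eq_appLE] at h₀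
  -- both sides vanish
  trans 0
  · refine (appLE_appLE_apply t (D.transition hr) ef le_rfl e b).symm.trans ?_
    refine (congrArg _ hρ).trans ?_
    rw [map_mul]
    have h₁ := appLE_appLE_apply t (D.π (r + 1) ≫ q) e₁ le_rfl e₂ c.g
    rw [c.appLE_comp_ιΔ w ht] at h₁
    rw [h₁, zero_mul]
  · have hS' : t ⁻¹ᵁ (D.π (r + 1) ⁻¹ᵁ W) ≤ ((w ≫ D.ιΔ) ≫ D.Γunit r) ⁻¹ᵁ (D.π r ⁻¹ᵁ W) := by
      rwa [Category.assoc]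
    have h1 := appLE_appLE_apply (w ≫ D.ιΔ) (D.Γunit r) le_rfl
      (V := D.Γunit r ⁻¹ᵁ (D.π r ⁻¹ᵁ W)) hS' hS' b
    have h2 := ConcreteCategory.congr_hom
      (appLE_eq_of_eq (Category.assoc w D.ιΔ (D.Γunit r)) hS' e') b
    refine Eq.symm ((h2.symm.trans h1.symm).trans ?_)
    exact (congrArg _ h₀).trans (map_zero _)

end Generators

lemma Γ_hom_ext_of_generators {t t' : S ⟶ D.Γ r} (h : t ≫ D.π r = t' ≫ D.π r)
    (H : ∀ s : S, ∃ (W : D.XX.Opens) (hW : IsAffineOpen W) (S' : S.Opens), s ∈ S' ∧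
      ∃ (e : S' ≤ t ⁻¹ᵁ (D.π r ⁻¹ᵁ W)) (e' : S' ≤ t' ⁻¹ᵁ (D.π r ⁻¹ᵁ W)),
      ∀ b : Γ(D.Γ r, D.π r ⁻¹ᵁ W),
        ((D.𝒜 r).fromSource.appLE _ _ ((D.𝒜 r).preimage_le_fromSource ⟨W, hW⟩)).hom b ∈
          (D.family r).carrier ⟨W, hW⟩ →
        (t.appLE _ S' e).hom b = (t'.appLE _ S' e').hom b) : t = t' :=
  (D.𝒜 r).hom_ext_of_generators (fun W ↦ (D.family r).carrier W) (fun _ ↦ rfl) h fun s ↦ by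
    obtain ⟨W, hW, S', hs, e, e', h⟩ := H s
    exact ⟨⟨W, hW⟩, S', hs, e, e', h⟩

/-- The transition morphism contracts the preimage of the different to the unit. -/
lemma transition_eq_of_p₁ (hr : 2 ≤ r) (t : S ⟶ D.Γ (r + 1)) (w : S ⟶ D.Δ)
    (ht : t ≫ D.p₁ (r + 1) = w ≫ D.ιΔ) : t ≫ D.transition hr = w ≫ D.ιΔ ≫ D.Γunit r := by
  have hr' : 2 ≤ r + 1 := by omega
  have ht₂ : t ≫ D.p₂ (r + 1) = w ≫ D.ιΔ :=
    (((close_p₁_p₂ hr').comp t).eq_of_comp_ιΔ hr' w ht).symm.trans ht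
  have hπ : (t ≫ D.transition hr) ≫ D.π r = (w ≫ D.ιΔ ≫ D.Γunit r) ≫ D.π r := by
    rw [Category.assoc, transition_π, Category.assoc, Category.assoc, Γunit_π]
    apply pullback.hom_ext
    · rw [Category.assoc, Category.assoc, Category.assoc, pullback.diagonal_fst, Category.comp_id]
      exact ht
    · rw [Category.assoc, Category.assoc, Category.assoc, pullback.diagonal_snd, Category.comp_id]
      exact ht₂
  refine Γ_hom_ext_of_generators hπ fun s ↦ ?_
  have hs₂ : D.p₂ (r + 1) (t s) = D.p₁ (r + 1) (t s) := by
    rw [← Scheme.Hom.comp_apply, ← Scheme.Hom.comp_apply, ht, ht₂]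
  obtain ⟨c, hc⟩ := D.exists_chart (D.p₁ (r + 1) (t s))
  have hc₂ : D.p₂ (r + 1) (t s) ∈ c.V := hs₂ ▸ hc
  obtain ⟨W, hW, hsW, hWV⟩ := exists_isAffineOpen_mem_and_subset
    (U := D.pr₁ ⁻¹ᵁ c.V ⊓ D.pr₂ ⁻¹ᵁ c.V) (x := D.π (r + 1) (t s)) ⟨hc, hc₂⟩
  have e₁ : W ≤ D.pr₁ ⁻¹ᵁ c.V := hWV.trans inf_le_left
  have e₂ : W ≤ D.pr₂ ⁻¹ᵁ c.V := hWV.trans inf_le_right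
  have e : t ⁻¹ᵁ (D.π (r + 1) ⁻¹ᵁ W) ≤ (t ≫ D.transition hr) ⁻¹ᵁ (D.π r ⁻¹ᵁ W) := by
    rw [← Scheme.Hom.comp_preimage, ← Scheme.Hom.comp_preimage, Category.assoc, transition_π]
  have e' : t ⁻¹ᵁ (D.π (r + 1) ⁻¹ᵁ W) ≤ (w ≫ D.ιΔ ≫ D.Γunit r) ⁻¹ᵁ (D.π r ⁻¹ᵁ W) := by
    rw [← Scheme.Hom.comp_preimage, ← Scheme.Hom.comp_preimage, ← hπ, Category.assoc, transition_π]
  have hg₁ : Good (D.Γunit r ≫ D.π r ≫ D.pr₁) := by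
    rw [show D.Γunit r ≫ D.π r ≫ D.pr₁ = 𝟙 _ from Γunit_p₁]; exact good_id
  have hg₂ : Good (D.Γunit r ≫ D.π r ≫ D.pr₂) := by
    rw [show D.Γunit r ≫ D.π r ≫ D.pr₂ = 𝟙 _ from Γunit_p₂]; exact good_id
  refine ⟨W, hW, t ⁻¹ᵁ (D.π (r + 1) ⁻¹ᵁ W), hsW, e, e', fun b hb ↦ ?_⟩
  rcases hb with (hb | hb) | (hb | hb)
  · exact transition_generator_eq D.D₁_fg _ hW c e₁ hb hr (by omega) D.pr₁_j_mem
      (fun W _ hf ↦ subset_ring_𝒜 _ W (.inl (.inl hf))) le_rfl (good_p₁ _) hg₁ t w ht e e'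
  · exact transition_generator_eq D.D₁_fg _ hW c e₁ hb hr (by omega) D.pr₁_j_mem
      (fun W _ hf ↦ subset_ring_𝒜 _ W (.inl (.inr hf))) I₂_le (good_p₁ _) hg₁ t w ht e e'
  · exact transition_generator_eq D.D₂_fg _ hW c e₂ hb hr (by omega) D.pr₂_j_mem
      (fun W _ hf ↦ subset_ring_𝒜 _ W (.inr (.inl hf))) le_rfl (good_p₂ hr') hg₂ t w ht₂ e e'
  · exact transition_generator_eq D.D₂_fg _ hW c e₂ hb hr (by omega) D.pr₂_j_mem
      (fun W _ hf ↦ subset_ring_𝒜 _ W (.inr (.inr hf))) I₂_le (good_p₂ hr') hg₂ t w ht₂ e e'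

end NewtonSetting

end Newton

/-! ### Lifting along the transition morphism -/

namespace Newton

namespace NewtonSetting

variable {k : Type u} [Field k] {D : NewtonSetting k} {S : Scheme.{u}} {r : ℕ}

/-- The morphism `a : S ⟶ Γ_r` contracts the preimage of the different to the unit. -/
abbrev Contracts (a : S ⟶ D.Γ r) : Prop :=
  pullback.fst (a ≫ D.p₁ r) D.ιΔ ≫ a = pullback.snd (a ≫ D.p₁ r) D.ιΔ ≫ D.ιΔ ≫ D.Γunit r

/-- Functions that vanish at the unit pull back into the ideal of the different, along a morphism
that contracts the preimage of the different to the unit. -/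
lemma Contracts.appLE_mem {a : S ⟶ D.Γ r} (ha : Contracts a) {S' : (D.Γ r).Opens} {u : Γ(D.Γ r, S')}
    (hu : ((D.Γunit r).app S').hom u = 0) {T' : S.Opens} (hT' : IsAffineOpen T')
    (e : T' ≤ a ⁻¹ᵁ S') :
    (a.appLE S' T' e).hom u ∈ (D.IΔ.comap (a ≫ D.p₁ r)).ideal ⟨T', hT'⟩ := by
  rw [Scheme.IdealSheafData.comap, Scheme.Hom.ker_apply, RingHom.mem_ker]
  set f := pullback.fst (a ≫ D.p₁ r) D.ιΔ
  set w := pullback.snd (a ≫ D.p₁ r) D.ιΔ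
  have e₁ : f ⁻¹ᵁ T' ≤ (f ≫ a) ⁻¹ᵁ S' := f.preimage_mono e
  have e₂ : f ⁻¹ᵁ T' ≤ (w ≫ D.ιΔ ≫ D.Γunit r) ⁻¹ᵁ S' := by rwa [ha] at e₁
  have e₃ : f ⁻¹ᵁ T' ≤ ((w ≫ D.ιΔ) ≫ D.Γunit r) ⁻¹ᵁ S' := by rwa [Category.assoc]
  have h₁ : (f.appLE T' (f ⁻¹ᵁ T') le_rfl).hom ((a.appLE S' T' e).hom u) =
      ((f ≫ a).appLE S' _ e₁).hom u := appLE_appLE_apply f a e le_rfl e₁ u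
  have h₂ := appLE_appLE_apply (w ≫ D.ιΔ) (D.Γunit r) le_rfl
      (V := D.Γunit r ⁻¹ᵁ S') e₃ e₃ u
  rw [← Scheme.Hom.app_eq_appLE] at h₁ h₂
  refine h₁.trans ((ConcreteCategory.congr_hom (appLE_eq_of_eq
    (ha.trans (Category.assoc _ _ _).symm) e₁ e₃) u).trans (h₂.symm.trans ?_))
  exact (congrArg _ hu).trans (map_zero _)

/-- Functions on `Γ_r` that are divisible by a power of the equation of the different and vanish at
the unit become divisible by one power more after pullback along a morphism that contracts the
preimage of the different. -/
lemma Contracts.sub_mem {a : S ⟶ D.Γ r} (ha : Contracts a) {Z : Scheme.{u}} {P₁ P₂ : D.Γ r ⟶ Z}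
    (hP : D.Γunit r ≫ P₁ = D.Γunit r ≫ P₂) {n n' : ℕ} (hn : n' = n + 1)
    (hmem : ∀ (γ : D.Γ r) (V : Z.Opens) (h₁ : P₁ γ ∈ V) (h₂ : P₂ γ ∈ V) (b : Γ(Z, V)),
      pullGerm P₁ γ h₁ b - pullGerm P₂ γ h₂ b ∈ D.pullDifferent (D.p₁ r) γ ^ n)
    (s : S) (V : Z.Opens) (h₁ : (a ≫ P₁) s ∈ V) (h₂ : (a ≫ P₂) s ∈ V) (b : Γ(Z, V)) :
    pullGerm (a ≫ P₁) s h₁ b - pullGerm (a ≫ P₂) s h₂ b ∈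
      D.pullDifferent (a ≫ D.p₁ r) s ^ n' := by
  subst hn
  obtain ⟨c, hc⟩ := D.exists_chart (D.p₁ r (a s))
  obtain ⟨S', hS', hsS', hle⟩ := exists_isAffineOpen_mem_and_subset
    (U := P₁ ⁻¹ᵁ V ⊓ P₂ ⁻¹ᵁ V ⊓ D.p₁ r ⁻¹ᵁ c.V) (x := a s) ⟨⟨h₁, h₂⟩, hc⟩
  have e₁ : S' ≤ P₁ ⁻¹ᵁ V := (hle.trans inf_le_left).trans inf_le_left
  have e₂ : S' ≤ P₂ ⁻¹ᵁ V := (hle.trans inf_le_left).trans inf_le_right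
  have ec : S' ≤ D.p₁ r ⁻¹ᵁ c.V := hle.trans inf_le_right
  obtain ⟨T', hT', hsT', e⟩ := exists_isAffineOpen_mem_and_subset (U := a ⁻¹ᵁ S') (x := s) hsS'
  set γ := ((D.p₁ r).appLE c.V S' ec).hom c.g with hγ
  obtain ⟨u, hu⟩ : ∃ u, (P₁.appLE V S' e₁).hom b - (P₂.appLE V S' e₂).hom b = γ ^ n * u := by
    refine Ideal.mem_span_singleton.mp (mem_span_pow_of_germ hS' _ γ n fun y hy ↦ ?_)
    have hy₁ : P₁ y ∈ V := e₁ hy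
    have hy₂ : P₂ y ∈ V := e₂ hy
    have hyc : D.p₁ r y ∈ c.V := ec hy
    have := hmem y V hy₁ hy₂ b
    rwa [pullGerm_eq_germ P₁ e₁ hy hy₁, pullGerm_eq_germ P₂ e₂ hy hy₂, c.pullDifferent_eq _ hyc,
      pullGerm_eq_germ _ ec hy hyc, ← map_sub] at this
  -- the quotient vanishes at the unit, because the equation of the different is regular on `X`
  have hu₀ : ((D.Γunit r).app S').hom u = 0 := by
    have hg : Good (D.Γunit r ≫ D.p₁ r) := by rw [Γunit_p₁]; exact good_id
    have ec' : D.Γunit r ⁻¹ᵁ S' ≤ (D.Γunit r ≫ D.p₁ r) ⁻¹ᵁ c.V := (D.Γunit r).preimage_mono ec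
    have e₁' : D.Γunit r ⁻¹ᵁ S' ≤ (D.Γunit r ≫ P₁) ⁻¹ᵁ V := (D.Γunit r).preimage_mono e₁
    have e₂' : D.Γunit r ⁻¹ᵁ S' ≤ (D.Γunit r ≫ P₂) ⁻¹ᵁ V := (D.Γunit r).preimage_mono e₂
    have h := congrArg ((D.Γunit r).appLE S' _ le_rfl).hom hu
    rw [map_sub, map_mul, map_pow, appLE_appLE_apply _ _ e₁ le_rfl e₁',
      appLE_appLE_apply _ _ e₂ le_rfl e₂', appLE_appLE_apply _ _ ec le_rfl ec',
      appLE_eq_of_eq hP e₁' e₂', sub_self] at h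
    rw [Scheme.Hom.app_eq_appLE]
    exact (mul_left_mem_nonZeroDivisors_eq_zero_iff
      (pow_mem (hg.mem_nonZeroDivisors c ec') n)).mp h.symm
  have ea : T' ≤ (a ≫ D.p₁ r) ⁻¹ᵁ c.V := e.trans (a.preimage_mono ec)
  have hmem' := ha.appLE_mem hu₀ hT' e
  rw [c.comap_IΔ_ideal (a ≫ D.p₁ r) hT' ea] at hmem'
  obtain ⟨v, hv⟩ := Ideal.mem_span_singleton.mp hmem'
  have hcs : (a ≫ D.p₁ r) s ∈ c.V := hc
  rw [pullGerm_comp_eq_germ a P₁ e₁ e hsT', pullGerm_comp_eq_germ a P₂ e₂ e hsT', ← map_sub,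
    ← map_sub, hu, map_mul, map_pow, hv, hγ, appLE_appLE_apply _ _ ec e ea,
    c.pullDifferent_eq _ hcs, pullGerm_eq_germ _ ea hsT' hcs, ← mul_assoc, ← pow_succ, map_mul,
    map_pow]
  exact Ideal.mul_mem_right _ _ (Ideal.pow_mem_pow (Ideal.mem_span_singleton_self _) _)

/-- If the preimage of the different is contracted to the unit, then the difference quotients that
exist on `Γ_r` gain one more factor of the equation of the different. -/
lemma Contracts.close {a : S ⟶ D.Γ r} (ha : Contracts a) (hr : 2 ≤ r) :
    D.Close (r + 1) (a ≫ D.p₁ r) (a ≫ D.p₂ r) := by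
  have hc := (close_p₁_p₂ (D := D) hr)
  refine ⟨(hc.comp a).pullDifferent_eq, (hc.comp a).eq_top_or, ?_, ?_⟩
  · exact ha.sub_mem (by simp) (n := r - 1) (by omega) hc.sub_mem
  · intro s V h₁ h₂ b
    have hP : D.Γunit r ≫ D.p₁ r ≫ D.φ = D.Γunit r ≫ D.p₂ r ≫ D.φ := by
      rw [← Category.assoc, ← Category.assoc, Γunit_p₁, Γunit_p₂]
    have := ha.sub_mem hP (n := r) rfl hc.sub_mem' s V h₁ h₂ b
    simpa only [Category.assoc] using this

/-- A morphism to `Γ_r` that contracts the preimage of the different to the unit lifts to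
`Γ_{r+1}`. -/
lemma Contracts.exists_lift {a : S ⟶ D.Γ r} (ha : Contracts a) (hr : 2 ≤ r)
    (hg : Good (a ≫ D.p₁ r)) : ∃ t : S ⟶ D.Γ (r + 1), t ≫ D.transition hr = a := by
  obtain ⟨t, h₁, h₂⟩ := (ha.close hr).exists_lift hg (by
    rw [Category.assoc, Category.assoc, p₁_pX])
  refine ⟨t, Γ_hom_ext hr ?_ ?_ ?_⟩
  · rw [Category.assoc, transition_p₁, h₁]
  · rw [Category.assoc, transition_p₂, h₂]
  · rwa [Category.assoc, transition_p₁, h₁]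

lemma contracts_iff {a : S ⟶ D.Γ r} {g : S ⟶ D.X} (h : a ≫ D.p₁ r = g) :
    Contracts a ↔ pullback.fst g D.ιΔ ≫ a = pullback.snd g D.ιΔ ≫ D.ιΔ ≫ D.Γunit r := by
  subst h; rfl

lemma contracts_transition (hr : 2 ≤ r) (t : S ⟶ D.Γ (r + 1)) :
    Contracts (t ≫ D.transition hr) := by
  refine (contracts_iff (g := t ≫ D.p₁ (r + 1)) (by rw [Category.assoc, transition_p₁])).mpr ?_
  refine (Category.assoc _ _ _).symm.trans (transition_eq_of_p₁ hr _ _ ?_)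
  rw [← pullback.condition, Category.assoc]

lemma p₁_eq_comp_ιΔ {T : Scheme.{u}} {t : T ⟶ D.Γ r} {w : T ⟶ D.Δ} (hr : 2 ≤ r)
    (h : t ≫ D.p₂ r = w ≫ D.ιΔ) : t ≫ D.p₁ r = w ≫ D.ιΔ :=
  (((close_p₁_p₂ hr).symm.comp t).eq_of_comp_ιΔ hr w h).symm.trans h

lemma p₂_eq_comp_ιΔ {T : Scheme.{u}} {t : T ⟶ D.Γ r} {w : T ⟶ D.Δ} (hr : 2 ≤ r)
    (h : t ≫ D.p₁ r = w ≫ D.ιΔ) : t ≫ D.p₂ r = w ≫ D.ιΔ :=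
  (((close_p₁_p₂ hr).comp t).eq_of_comp_ιΔ hr w h).symm.trans h

/-- The condition that the preimage of the different is contracted to the unit does not depend on
the choice of the projection. -/
lemma contracts_iff' (hr : 2 ≤ r) {a : S ⟶ D.Γ r} {g : S ⟶ D.X} (h : a ≫ D.p₂ r = g) :
    Contracts a ↔ pullback.fst g D.ιΔ ≫ a = pullback.snd g D.ιΔ ≫ D.ιΔ ≫ D.Γunit r := by
  subst h
  constructor <;> intro h
  · have h' : (pullback.fst (a ≫ D.p₂ r) D.ιΔ ≫ a) ≫ D.p₁ r =
        pullback.snd (a ≫ D.p₂ r) D.ιΔ ≫ D.ιΔ := p₁_eq_comp_ιΔ hr (by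
      rw [Category.assoc, pullback.condition])
    have := congrArg (pullback.lift (pullback.fst (a ≫ D.p₂ r) D.ιΔ)
      (pullback.snd (a ≫ D.p₂ r) D.ιΔ)
      (by rw [← h', Category.assoc]) ≫ ·) h
    simpa only [pullback.lift_fst_assoc, pullback.lift_snd_assoc] using this
  · have h' : (pullback.fst (a ≫ D.p₁ r) D.ιΔ ≫ a) ≫ D.p₂ r =
        pullback.snd (a ≫ D.p₁ r) D.ιΔ ≫ D.ιΔ := p₂_eq_comp_ιΔ hr (by
      rw [Category.assoc, pullback.condition])
    have := congrArg (pullback.lift (pullback.fst (a ≫ D.p₁ r) D.ιΔ)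
      (pullback.snd (a ≫ D.p₁ r) D.ιΔ)
      (by rw [← h', Category.assoc]) ≫ ·) h
    simpa only [pullback.lift_fst_assoc, pullback.lift_snd_assoc] using this

lemma hom_ext_transition (hr : 2 ≤ r) {h h' : S ⟶ D.Γ (r + 1)} (hg : Good (h ≫ D.p₁ (r + 1)))
    (H : h ≫ D.transition hr = h' ≫ D.transition hr) : h = h' := by
  refine Γ_hom_ext (by omega) ?_ ?_ hg
  · rw [← transition_p₁ hr, ← Category.assoc, H, Category.assoc]
  · rw [← transition_p₂ hr, ← Category.assoc, H, Category.assoc]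

lemma exists_lift_iff (hr : 2 ≤ r) (a : S ⟶ D.Γ r) (hg : Good (a ≫ D.p₁ r)) :
    (∃ t : S ⟶ D.Γ (r + 1), t ≫ D.transition hr = a) ↔ Contracts a :=
  ⟨fun ⟨t, ht⟩ ↦ ht ▸ contracts_transition hr t, fun ha ↦ ha.exists_lift hr hg⟩

lemma good_p₁_of_flat_p₂ (hr : 2 ≤ r) {a : S ⟶ D.Γ r} (h : Flat (a ≫ D.p₂ r)) :
    Good (a ≫ D.p₁ r) :=
  ((close_p₁_p₂ hr).symm.comp a).good (good_of_flat _)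

end NewtonSetting

end Newton

/-! ### The affine blow-up -/

namespace Newton

namespace NewtonSetting

variable {k : Type u} [Field k] {D : NewtonSetting k} {S : Scheme.{u}} {r : ℕ}

instance isAffineHom_π (r : ℕ) : IsAffineHom (D.π r) := (D.𝒜 r).isAffineHom_toBase

instance isAffineHom_transition (hr : 2 ≤ r) : IsAffineHom (D.transition hr) :=
  MorphismProperty.of_postcomp (W := @IsAffineHom) (W' := @IsSeparated) _ (D.π r) inferInstance
    (by rw [transition_π]; infer_instance)

/-- The two preimages of the different in `Γ_r` agree, because the projections of `Γ_r` agree over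
the different. -/
lemma IΔ_comap_p₁_eq (hr : 2 ≤ r) : D.IΔ.comap (D.p₁ r) = D.IΔ.comap (D.p₂ r) := by
  have key {q q' : D.Γ r ⟶ D.X} (h : pullback.fst q D.ιΔ ≫ q' = pullback.snd q D.ιΔ ≫ D.ιΔ) :
      D.IΔ.comap q' ≤ D.IΔ.comap q := by
    rw [Scheme.IdealSheafData.comap, Scheme.IdealSheafData.comap, ← pullback.lift_fst _ _ h]
    exact Scheme.Hom.le_ker_comp _ _
  exact le_antisymm (key (p₁_eq_comp_ιΔ hr pullback.condition))
    (key (p₂_eq_comp_ιΔ hr pullback.condition))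

instance isClosedImmersion_Γunit (r : ℕ) : IsClosedImmersion (D.Γunit r) := by
  have := D.isSeparated_X
  have : IsSeparated (D.p₁ r) := by rw [p₁]; infer_instance
  have : IsClosedImmersion (D.Γunit r ≫ D.p₁ r) := by rw [Γunit_p₁]; infer_instance
  exact .of_comp _ (D.p₁ r)

/-- The contraction of the preimage of the different to the unit, in terms of ideals: the ideal of
the unit over the different pulls back into the ideal of the preimage of the different. -/
lemma contracts_iff_ker_le (a : S ⟶ D.Γ r) :
    Contracts a ↔ (D.ιΔ ≫ D.Γunit r).ker ≤ (D.IΔ.comap (a ≫ D.p₁ r)).map a := by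
  rw [Scheme.IdealSheafData.comap, Scheme.IdealSheafData.map_ker]
  refine ⟨fun h ↦ h.symm ▸ Scheme.Hom.le_ker_comp _ _, fun h ↦ ?_⟩
  have hl := IsClosedImmersion.lift_fac (D.ιΔ ≫ D.Γunit r) _ h
  set l := IsClosedImmersion.lift (D.ιΔ ≫ D.Γunit r) _ h
  have : l = pullback.snd (a ≫ D.p₁ r) D.ιΔ := by
    rw [← cancel_mono D.ιΔ, ← pullback.condition]
    have := congrArg (· ≫ D.p₁ r) hl
    simpa using this
  rw [Contracts, ← hl, this]

/-- The algebra of which the spectrum is the affine blow-up of `Γ_r` in the unit over the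
different. -/
noncomputable abbrev blowup (D : NewtonSetting k) (r : ℕ) : QCSubalgebra (D.ν r) :=
  D.ℬ r (D.Γunit r)

lemma good_blowup : Good ((D.blowup r).toBase ≫ D.p₁ r) := by
  refine good_of_dominant (D.blowup r).fromSource _ fun x ↦ ?_
  rw [← Scheme.Hom.comp_apply, ← Category.assoc, QCSubalgebra.fromSource_toBase]
  exact p₁_ν x

/-- On the affine blow-up, the ideal `I` of the unit over the different is divisible by the equation
of the different, because `I(Δ_r)` belongs to the algebra. -/
lemma contracts_blowup : Contracts (D.blowup r).toBase := by
  rw [contracts_iff_ker_le]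
  have key (z : D.Γ r) : ∃ W : (D.Γ r).affineOpens, z ∈ W.1 ∧ (D.ιΔ ≫ D.Γunit r).ker.ideal W ≤
      ((D.IΔ.comap ((D.blowup r).toBase ≫ D.p₁ r)).map (D.blowup r).toBase).ideal W := by
    obtain ⟨c, hc⟩ := D.exists_chart (D.p₁ r z)
    obtain ⟨W, hW, hzW, hle⟩ := exists_isAffineOpen_mem_and_subset (U := D.p₁ r ⁻¹ᵁ c.V) (x := z) hc
    refine ⟨⟨W, hW⟩, hzW, fun i hi ↦ ?_⟩
    have hW' : IsAffineOpen ((D.blowup r).toBase ⁻¹ᵁ W) := hW.preimage _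
    rw [Scheme.IdealSheafData.ideal_map _ _ ⟨W, hW⟩ hW']
    have e : (D.blowup r).toBase ⁻¹ᵁ W ≤ ((D.blowup r).toBase ≫ D.p₁ r) ⁻¹ᵁ c.V :=
      (D.blowup r).toBase.preimage_mono hle
    obtain ⟨ρ, hρ⟩ := c.exists_pow_mul_eq (q := D.p₁ r) p₁_ν (D.blowup r) (comap_fg _ _) 1
      (fun W _ hf ↦ Subring.subset_closure (.inr hf)) hW hle e hi
    have h := c.comap_IΔ_ideal ((D.blowup r).toBase ≫ D.p₁ r) hW' e
    have hm : ((D.blowup r).toBase.appLE W _ le_rfl).hom i ∈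
        (D.IΔ.comap ((D.blowup r).toBase ≫ D.p₁ r)).ideal ⟨_, hW'⟩ := by
      rw [h, ← hρ, pow_one]
      exact Ideal.mul_mem_right _ _ (Ideal.mem_span_singleton_self _)
    rw [← Scheme.Hom.app_eq_appLE] at hm
    exact hm
  choose W hW h using key
  exact Scheme.IdealSheafData.le_of_iSup_eq_top W (top_le_iff.mp fun z _ ↦
    TopologicalSpace.Opens.mem_iSup.mpr ⟨z, hW z⟩) h

lemma ν_transition (hr : 2 ≤ r) : D.ν (r + 1) ≫ D.transition hr = D.ν r := by
  have h : (D.ν (r + 1) ≫ D.transition hr) ≫ D.π r = 𝟙 _ ≫ D.j := by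
    rw [Category.assoc, transition_π, ν_π, Category.id_comp]
  exact ((D.𝒜 r).eq_fromSource_of_toBase_eq h).trans (Category.id_comp _)

/-- The generators `I(Δ_r)` of the algebra of the blow-up extend to functions on `Γ_{r+1}`, because
the transition morphism contracts the preimage of the different. -/
lemma exists_lift_blowup (hr : 2 ≤ r) :
    ∃ t : D.Γ (r + 1) ⟶ (D.blowup r).relSpec, t ≫ (D.blowup r).toBase = D.transition hr := by
  refine SectionFamily.exists_relSpec_lift _ (D.transition hr) (D.ν (r + 1)) (𝟙 _)
    ((ν_transition hr).trans (Category.id_comp _).symm) fun s ↦ ?_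
  obtain ⟨c, hc⟩ := D.exists_chart (D.p₁ r (D.transition hr s))
  obtain ⟨W, hW, hsW, hle⟩ := exists_isAffineOpen_mem_and_subset (U := D.p₁ r ⁻¹ᵁ c.V)
    (x := D.transition hr s) hc
  have hW' : IsAffineOpen (D.transition hr ⁻¹ᵁ W) := hW.preimage _
  have e' : D.ν (r + 1) ⁻¹ᵁ (D.transition hr ⁻¹ᵁ W) ≤ (𝟙 D.UU.toScheme) ⁻¹ᵁ (D.ν r ⁻¹ᵁ W) := by
    rw [← Scheme.Hom.comp_preimage, ν_transition, ← Scheme.Hom.comp_preimage, Category.id_comp]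
  have hcon : Contracts (D.transition hr) := by
    have := contracts_transition hr (𝟙 (D.Γ (r + 1)))
    rwa [Category.id_comp] at this
  rw [contracts_iff_ker_le] at hcon
  refine ⟨⟨W, hW⟩, D.transition hr ⁻¹ᵁ W, hsW, le_rfl, e', fun f hf ↦ ?_⟩
  refine c.exists_app_eq (q := D.p₁ r) p₁_ν (comap_fg _ _) 1
    ((ν_transition hr).trans (Category.id_comp _).symm) hW hle le_rfl e' (fun z hz ↦ ?_) hf
  have e : D.transition hr ⁻¹ᵁ W ≤ (D.transition hr ≫ D.p₁ r) ⁻¹ᵁ c.V :=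
    (D.transition hr).preimage_mono hle
  have hz' := hcon ⟨W, hW⟩ hz
  rw [Scheme.IdealSheafData.ideal_map _ _ ⟨W, hW⟩ hW'] at hz'
  have h := c.comap_IΔ_ideal (D.transition hr ≫ D.p₁ r) hW' e
  have hm : ((D.transition hr).appLE W _ le_rfl).hom z ∈
        (D.IΔ.comap (D.transition hr ≫ D.p₁ r)).ideal ⟨_, hW'⟩ := by
    rw [← Scheme.Hom.app_eq_appLE]; exact hz'
  rw [h, ← appLE_appLE_apply _ _ hle le_rfl e] at hm
  rwa [pow_one]

/-- The groupoid `Γ_{r+1}` is the affine blow-up of `Γ_r`: both have the universal property that the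
preimage of the different is contracted to the unit. -/
lemma exists_iso_blowup (hr : 2 ≤ r) : ∃ σ : D.Γ (r + 1) ≅ (D.blowup r).relSpec,
    σ.hom ≫ (D.blowup r).toBase = D.transition hr ∧
      D.ν (r + 1) ≫ σ.hom = (D.blowup r).fromSource := by
  obtain ⟨t, ht⟩ := exists_lift_blowup (D := D) hr
  obtain ⟨v, hv⟩ := (contracts_blowup (D := D) (r := r)).exists_lift hr good_blowup
  refine ⟨⟨t, v, ?_, ?_⟩, ht, ?_⟩
  · refine hom_ext_transition hr ?_ ?_
    · rw [Category.assoc, ← transition_p₁ hr, ← Category.assoc v, hv, ← Category.assoc, ht,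
        transition_p₁]
      exact good_p₁ _
    · rw [Category.assoc, hv, ht, Category.id_comp]
  · refine (D.blowup r).hom_ext_of_isSchemeTheoreticallyDominant ?_ (D.blowup r).fromSource
      (a := 𝟙 _) ?_
    · rw [Category.assoc, ht, hv, Category.id_comp]
    · rw [Category.assoc, ht, hv, QCSubalgebra.fromSource_toBase, Category.id_comp]
  · have := (D.blowup r).eq_fromSource_of_toBase_eq (t := D.ν (r + 1) ≫ t) (a := 𝟙 _)
      (by rw [Category.assoc, ht, ν_transition, Category.id_comp])
    rwa [Category.id_comp] at this

lemma ιΔΔ_pr₁ : D.ιΔΔ ≫ D.pr₁ = pullback.fst (D.ιΔ ≫ D.pX) (D.ιΔ ≫ D.pX) ≫ D.ιΔ :=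
  pullback.lift_fst _ _ _

lemma ιΔΔ_pr₂ : D.ιΔΔ ≫ D.pr₂ = pullback.snd (D.ιΔ ≫ D.pX) (D.ιΔ ≫ D.pX) ≫ D.ιΔ :=
  pullback.lift_snd _ _ _

/-- Over `Δ × Δ` the two projections of `Γ_{r+1}` agree, and the transition morphism is the unit. -/
lemma mapΔ_transition (hr : 2 ≤ r) (q : D.ΔΔ ⟶ D.Δ)
    (hq : q = pullback.fst (D.ιΔ ≫ D.pX) (D.ιΔ ≫ D.pX) ∨
      q = pullback.snd (D.ιΔ ≫ D.pX) (D.ιΔ ≫ D.pX)) :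
    D.mapΔ (D.transition hr) (transition_π hr) = pullback.snd (D.π (r + 1)) D.ιΔΔ ≫ q ≫
      D.unitΔ (D.Γunit r) Γunit_p₁ Γunit_p₂ := by
  have hr' : 2 ≤ r + 1 := by omega
  set t := pullback.fst (D.π (r + 1)) D.ιΔΔ with ht
  set w := pullback.snd (D.π (r + 1)) D.ιΔΔ with hw
  set w₁ := pullback.fst (D.ιΔ ≫ D.pX) (D.ιΔ ≫ D.pX) with hw₁
  set w₂ := pullback.snd (D.ιΔ ≫ D.pX) (D.ιΔ ≫ D.pX) with hw₂
  have h₁ : t ≫ D.p₁ (r + 1) = (w ≫ w₁) ≫ D.ιΔ := by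
    rw [p₁, ← Category.assoc, pullback.condition, Category.assoc, ιΔΔ_pr₁,
      Category.assoc]
  have h₂ : t ≫ D.p₂ (r + 1) = (w ≫ w₂) ≫ D.ιΔ := by
    rw [p₂, ← Category.assoc, pullback.condition, Category.assoc, ιΔΔ_pr₂,
      Category.assoc]
  have h₁₂ : w ≫ w₁ = w ≫ w₂ := by
    rw [← cancel_mono D.ιΔ, ← h₂]
    exact (p₂_eq_comp_ιΔ hr' h₁).symm
  have hwq : w ≫ q = w ≫ w₁ := by rcases hq with rfl | rfl <;> [rfl; exact h₁₂.symm]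
  rw [← Category.assoc, hwq]
  apply pullback.hom_ext
  · rw [mapΔ, pullback.map, pullback.lift_fst, unitΔ, Category.assoc, pullback.lift_fst]
    exact transition_eq_of_p₁ hr _ _ h₁
  · rw [mapΔ, pullback.map, pullback.lift_snd, unitΔ, Category.assoc, pullback.lift_snd]
    apply pullback.hom_ext
    · rw [Category.assoc, Category.assoc, pullback.lift_fst, Category.comp_id, Category.id_comp]
    · rw [Category.assoc, Category.assoc, pullback.lift_snd, Category.comp_id, Category.id_comp]
      exact h₁₂.symm

end NewtonSetting

end Newton

theorem mainTheorem6 {k : Type u} [Field k] (D : NewtonSetting k) (r : ℕ) (hr : 2 ≤ r) :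
    ∃ (G : SchemeGroupoid (D.p₁ r) (D.p₂ r))
      (G' : SchemeGroupoid (D.p₁ (r + 1)) (D.p₂ (r + 1))),
      -- the groupoid structures on `Γ_r` and `Γ_{r+1}` are unique
      (∀ H : SchemeGroupoid (D.p₁ r) (D.p₂ r), H = G) ∧
      (∀ H : SchemeGroupoid (D.p₁ (r + 1)) (D.p₂ (r + 1)), H = G') ∧
      ∃ (f : D.Γ (r + 1) ⟶ D.Γ r) (hf : f ≫ D.π r = D.π (r + 1)),
        -- (i)
        (∀ g : D.Γ (r + 1) ⟶ D.Γ r, g ≫ D.π r = D.π (r + 1) → g = f) ∧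
        G'.IsHom G f ∧
        -- (ii)
        D.mapΔ f hf = pullback.snd (D.π (r + 1)) D.ιΔΔ ≫
          pullback.fst (D.ιΔ ≫ D.pX) (D.ιΔ ≫ D.pX) ≫
            D.unitΔ G.unit G.unit_source G.unit_target ∧
        D.mapΔ f hf = pullback.snd (D.π (r + 1)) D.ιΔΔ ≫
          pullback.snd (D.ιΔ ≫ D.pX) (D.ιΔ ≫ D.pX) ≫
            D.unitΔ G.unit G.unit_source G.unit_target ∧
        -- (iii)
        IsAffineHom f ∧
        D.IΔ.comap (D.p₁ r) = D.IΔ.comap (D.p₂ r) ∧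
        IsOpenImmersion (D.ν r) ∧
        (∃ σ : D.Γ (r + 1) ≅ (D.ℬ r G.unit).relSpec,
          σ.hom ≫ (D.ℬ r G.unit).toBase = f ∧
          D.ν (r + 1) ≫ σ.hom = (D.ℬ r G.unit).fromSource) ∧
        -- (iv), for the structure morphisms `p₁` and `p₂`
        (∀ {S : Scheme.{u}} (g : S ⟶ D.X), Flat g →
          (∀ h h' : S ⟶ D.Γ (r + 1), h ≫ D.p₁ (r + 1) = g → h' ≫ D.p₁ (r + 1) = g →
            h ≫ f = h' ≫ f → h = h') ∧
          (∀ a : S ⟶ D.Γ r, a ≫ D.p₁ r = g →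
            ((∃ h : S ⟶ D.Γ (r + 1), h ≫ D.p₁ (r + 1) = g ∧ h ≫ f = a) ↔
              pullback.fst g D.ιΔ ≫ a = pullback.snd g D.ιΔ ≫ D.ιΔ ≫ G.unit))) ∧
        (∀ {S : Scheme.{u}} (g : S ⟶ D.X), Flat g →
          (∀ h h' : S ⟶ D.Γ (r + 1), h ≫ D.p₂ (r + 1) = g → h' ≫ D.p₂ (r + 1) = g →
            h ≫ f = h' ≫ f → h = h') ∧
          (∀ a : S ⟶ D.Γ r, a ≫ D.p₂ r = g →
            ((∃ h : S ⟶ D.Γ (r + 1), h ≫ D.p₂ (r + 1) = g ∧ h ≫ f = a) ↔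
              pullback.fst g D.ιΔ ≫ a = pullback.snd g D.ιΔ ≫ D.ιΔ ≫ G.unit))) := by
  have hr' : 2 ≤ r + 1 := by omega
  refine ⟨D.groupoid hr, D.groupoid hr', NewtonSetting.groupoid_unique hr,
    NewtonSetting.groupoid_unique hr', D.transition hr, NewtonSetting.transition_π hr,
    NewtonSetting.eq_transition hr, NewtonSetting.isHom_transition hr hr',
    NewtonSetting.mapΔ_transition hr _ (.inl rfl), NewtonSetting.mapΔ_transition hr _ (.inr rfl),
    inferInstance, NewtonSetting.IΔ_comap_p₁_eq hr, inferInstance,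
    NewtonSetting.exists_iso_blowup hr, fun {S} g hg ↦ ⟨fun h h' hh _ H ↦ ?_, fun a ha ↦ ?_⟩,
    fun {S} g hg ↦ ⟨fun h h' hh _ H ↦ ?_, fun a ha ↦ ?_⟩⟩
  · exact NewtonSetting.hom_ext_transition hr (hh ▸ NewtonSetting.good_of_flat g) H
  · refine Iff.trans ?_ (NewtonSetting.contracts_iff ha)
    rw [← NewtonSetting.exists_lift_iff hr a (ha ▸ NewtonSetting.good_of_flat g)]
    refine exists_congr fun h ↦ and_iff_right_of_imp fun hh ↦ ?_
    rw [← ha, ← hh, Category.assoc, NewtonSetting.transition_p₁]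
  · subst hh
    exact NewtonSetting.hom_ext_transition hr (NewtonSetting.good_p₁_of_flat_p₂ hr' hg) H
  · refine Iff.trans ?_ (NewtonSetting.contracts_iff' hr ha)
    subst ha
    rw [← NewtonSetting.exists_lift_iff hr a (NewtonSetting.good_p₁_of_flat_p₂ hr hg)]
    refine exists_congr fun h ↦ and_iff_right_of_imp fun hh ↦ ?_
    rw [← hh, Category.assoc, NewtonSetting.transition_p₂]
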